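/- **Setting.** Sensors $i\in\mathcal V=\{1,\dots,N\}$, times $k=1,2,\dots$. Let $\mathcal A^{(u)}=(a^{(u)}_{ij})$, $u=1,\dots,M$, be symmetric non-negative weight matrices, $\mathcal E^{(u)}=\{(i,j):a^{(u)}_{ij}>0\}$, $\mathcal E=\bigcup_u\mathcal E^{(u)}$, $\mathcal N_i=\{j:(i,j)\in\mathcal E\}$, $\mathbb G_{ij}=\{u:(i,j)\in\mathcal E^{(u)}\}$. The graph at time $k$ is $\mathtt G_k=\mathcal G^{(\mathtt m_k)}$, where $\{\mathtt m_k\}$ is a homogeneous Markov chain on $\{1,\dots,M\}$ with $\pi_u=\lim_k\mathbb P\{\mathtt m_k=u\}$; put $q_{ij,k}=\mathbb P\{(i,j)\in\mathcal E^{(\mathtt m_k)}\}$. Sensor $i$ observes $\mathtt y_{i,k}=\mathtt H_{i,k}\theta+\mathtt w_{i,k}\in\mathbb R^{m_i}$, $\theta\in\mathbb R^n$, $n\ge1$. Let $\varphi_k\in\mathbb R^n$ be the $l$-th unit vector if $k=nq+l$, $q\geq 0$, $1\le l\le n$. Whenever $(i,j)\in\mathcal E^{(\mathtt m_k)}$,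 sensor $i$ sends to $j$ the signal $\mathtt s_{ij,k}=1$ if $\varphi_k^\top\hat\uptheta_{i,k-1}+\mathtt d_{ij,k}\le C_{ij}$ and $\mathtt s_{ij,k}=-1$ otherwise, and $$\hat\uptheta_{i,k}=\hat\uptheta_{i,k-1}+\varphi_k\sum_{j:(i,j)\in\mathcal E^{(\mathtt m_k)}}\alpha_{ij,k}a^{(\mathtt m_k)}_{ij}(\mathtt s_{ij,k}-\mathtt s_{ji,k})+\beta_{i,k}\bar H_i^\top(\mathtt y_{i,k}-\bar H_i\hat\uptheta_{i,k-1}),$$ with deterministic $\hat\uptheta_{i,0}$, $C_{ij}=C_{ji}$, $\alpha_{ij,k}=\alpha_{ji,k}>0$, $\beta_{i,k}\ge0$. Put $Q_i=\bar H_i^\top\bar H_i$; $\lambda_{\max}$ and $\lambda^+_{\min}$ are the largest and the smallest positive eigenvalue, and $\leq$ between matrices is the Loewner order. **Assumptions.** (a) $\mathbb E\mathtt H_{i,k}=\bar H_i$ and $\sum_i\bar H_i^\top\bar H_i$ is invertible. (b) The $\mathtt w_{i,k},\mathtt H_{i,k}$ are mutually independent, jointly independent of $\{\mathtt G_k\}$,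 $\mathbb E\mathtt w_{i,k}=0$, and $\sup_{i,k}\mathbb E\|\mathtt w_{i,k}\|^\rho<\infty$, $\sup_{i,k}\mathbb E\|\mathtt H_{i,k}-\bar H_i\|^\rho<\infty$ for some $\rho>2$. (c) For $(i,j)\in\mathcal E$, the noise $\mathtt d_{ij,k}$ has distribution function $F_{ij,k}=F_{ji,k}$ and a density $f_{ij,k}$, with $\eta_{ij,k}=\sup_x f_{ij,k}^2(x)/\big(F_{ij,k}(x)(1-F_{ij,k}(x))\big)<\infty$ (where $0/0=0$); the $\mathtt d_{ij,k}$, $(i,j)\in\mathcal E$, are mutually independent and jointly independent of all $\mathtt w,\mathtt H,\mathtt G$. (d) $\sum_k\beta_{i,k}^2<\infty$, $\beta_{i,k}=O(\beta_{i,k+1})$, and $\sum_k z_k=\infty$, where $z_k$ is the minimum of all $\alpha_{ij,k}\zeta_{ij,k}$, $(i,j)\in\mathcal E$, and all $\beta_{i,k}$, for some real sequences $\zeta_{ij,k}$. (e) $\beta_{i,k}\lambda_{\max}(Q_i)<1$ for all $i,k$. (f) $\sum_{t\ge1}\eta_{ij,t}\prod_{l=1}^t(1-\lambda^+_{\min}(Q_i)\beta_{i,l})^2<\infty$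 for all $(i,j)\in\mathcal E$ with $Q_i\ne0$. **Fisher information.** Let $\mathtt S_T$ be the family of all signals sent in the network at the times $1,\dots,T$ (including who sends to whom). For $y\in\mathbb R^{m_i}$ let $\mathbb P(\mathtt S_T=s\,|\,y)$ be the probability that $\mathtt S_T=s$ when the value of $\mathtt y_{i,k}$ is replaced by $y$, and put $\mathcal I_{\mathtt S_T}(y)=\sum_s\mathbb P(s|y)\,[\partial_y\ln\mathbb P(s|y)][\partial_y\ln\mathbb P(s|y)]^\top$ and $\mathbb E\mathcal I_{\mathtt S}(\mathtt y_{i,k})=\lim_{T\to\infty}\mathbb E\,\mathcal I_{\mathtt S_T}(\mathtt y_{i,k})$. The information about $\mathtt y_{i,k}$ is called *defined* if, for all $T$ and $s$, $\mathbb P(\mathtt S_T=s|\cdot)$ is differentiable at $\mathtt y_{i,k}$ almost surely. **Theorem.** Suppose (a)–(f). 1. $\mathbb P(\mathtt S_T=s\,|\,y)$ is a version of the conditional probability of $\mathtt S_T=s$ given $\mathtt y_{i,k}=y$. The information about $\mathtt y_{i,k}$ is defined if $F_{uv,t}'=f_{uv,t}$ everywhere for all $(u,v)\in\mathcal E$ and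 all $t$, and also if $\mathtt y_{i,k}$ has a density. 2. Whenever the information about $\mathtt y_{i,k}$ is defined, the expectations and the limit defining $\mathbb E\mathcal I_{\mathtt S}(\mathtt y_{i,k})$ exist and $$\mathbb E\mathcal I_{\mathtt S}(\mathtt y_{i,k})\le\sum_{j\in\mathcal N_i}\sum_{t=k+1}^\infty\beta_{i,k}^2\,q_{ij,t}\,\eta_{ij,t}\Big(\prod_{l=k+1}^{t-1}\big(1-\lambda^+_{\min}(Q_i)\beta_{i,l}\big)\Big)^2\bar H_i\bar H_i^\top<\infty$$ (for $\bar H_i=0$ every term of the series is the zero matrix). 3. Suppose moreover that $\mathbb P\{\mathtt m_1=u\}=\pi_u$ for all $u$; that $\eta_{ij,1}>0$, $\epsilon_{ij}\ge0$ and $\eta_{ij,k}\le\eta_{ij,1}/k^{2\epsilon_{ij}}$ for $(i,j)\in\mathcal E$ and all $k$; that $\beta_{i,k}=b_i/k^{\delta_i}$ for $k\ge k_{i,0}$ and $\beta_{i,k}=0$ for $k<k_{i,0}$, with $\delta_i\in(1/2,1]$ and $b_i\in(0,k_{i,0}^{\delta_i})$; and that $2\lambda^+_{\min}(Q_i)b_i+2\epsilon_{ij}>1$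 for $(i,j)\in\mathcal E$ with $Q_i\ne0$. Let $$R_{ij,k}=\begin{cases}\dfrac{b_i}{2\lambda^+_{\min}(Q_i)b_i+2\epsilon_{ij}-1}\cdot\dfrac{(k+1)^{2\lambda^+_{\min}(Q_i)b_i}\,k^{2\epsilon_{ij}}}{(k-1)^{2\lambda^+_{\min}(Q_i)b_i+2\epsilon_{ij}}},&\delta_i=1,\\[2ex]\dfrac{b_i\,\exp\!\Big(\frac{2\lambda^+_{\min}(Q_i)b_i}{1-\delta_i}\big((k+1)^{1-\delta_i}-k^{1-\delta_i}\big)\Big)}{2\lambda^+_{\min}(Q_i)b_i-\max(\delta_i-2\epsilon_{ij},0)\,k^{\delta_i-1}},&\delta_i<1.\end{cases}$$ Then, for $k\ge1$ if $\delta_i<1$ and for $k\ge2$ if $\delta_i=1$, whenever the information about $\mathtt y_{i,k}$ is defined, $$\mathbb E\mathcal I_{\mathtt S}(\mathtt y_{i,k})\le\sum_{j\in\mathcal N_i}\sum_{u\in\mathbb G_{ij}}\pi_u\,R_{ij,k}\,\beta_{i,k}\,\frac{\eta_{ij,1}}{k^{2\epsilon_{ij}}}\,\bar H_i\bar H_i^\top,$$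 (the right-hand side is $0$ if $\bar H_i=0$) and the right-hand side is $O\big(\sum_{j\in\mathcal N_i}k^{-(\delta_i+2\epsilon_{ij})}\big)$ as $k\to\infty$. If the information is defined for all $i,k$, then $\mathbb E\mathcal I_{\mathtt S}(\mathtt y_{i,k})=O\big(\sum_{j\in\mathcal N_i}k^{-(\delta_i+2\epsilon_{ij})}\big)$, and the algorithm achieves dynamically enhanced privacy: whenever $\mathbb E\mathcal I_{\mathtt S}(\mathtt y_{i,k})$ is positive definite there is $T>k$ such that $\mathbb E\mathcal I_{\mathtt S}(\mathtt y_{i,k})-\mathbb E\mathcal I_{\mathtt S}(\mathtt y_{i,t})$ is positive definite for all $t\ge T$; likewise, for every $v$ with $v^\top\mathbb E\mathcal I_{\mathtt S}(\mathtt y_{i,k})v>0$ there is $T>k$ with $v^\top\mathbb E\mathcal I_{\mathtt S}(\mathtt y_{i,t})v<v^\top\mathbb E\mathcal I_{\mathtt S}(\mathtt y_{i,k})v$ for all $t\ge T$. -/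

import Mathlib

open MeasureTheory ProbabilityTheory Filter Topology Asymptotics
open scoped Matrix

noncomputable section

namespace PrivEst

/-- Deterministic data: the topology graphs `1, …, M` through their weighted adjacency matrices
`a u`, the mean measurement matrices, and the inputs of the algorithm.  Times are `1, 2, 3, …`;
values at time `0` are never used.  The step-sizes `β` are allowed to vanish. -/
structure Model (N n M : ℕ) (m : Fin N → ℕ) where
  /-- weighted adjacency matrices -/
  a : Fin M → Fin N → Fin N → ℝ
  a_nonneg : ∀ u i j, 0 ≤ a u i j
  a_symm : ∀ u i j, a u i j = a u j i
  /-- mean measurement matrices -/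
  Hbar : (i : Fin N) → Matrix (Fin (m i)) (Fin n) ℝ
  /-- initial estimates -/
  est0 : Fin N → Fin n → ℝ
  /-- thresholds of the quantizers -/
  C : Fin N → Fin N → ℝ
  C_symm : ∀ i j, C i j = C j i
  /-- step-sizes of the information fusion -/
  α : Fin N → Fin N → ℕ → ℝ
  α_symm : ∀ i j k, α i j k = α j i k
  α_pos : ∀ i j k, 1 ≤ k → (∃ u, 0 < a u i j) → 0 < α i j k
  /-- step-sizes of the estimate update -/
  β : Fin N → ℕ → ℝ
  β_nonneg : ∀ i k, 1 ≤ k → 0 ≤ β i k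

/-- The random objects: the unknown parameter `θ`, the switching chain, observation noises,
random measurement matrices, privacy noises, and the density functions of the privacy noises. -/
structure Env (N n M : ℕ) (m : Fin N → ℕ) (Ω : Type*) [MeasurableSpace Ω] where
  θ : Fin n → ℝ
  chain : ℕ → Ω → Fin M
  chain_meas : ∀ k, Measurable (chain k)
  w : (i : Fin N) → ℕ → Ω → Fin (m i) → ℝ
  w_meas : ∀ i k, Measurable (w i k)
  H : (i : Fin N) → ℕ → Ω → Matrix (Fin (m i)) (Fin n) ℝ
  H_meas : ∀ i k r c, Measurable fun ω => H i k ω r c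
  d : Fin N → Fin N → ℕ → Ω → ℝ
  d_meas : ∀ i j k, Measurable (d i j k)
  f : Fin N → Fin N → ℕ → ℝ → ℝ

/-- Largest eigenvalue. -/
def lamMax {n : ℕ} (Q : Matrix (Fin n) (Fin n) ℝ) : ℝ :=
  sSup {x : ℝ | Module.End.HasEigenvalue (Matrix.toLin' Q) x}

/-- Smallest positive eigenvalue (only meaningful for a nonzero positive semidefinite `Q`). -/
def lamMinPos {n : ℕ} (Q : Matrix (Fin n) (Fin n) ℝ) : ℝ :=
  sInf {x : ℝ | 0 < x ∧ Module.End.HasEigenvalue (Matrix.toLin' Q) x}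

/-- Operator norm induced by the Euclidean norms. -/
def matNorm {r c : ℕ} (A : Matrix (Fin r) (Fin c) ℝ) : ℝ :=
  ‖(Matrix.toEuclideanLin A).toContinuousLinearMap‖

/-- The compression vector: `φ_k` with `k = n q + l`, `1 ≤ l ≤ n`, is the `l`-th unit vector. -/
def phi (n : ℕ) [NeZero n] (k : ℕ) : Fin n → ℝ := Pi.single (Fin.ofNat n (k - 1)) 1

/-- Dynamically enhanced privacy for a family of matrices `J i k`
(the information about the observation of sensor `i` at time `k ≥ 1`), with `A < B` meaning that
`B - A` is positive definite. -/
def DynamicallyEnhanced {N : ℕ} {m : Fin N → ℕ}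
    (J : (i : Fin N) → ℕ → Matrix (Fin (m i)) (Fin (m i)) ℝ) : Prop :=
  ∀ i k, 1 ≤ k → (J i k).PosDef → ∃ T, k < T ∧ ∀ t, T ≤ t → (J i k - J i t).PosDef

/-- The same requirement read direction by direction, which is not void for singular `J i k`. -/
def DirectionallyEnhanced {N : ℕ} {m : Fin N → ℕ}
    (J : (i : Fin N) → ℕ → Matrix (Fin (m i)) (Fin (m i)) ℝ) : Prop :=
  ∀ i k, 1 ≤ k → ∀ v : Fin (m i) → ℝ, 0 < v ⬝ᵥ (J i k *ᵥ v) →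
    ∃ T, k < T ∧ ∀ t, T ≤ t → v ⬝ᵥ (J i t *ᵥ v) < v ⬝ᵥ (J i k *ᵥ v)

/-- The constants `R_{ij,k}`, with `lam = λ⁺_min(Q_i)`, `b = β_{i,1}`, `δ = δ_i`, `ε = ε_{ij}`. -/
def rateConst (lam b δ ε : ℝ) (k : ℕ) : ℝ :=
  if δ = 1 then
    b / (2 * lam * b + 2 * ε - 1) *
      (((k : ℝ) + 1) ^ (2 * lam * b) * (k : ℝ) ^ (2 * ε) /
        ((k : ℝ) - 1) ^ (2 * lam * b + 2 * ε))
  else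
    b / (2 * lam * b - max (δ - 2 * ε) 0 * (k : ℝ) ^ (δ - 1)) *
      Real.exp (2 * lam * b / (1 - δ) * (((k : ℝ) + 1) ^ (1 - δ) - (k : ℝ) ^ (1 - δ)))

/-! ### The algorithm, as a function of the realized graphs, observations and privacy noises -/

section Algorithm

variable {N n M : ℕ} [NeZero n] {m : Fin N → ℕ}

/-- `(i, j)` is an edge of the union graph. -/
def Model.Edge (S : Model N n M m) (i j : Fin N) : Prop := ∃ u, 0 < S.a u i j

open Classical in
/-- Neighbours of `i` in the union graph. -/
def Model.nbr (S : Model N n M m) (i : Fin N) : Finset (Fin N) :=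
  Finset.univ.filter fun j => S.Edge i j

open Classical in
/-- Indices of the graphs that contain the edge `(i, j)`. -/
def Model.graphsWith (S : Model N n M m) (i j : Fin N) : Finset (Fin M) :=
  Finset.univ.filter fun u => 0 < S.a u i j

/-- `Q_i = H̄_iᵀ H̄_i`. -/
def Model.Q (S : Model N n M m) (i : Fin N) : Matrix (Fin n) (Fin n) ℝ :=
  (S.Hbar i)ᵀ * S.Hbar i

open Classical in
/-- The signal that `i` sends to `j` at time `k`: `1` or `-1`, computed from the previous estimate
`x i`, if `(i, j)` is an edge of the current graph `g`; the value `0` records that there is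
no transmission. -/
def Model.sendSignal (S : Model N n M m) (g : Fin N → Fin N → ℝ) (d : Fin N → Fin N → ℝ)
    (k : ℕ) (x : Fin N → Fin n → ℝ) (i j : Fin N) : SignType :=
  if 0 < g i j then (if phi n k ⬝ᵥ x i + d i j ≤ S.C i j then 1 else -1) else 0

open Classical in
/-- The estimates after `k` steps, for graph path `g`, observations `y` and privacy noises `d`. -/
def Model.est (S : Model N n M m) (g : ℕ → Fin N → Fin N → ℝ)
    (y : (i : Fin N) → ℕ → Fin (m i) → ℝ) (d : Fin N → Fin N → ℕ → ℝ) :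
    ℕ → Fin N → Fin n → ℝ
  | 0 => S.est0
  | k + 1 => fun i =>
      let x := S.est g y d k
      let s := S.sendSignal (g (k + 1)) (fun i j => d i j (k + 1)) (k + 1) x
      let fused : Fin n → ℝ := x i +
        (∑ j ∈ Finset.univ.filter (fun j => 0 < g (k + 1) i j),
          S.α i j (k + 1) * g (k + 1) i j * ((s i j : ℝ) - (s j i : ℝ))) • phi n (k + 1)
      fused + S.β i (k + 1) • ((S.Hbar i)ᵀ *ᵥ (y i (k + 1) - S.Hbar i *ᵥ x i))

/-- All signals transmitted in the network at the times `1, …, T`. -/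
def Model.record (S : Model N n M m) (g : ℕ → Fin N → Fin N → ℝ)
    (y : (i : Fin N) → ℕ → Fin (m i) → ℝ) (d : Fin N → Fin N → ℕ → ℝ) (T : ℕ) :
    Fin T → Fin N → Fin N → SignType :=
  fun t => S.sendSignal (g (t + 1)) (fun i j => d i j (t + 1)) (t + 1) (S.est g y d t)

end Algorithm

/-! ### The stochastic system -/

section System

variable {N n M : ℕ} [NeZero n] {m : Fin N → ℕ} {Ω : Type*} [MeasurableSpace Ω]

/-- The observation `y_{i,k} = H_{i,k} θ + w_{i,k}`. -/
def Env.obs (X : Env N n M m Ω) (i : Fin N) (k : ℕ) (ω : Ω) : Fin (m i) → ℝ :=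
  X.H i k ω *ᵥ X.θ + X.w i k ω

/-- The (weighted) communication graph at time `k`. -/
def Env.graph (S : Model N n M m) (X : Env N n M m Ω) (k : ℕ) (ω : Ω) : Fin N → Fin N → ℝ :=
  S.a (X.chain k ω)

/-- `q_{ij,k}`: the probability that `(i, j)` is an edge at time `k`. -/
def Env.q (S : Model N n M m) (X : Env N n M m Ω) (μ : Measure Ω) (i j : Fin N) (k : ℕ) : ℝ :=
  μ.real {ω | 0 < X.graph S k ω i j}

/-- Distribution function of the privacy noise. -/
def Env.F (X : Env N n M m Ω) (μ : Measure Ω) (i j : Fin N) (k : ℕ) (x : ℝ) : ℝ :=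
  cdf (μ.map (X.d i j k)) x

/-- The quotient `f² / (F (1 - F))` (with `0 / 0 = 0`). -/
def Env.etaFun (X : Env N n M m Ω) (μ : Measure Ω) (i j : Fin N) (k : ℕ) (x : ℝ) : ℝ :=
  X.f i j k x ^ 2 / (X.F μ i j k x * (1 - X.F μ i j k x))

/-- `η_{ij,k}`. -/
def Env.eta (X : Env N n M m Ω) (μ : Measure Ω) (i j : Fin N) (k : ℕ) : ℝ :=
  ⨆ x : ℝ, X.etaFun μ i j k x

/-- The signals transmitted up to time `T`. -/
def Env.signals (S : Model N n M m) (X : Env N n M m Ω) (T : ℕ) (ω : Ω) :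
    Fin T → Fin N → Fin N → SignType :=
  S.record (fun k => X.graph S k ω) (fun i k => X.obs i k ω) (fun i j k => X.d i j k ω) T

/-- The signals transmitted up to time `T` when the observation of sensor `i` at time `k`
has the value `y`. -/
def Env.signalsGiven (S : Model N n M m) (X : Env N n M m Ω) (i : Fin N) (k : ℕ)
    (y : Fin (m i) → ℝ) (T : ℕ) (ω : Ω) : Fin T → Fin N → Fin N → SignType :=
  S.record (fun k' => X.graph S k' ω)
    (Function.update (fun i' k' => X.obs i' k' ω) i
      (Function.update (fun k' => X.obs i k' ω) k y))
    (fun i j k => X.d i j k ω) T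

/-- The likelihood `ℙ(S_T = s | y)`, where `S_T` are the signals up to time `T` and `y` is the
value of the observation of sensor `i` at time `k`. -/
def Env.lik (S : Model N n M m) (X : Env N n M m Ω) (μ : Measure Ω) (i : Fin N) (k T : ℕ)
    (s : Fin T → Fin N → Fin N → SignType) (y : Fin (m i) → ℝ) : ℝ :=
  μ.real {ω | X.signalsGiven S i k y T ω = s}

/-- The score `∂ ln ℙ(S_T = s | y) / ∂y`. -/
def Env.score (S : Model N n M m) (X : Env N n M m Ω) (μ : Measure Ω) (i : Fin N) (k T : ℕ)
    (s : Fin T → Fin N → Fin N → SignType) (y : Fin (m i) → ℝ) : Fin (m i) → ℝ :=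
  fun r => fderiv ℝ (fun y' => Real.log (X.lik S μ i k T s y')) y (Pi.single r 1)

/-- Fisher information matrix of the signals up to time `T` with respect to `y`:
the conditional mean, given `y`, of the outer product of the score with itself. -/
def Env.fisher (S : Model N n M m) (X : Env N n M m Ω) (μ : Measure Ω) (i : Fin N) (k T : ℕ)
    (y : Fin (m i) → ℝ) : Matrix (Fin (m i)) (Fin (m i)) ℝ :=
  ∑ s : Fin T → Fin N → Fin N → SignType,
    X.lik S μ i k T s y • Matrix.vecMulVec (X.score S μ i k T s y) (X.score S μ i k T s y)

/-- The mean of the Fisher information of the signals up to time `T` about `y_{i,k}`. -/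
def Env.meanFisherUpTo (S : Model N n M m) (X : Env N n M m Ω) (μ : Measure Ω) (i : Fin N)
    (k T : ℕ) : Matrix (Fin (m i)) (Fin (m i)) ℝ :=
  Matrix.of fun r c => ∫ ω, X.fisher S μ i k T (X.obs i k ω) r c ∂μ

/-- `𝔼 I_S(y_{i,k})` for the whole signal sequence `S`: the limit over finite horizons. -/
def Env.meanFisher (S : Model N n M m) (X : Env N n M m Ω) (μ : Measure Ω) (i : Fin N)
    (k : ℕ) : Matrix (Fin (m i)) (Fin (m i)) ℝ :=
  limUnder atTop fun T => X.meanFisherUpTo S μ i k T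

/-- The Fisher information about `y_{i,k}` is defined: almost surely the likelihoods are
differentiable in `y` at `y = y_{i,k}`. -/
def Env.FisherDefined (S : Model N n M m) (X : Env N n M m Ω) (μ : Measure Ω) (i : Fin N)
    (k : ℕ) : Prop :=
  ∀ T s, ∀ᵐ ω ∂μ, DifferentiableAt ℝ (X.lik S μ i k T s) (X.obs i k ω)

/-! ### Assumptions -/

/-- The switching signal is a homogeneous Markov chain (started at time `1`) with transition
matrix `p`, and the law at time `k` converges to `π`. -/
structure Env.IsMarkov (X : Env N n M m Ω) (μ : Measure Ω) (p : Fin M → Fin M → ℝ)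
    (π : Fin M → ℝ) : Prop where
  p_nonneg : ∀ u v, 0 ≤ p u v
  p_sum : ∀ u, ∑ v, p u v = 1
  markov : ∀ k, 1 ≤ k → ∀ u : ℕ → Fin M,
    μ.real {ω | ∀ l ∈ Finset.Icc 1 (k + 1), X.chain l ω = u l} =
      μ.real {ω | ∀ l ∈ Finset.Icc 1 k, X.chain l ω = u l} * p (u k) (u (k + 1))
  limit : ∀ u, Tendsto (fun k => μ.real {ω | X.chain k ω = u}) atTop (𝓝 (π u))

/-- `H̄_i` is the mean of `H_{i,k}`, and `∑ H̄_iᵀ H̄_i` is invertible. -/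
structure Env.MeasurementAssumption (S : Model N n M m) (X : Env N n M m Ω)
    (μ : Measure Ω) : Prop where
  integrable : ∀ i k r c, 1 ≤ k → Integrable (fun ω => X.H i k ω r c) μ
  mean : ∀ i k r c, 1 ≤ k → ∫ ω, X.H i k ω r c ∂μ = S.Hbar i r c
  observable : IsUnit (∑ i, (S.Hbar i)ᵀ * S.Hbar i)

/-- The σ-algebra generated by `w_{i,k}`. -/
abbrev Env.sigW (X : Env N n M m Ω) (i : Fin N) (k : ℕ) : MeasurableSpace Ω :=
  MeasurableSpace.comap (X.w i k) inferInstance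

/-- The σ-algebra generated by `H_{i,k}`. -/
abbrev Env.sigH (X : Env N n M m Ω) (i : Fin N) (k : ℕ) : MeasurableSpace Ω :=
  MeasurableSpace.comap (fun ω (r : Fin (m i)) (c : Fin n) => X.H i k ω r c) inferInstance

/-- The σ-algebra generated by the graph at time `k`. -/
abbrev Env.sigG (S : Model N n M m) (X : Env N n M m Ω) (k : ℕ) : MeasurableSpace Ω :=
  MeasurableSpace.comap (X.graph S k) inferInstance

/-- The σ-algebra generated by `d_{ij,k}`. -/
abbrev Env.sigD (X : Env N n M m Ω) (i j : Fin N) (k : ℕ) : MeasurableSpace Ω :=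
  MeasurableSpace.comap (X.d i j k) inferInstance

/-- Observation noises and measurement matrices: (mutual) independence, centering, moments of an
order `ρ > 2`, independence of the graph sequence. -/
structure Env.NoiseAssumption (S : Model N n M m) (X : Env N n M m Ω)
    (μ : Measure Ω) : Prop where
  indep : iIndep (Sum.elim (fun e : Fin N × ℕ => X.sigW e.1 (e.2 + 1))
    (fun e : Fin N × ℕ => X.sigH e.1 (e.2 + 1))) μ
  centered : ∀ i k r, 1 ≤ k → Integrable (fun ω => X.w i k ω r) μ ∧ ∫ ω, X.w i k ω r ∂μ = 0
  moments : ∃ ρ : ℝ, 2 < ρ ∧ ∃ K : NNReal, ∀ i k, 1 ≤ k →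
    ∫⁻ ω, ENNReal.ofReal (‖WithLp.toLp 2 (X.w i k ω)‖ ^ ρ) ∂μ ≤ K ∧
    ∫⁻ ω, ENNReal.ofReal (matNorm (X.H i k ω - S.Hbar i) ^ ρ) ∂μ ≤ K
  indep_graph : Indep
    ((⨆ e : Fin N × ℕ, X.sigW e.1 (e.2 + 1)) ⊔ (⨆ e : Fin N × ℕ, X.sigH e.1 (e.2 + 1)))
    (⨆ k : ℕ, X.sigG S (k + 1)) μ

/-- Privacy noises: symmetric distributions `F_{ij,k} = F_{ji,k}`, densities, finite `η_{ij,k}`,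
(mutual) independence, independence of everything else. -/
structure Env.PrivacyNoiseAssumption (S : Model N n M m) (X : Env N n M m Ω)
    (μ : Measure Ω) : Prop where
  symm : ∀ i j k, 1 ≤ k → S.Edge i j → X.F μ i j k = X.F μ j i k
  dens_meas : ∀ i j k, 1 ≤ k → S.Edge i j → Measurable (X.f i j k)
  dens_nonneg : ∀ i j k, 1 ≤ k → S.Edge i j → ∀ x, 0 ≤ X.f i j k x
  dens : ∀ i j k, 1 ≤ k → S.Edge i j →
    μ.map (X.d i j k) = volume.withDensity fun x => ENNReal.ofReal (X.f i j k x)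
  eta_finite : ∀ i j k, 1 ≤ k → S.Edge i j → BddAbove (Set.range (X.etaFun μ i j k))
  indep : iIndep (fun e : {e : Fin N × Fin N // S.Edge e.1 e.2} × ℕ =>
    X.sigD e.1.1.1 e.1.1.2 (e.2 + 1)) μ
  indep_rest : Indep
    (⨆ e : {e : Fin N × Fin N // S.Edge e.1 e.2} × ℕ, X.sigD e.1.1.1 e.1.1.2 (e.2 + 1))
    ((⨆ e : Fin N × ℕ, X.sigW e.1 (e.2 + 1)) ⊔ (⨆ e : Fin N × ℕ, X.sigH e.1 (e.2 + 1)) ⊔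
      (⨆ k : ℕ, X.sigG S (k + 1))) μ

/-- Step-sizes: `∑ β² < ∞`, `β_{i,k} = O(β_{i,k+1})`, and `∑ z_k = ∞`, where `z_k` is the minimum
of all `α_{ij,k} ζ_{ij,k}` over the edges and of all `β_{i,k}`. -/
structure Model.StepAssumption (S : Model N n M m) (ζ : Fin N → Fin N → ℕ → ℝ) : Prop where
  beta_sq : ∀ i, Summable fun k : ℕ => S.β i (k + 1) ^ 2
  beta_O : ∀ i, (fun k => S.β i k) =O[atTop] fun k => S.β i (k + 1)
  z_div : Tendsto (fun K : ℕ => ∑ k ∈ Finset.Icc 1 K,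
    sInf ({x : ℝ | ∃ i j, S.Edge i j ∧ x = S.α i j k * ζ i j k} ∪ Set.range fun i => S.β i k))
    atTop atTop

/-! ### The bounds -/

/-- The coefficient
`β_{i,k}² q_{ij,t} η_{ij,t} (∏_{l=k+1}^{t-1} (1 - λ⁺_min(Q_i) β_{i,l}))²`. -/
def Env.coef (S : Model N n M m) (X : Env N n M m Ω) (μ : Measure Ω) (i j : Fin N)
    (k t : ℕ) : ℝ :=
  S.β i k ^ 2 * X.q S μ i j t * X.eta μ i j t *
    (∏ l ∈ Finset.Ico (k + 1) t, (1 - lamMinPos (S.Q i) * S.β i l)) ^ 2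

/-- The series bound: the sum over the neighbours `j` and over `t = k+1, k+2, …`. -/
def Env.seriesBound (S : Model N n M m) (X : Env N n M m Ω) (μ : Measure Ω) (i : Fin N)
    (k : ℕ) : Matrix (Fin (m i)) (Fin (m i)) ℝ :=
  ∑ j ∈ S.nbr i, ∑' t : ℕ, X.coef S μ i j k (k + 1 + t) • (S.Hbar i * (S.Hbar i)ᵀ)

/-- The explicit bound
`∑_j ∑_{u : (i,j) ∈ E^(u)} π_u R_{ij,k} β_{i,k} (η_{ij,1} / k^{2 ε_ij}) H̄_i H̄_iᵀ`. -/
def Env.rateBound (S : Model N n M m) (X : Env N n M m Ω) (μ : Measure Ω) (π : Fin M → ℝ)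
    (b δ : Fin N → ℝ) (ε : Fin N → Fin N → ℝ) (i : Fin N) (k : ℕ) :
    Matrix (Fin (m i)) (Fin (m i)) ℝ :=
  ∑ j ∈ S.nbr i, ∑ u ∈ S.graphsWith i j,
    (π u * rateConst (lamMinPos (S.Q i)) (b i) (δ i) (ε i j) k * S.β i k *
      (X.eta μ i j 1 / (k : ℝ) ^ (2 * ε i j))) • (S.Hbar i * (S.Hbar i)ᵀ)

end System

end PrivEst

end

set_option linter.unusedSectionVars false

noncomputable section

namespace PrivEst

/-! ### The Bernoulli affinity along a distribution function -/

section CdfAffinity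

variable {ν : Measure ℝ} {f : ℝ → ℝ}

/-! The information is bounded through the Hellinger distance. In a direction `v`, the quadratic
form of the information is four times the limit of `h⁻² ∑ (√P(s|y+hv) - √P(s|y))²` over the records
of positive likelihood. It therefore suffices to bound the affinity `∑ √(P(s|y) P(s|y'))` below by
`1 - (B/8) |H̄ᵢᵀ(y - y')|²`, and this needs no differentiability of `F`.

Fix the graphs and the observations. For prescribed signals the estimates are deterministic
(`Model.replay`), so the event that the record equals `s` splits into conditions on independent
privacy noises, and its conditional probability is a product of Bernoulli probabilities
(`Env.measure_record_of_path`). Changing one observation of sensor `i` leaves the other sensors'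
estimates alone and shifts that of `i` by a vector `Model.err` obeying a linear recursion free of
the signals. The shift starts as a multiple of `H̄ᵢᵀ v` and stays in the range of `H̄ᵢᵀ`, where each
step contracts by `1 - λ⁺_min β` (`Model.err_dotProduct_self_le`).

For one transmitted bit, the angle `arcsin √F` is Lipschitz with constant `√η / 2`. The affinity of
two Bernoulli laws is the cosine of the angle difference, hence at least `1 - η (x - y)² / 8`
(`one_sub_le_affinity_cdf`). Affinities multiply over independent edges. They can also be chained
over time, because the shift is the same for all records, and the defects of the factors add up at
most. Averaging over graphs and observations can only increase the affinity (Cauchy–Schwarz) and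
turns edge indicators into the probabilities `q` (`Env.hellinger_lik_le`). Passing to the limit in
`h` gives the bound at a finite horizon (`Env.dotProduct_fisher_mulVec_le`).

A second use of Cauchy–Schwarz shows that information grows with the horizon, so the limit exists
and inherits the bound. The series converges because its products differ from those of the
summability assumption by a fixed factor and one factor tending to `1`. The affinity bound also
makes the likelihoods Lipschitz in `y`: Rademacher's theorem then handles observations with a
density, and domination under the integral handles differentiable `F`.

For the rates, stationarity makes `q` constant in time and the series is estimated by telescoping
potentials. The information then tends to `0`, and compactness of the unit sphere turns this into
enhanced privacy in the Loewner order. -/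

lemma cdf_sub_le_mul [IsProbabilityMeasure ν]
    (hν : ν = volume.withDensity fun x => ENNReal.ofReal (f x))
    {a b c : ℝ} (hab : a ≤ b) (hc : 0 ≤ c) (h : ∀ t ∈ Set.Ioc a b, f t ≤ c) :
    cdf ν b - cdf ν a ≤ c * (b - a) := by
  have h1 : ν (Set.Ioc a b) = ENNReal.ofReal (cdf ν b - cdf ν a) := by
    conv_lhs => rw [← measure_cdf ν]
    exact StieltjesFunction.measure_Ioc _ _ _
  have h2 : ν (Set.Ioc a b) ≤ ENNReal.ofReal (c * (b - a)) := by
    rw [hν, withDensity_apply _ measurableSet_Ioc]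
    calc ∫⁻ x in Set.Ioc a b, ENNReal.ofReal (f x)
        ≤ ∫⁻ _ in Set.Ioc a b, ENNReal.ofReal c :=
          setLIntegral_mono measurable_const fun x hx => ENNReal.ofReal_le_ofReal (h x hx)
      _ = ENNReal.ofReal (c * (b - a)) := by
          rw [setLIntegral_const, Real.volume_Ioc, ENNReal.ofReal_mul hc]
  rw [h1] at h2
  exact (ENNReal.ofReal_le_ofReal_iff (mul_nonneg hc (sub_nonneg.2 hab))).1 h2

lemma continuous_cdf_of_density [IsProbabilityMeasure ν]
    (hν : ν = volume.withDensity fun x => ENNReal.ofReal (f x)) :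
    Continuous (cdf ν) := by
  rw [continuous_iff_continuousAt]
  intro a
  rw [(monotone_cdf ν).continuousAt_iff_leftLim_eq_rightLim, StieltjesFunction.rightLim_eq]
  have h1 : ν {a} = ENNReal.ofReal (cdf ν a - Function.leftLim (cdf ν) a) := by
    conv_lhs => rw [← measure_cdf ν]
    exact StieltjesFunction.measure_singleton _ _
  have h2 : ν {a} = 0 := by
    rw [hν]
    exact withDensity_absolutelyContinuous _ _ (Real.volume_singleton)
  rw [h2] at h1
  have h3 := ENNReal.ofReal_eq_zero.1 h1.symm
  exact le_antisymm ((monotone_cdf ν).leftLim_le le_rfl) (by linarith)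

/-- Where `F` is `0` or `1` the quotient is `0` by the division convention and says nothing about
`f`, hence the strict hypotheses. -/
lemma density_le_sqrt {η : ℝ}
    (hη : ∀ x, f x ^ 2 / (cdf ν x * (1 - cdf ν x)) ≤ η) {x : ℝ}
    (h0 : 0 < cdf ν x) (h1 : cdf ν x < 1) :
    f x ≤ √η * √(cdf ν x * (1 - cdf ν x)) := by
  have hp : 0 < cdf ν x * (1 - cdf ν x) := mul_pos h0 (by linarith)
  have hη0 : 0 ≤ η := (div_nonneg (sq_nonneg _) hp.le).trans (hη x)
  rw [← Real.sqrt_mul hη0]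
  apply Real.le_sqrt_of_sq_le
  have := (div_le_iff₀ hp).1 (hη x)
  linarith

/-- A bound on the right Dini derivative replaces `F' = f`, which may fail. The bound on the density
is continuous in `F`, so it persists nearby and can be integrated; if `F x = 1`, then `F` is
constant to the right. -/
lemma frequently_slope_cdf_lt [IsProbabilityMeasure ν] {η : ℝ}
    (hν : ν = volume.withDensity fun x => ENNReal.ofReal (f x))
    (hη : ∀ x, f x ^ 2 / (cdf ν x * (1 - cdf ν x)) ≤ η) {x r : ℝ} (h0 : 0 < cdf ν x)
    (hr : √η * √(cdf ν x * (1 - cdf ν x)) < r) :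
    ∃ᶠ z in 𝓝[>] x, slope (cdf ν) x z < r := by
  have hcont := continuous_cdf_of_density hν
  apply Eventually.frequently
  rcases (cdf_le_one ν x).lt_or_eq with h1 | h1
  · obtain ⟨r', hr1, hr2⟩ := exists_between hr
    have hg : Continuous fun z => √η * √(cdf ν z * (1 - cdf ν z)) := by fun_prop
    have e1 : ∀ᶠ z in 𝓝 x, √η * √(cdf ν z * (1 - cdf ν z)) < r' :=
      hg.continuousAt.eventually_lt continuousAt_const hr1
    have e2 : ∀ᶠ z in 𝓝 x, 0 < cdf ν z := continuousAt_const.eventually_lt hcont.continuousAt h0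
    have e3 : ∀ᶠ z in 𝓝 x, cdf ν z < 1 := hcont.continuousAt.eventually_lt continuousAt_const h1
    obtain ⟨ε, hε, hball⟩ := Metric.eventually_nhds_iff.1 (e1.and (e2.and e3))
    have e4 : ∀ᶠ z in 𝓝[>] x, z < x + ε :=
      nhdsWithin_le_nhds (eventually_lt_nhds (by linarith))
    filter_upwards [e4, self_mem_nhdsWithin] with z hz hxz
    have hxz' : x < z := hxz
    have hle : cdf ν z - cdf ν x ≤ r' * (z - x) := by
      refine cdf_sub_le_mul hν hxz'.le (le_trans (by positivity) hr1.le) fun t ht => ?_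
      have hd : dist t x < ε := by
        rw [Real.dist_eq, abs_lt]; constructor <;> linarith [ht.1, ht.2]
      obtain ⟨b1, b2, b3⟩ := hball hd
      exact (density_le_sqrt hη b2 b3).trans b1.le
    rw [slope_def_field, div_lt_iff₀ (by linarith)]
    exact hle.trans_lt (mul_lt_mul_of_pos_right hr2 (by linarith))
  · filter_upwards [self_mem_nhdsWithin] with z hz
    have hz1 : cdf ν z = 1 := le_antisymm (cdf_le_one ν z) (h1 ▸ monotone_cdf ν (le_of_lt hz))
    rw [slope_def_field, hz1, h1]
    simp only [sub_self, zero_div]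
    exact lt_of_le_of_lt (by positivity) hr

lemma sin_sq_arcsin_sqrt {p : ℝ} (h0 : 0 ≤ p) (h1 : p ≤ 1) :
    Real.sin (Real.arcsin √p) ^ 2 = p := by
  rw [Real.sin_arcsin (by linarith [Real.sqrt_nonneg p]) (Real.sqrt_le_one.2 h1), Real.sq_sqrt h0]

lemma arcsin_sqrt_le_of_le_sin_sq {p θ : ℝ} (hθ0 : 0 ≤ θ) (hθ : θ ≤ Real.pi / 2)
    (h : p ≤ Real.sin θ ^ 2) : Real.arcsin √p ≤ θ := by
  have hs : 0 ≤ Real.sin θ := Real.sin_nonneg_of_nonneg_of_le_pi hθ0 (by linarith [Real.pi_pos])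
  have : √p ≤ Real.sin θ := Real.sqrt_le_iff.2 ⟨hs, h⟩
  calc Real.arcsin √p ≤ Real.arcsin (Real.sin θ) := Real.monotone_arcsin this
    _ = θ := Real.arcsin_sin (by linarith [Real.pi_pos]) hθ

/-- The angle `arcsin √F` is Lipschitz with constant `√η / 2`. -/
lemma arcsin_sqrt_cdf_sub_le [IsProbabilityMeasure ν] {η : ℝ}
    (hν : ν = volume.withDensity fun x => ENNReal.ofReal (f x))
    (hη : ∀ x, f x ^ 2 / (cdf ν x * (1 - cdf ν x)) ≤ η) {a b : ℝ} (hab : a ≤ b) :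
    Real.arcsin √(cdf ν b) ≤ Real.arcsin √(cdf ν a) + √η / 2 * (b - a) := by
  have hcont := continuous_cdf_of_density hν
  have hpi := Real.pi_pos
  -- The room `ε` raises both the initial angle, so that the comparison starts where `F > 0`, and
  -- the slope, so that the comparison of derivatives is strict.
  suffices H : ∀ ε : ℝ, 0 < ε → Real.arcsin √(cdf ν b) ≤
      Real.arcsin √(cdf ν a) + √η / 2 * (b - a) + ε * (1 + (b - a)) by
    refine le_of_forall_pos_le_add fun ε hε => ?_
    have hb : 0 < 1 + (b - a) := by linarith
    have := H (ε / (1 + (b - a))) (by positivity)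
    rwa [div_mul_cancel₀ _ hb.ne'] at this
  intro ε hε
  set θ := Real.arcsin √(cdf ν a) + ε with hθ
  have hθa : 0 ≤ Real.arcsin √(cdf ν a) := Real.arcsin_nonneg.2 (Real.sqrt_nonneg _)
  set κ := √η / 2 + ε with hκ
  have hκ0 : 0 < κ := by positivity
  by_cases hbig : Real.pi / 2 < θ + κ * (b - a)
  · refine (Real.arcsin_le_pi_div_two _).trans ?_
    nlinarith
  push Not at hbig
  have hθpos : 0 < θ := by positivity
  have hκb : 0 ≤ κ * (b - a) := mul_nonneg hκ0.le (by linarith)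
  by_cases hsmall : cdf ν b ≤ Real.sin θ ^ 2
  · refine (arcsin_sqrt_le_of_le_sin_sq hθpos.le (by linarith) hsmall).trans ?_
    have : 0 ≤ √η / 2 * (b - a) := mul_nonneg (by positivity) (by linarith)
    have : 0 ≤ ε * (b - a) := mul_nonneg hε.le (by linarith)
    nlinarith
  push Not at hsmall
  have hFa : cdf ν a ≤ Real.sin θ ^ 2 := by
    conv_lhs => rw [← sin_sq_arcsin_sqrt (cdf_nonneg ν a) (cdf_le_one ν a)]
    have : Real.sin (Real.arcsin √(cdf ν a)) ≤ Real.sin θ :=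
      Real.sin_le_sin_of_le_of_le_pi_div_two (by linarith) (by linarith) (by linarith)
    have h0 : 0 ≤ Real.sin (Real.arcsin √(cdf ν a)) :=
      Real.sin_nonneg_of_nonneg_of_le_pi hθa (by linarith)
    gcongr
  -- The comparison starts at a point `a1` with `F a1 = sin² θ > 0`, since the density is not
  -- controlled where `F = 0`.
  obtain ⟨a1, ⟨ha1, ha1b⟩, hFa1⟩ := intermediate_value_Icc hab hcont.continuousOn
    (show Real.sin θ ^ 2 ∈ Set.Icc (cdf ν a) (cdf ν b) from ⟨hFa, hsmall.le⟩)
  have hsθ : 0 < Real.sin θ := Real.sin_pos_of_pos_of_lt_pi hθpos (by linarith)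
  -- The barrier `sin² (θ + κ (x - a1))` solves `y' = 2 κ √(y (1 - y))` below the angle `π / 2`. At
  -- a contact point its slope exceeds that of `F` because `2 κ > √η`.
  have key := image_le_of_liminf_slope_right_lt_deriv_boundary' (f := cdf ν)
    (f' := fun x => √η * √(cdf ν x * (1 - cdf ν x))) (a := a1) (b := b)
    (B := fun x => Real.sin (θ + κ * (x - a1)) ^ 2)
    (B' := fun x => 2 * κ * (Real.sin (θ + κ * (x - a1)) * Real.cos (θ + κ * (x - a1))))
    hcont.continuousOn
    (fun x hx r hr => frequently_slope_cdf_lt hν hη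
      (lt_of_lt_of_le (by rw [hFa1]; positivity) (monotone_cdf ν hx.1)) hr)
    (by simp [hFa1]) (by fun_prop)
    (fun x hx => by
      have h1 : HasDerivAt (fun x => θ + κ * (x - a1)) κ x := by
        simpa using (((hasDerivAt_id x).sub_const a1).const_mul κ).const_add θ
      have h2 := (h1.sin.pow 2)
      refine (h2.congr_deriv ?_).hasDerivWithinAt
      simp; ring)
    (fun x hx hB => by
      have hang : θ + κ * (x - a1) < Real.pi / 2 := by
        have : κ * (x - a1) < κ * (b - a) := by
          apply mul_lt_mul_of_pos_left _ hκ0; linarith [hx.1, hx.2]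
        linarith
      have hang0 : 0 < θ + κ * (x - a1) := by
        have : 0 ≤ κ * (x - a1) := mul_nonneg hκ0.le (by linarith [hx.1])
        linarith
      have hs := Real.sin_pos_of_pos_of_lt_pi hang0 (by linarith)
      have hc := Real.cos_pos_of_mem_Ioo (x := θ + κ * (x - a1)) ⟨by linarith, hang⟩
      have e : cdf ν x * (1 - cdf ν x) =
          (Real.sin (θ + κ * (x - a1)) * Real.cos (θ + κ * (x - a1))) ^ 2 := by
        rw [hB, mul_pow, Real.cos_sq']
      simp only [e, Real.sqrt_sq (mul_pos hs hc).le]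
      have := mul_pos hs hc
      nlinarith)
  have hb := key (Set.right_mem_Icc.2 ha1b)
  have hle : κ * (b - a1) ≤ κ * (b - a) := by
    apply mul_le_mul_of_nonneg_left _ hκ0.le; linarith
  have hge : 0 ≤ κ * (b - a1) := mul_nonneg hκ0.le (by linarith)
  refine (arcsin_sqrt_le_of_le_sin_sq (θ := θ + κ * (b - a1)) (by linarith) (by linarith)
    hb).trans ?_
  simp only [hθ, hκ] at hle ⊢
  nlinarith

/-- The affinity of the two Bernoulli laws with parameters `F x` and `F y`. -/
theorem one_sub_le_affinity_cdf [IsProbabilityMeasure ν] {η : ℝ}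
    (hν : ν = volume.withDensity fun x => ENNReal.ofReal (f x))
    (hη : ∀ x, f x ^ 2 / (cdf ν x * (1 - cdf ν x)) ≤ η) (x y : ℝ) :
    1 - η / 8 * (x - y) ^ 2 ≤
      √(cdf ν x * cdf ν y) + √((1 - cdf ν x) * (1 - cdf ν y)) := by
  wlog hxy : x ≤ y generalizing x y
  · have := this y x (le_of_not_ge hxy)
    rw [mul_comm (cdf ν x), mul_comm (1 - cdf ν x)]
    convert this using 3; ring
  have hη0 : 0 ≤ η := (div_nonneg (sq_nonneg _)
    (mul_nonneg (cdf_nonneg ν 0) (sub_nonneg.2 (cdf_le_one ν 0)))).trans (hη 0)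
  have hs : ∀ z, Real.sin (Real.arcsin √(cdf ν z)) = √(cdf ν z) := fun z =>
    Real.sin_arcsin (by linarith [Real.sqrt_nonneg (cdf ν z)]) (Real.sqrt_le_one.2 (cdf_le_one ν z))
  have hc : ∀ z, Real.cos (Real.arcsin √(cdf ν z)) = √(1 - cdf ν z) := fun z => by
    rw [Real.cos_arcsin, Real.sq_sqrt (cdf_nonneg ν z)]
  have h1 := arcsin_sqrt_cdf_sub_le hν hη hxy
  have h2 : Real.arcsin √(cdf ν x) ≤ Real.arcsin √(cdf ν y) :=
    Real.monotone_arcsin (Real.sqrt_le_sqrt (monotone_cdf ν hxy))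
  rw [Real.sqrt_mul (cdf_nonneg ν x), Real.sqrt_mul (sub_nonneg.2 (cdf_le_one ν x)), ← hs x, ← hs y,
    ← hc x, ← hc y]
  -- The affinity is the cosine of the difference of the angles; `cos t ≥ 1 - t² / 2` with `t ≤ (√η
  -- / 2) (y - x)` produces `η / 8`.
  have h3 := Real.one_sub_sq_div_two_le_cos (x := Real.arcsin √(cdf ν y) - Real.arcsin √(cdf ν x))
  rw [Real.cos_sub] at h3
  have h4 : (Real.arcsin √(cdf ν y) - Real.arcsin √(cdf ν x)) ^ 2 ≤ (√η / 2 * (y - x)) ^ 2 := by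
    apply pow_le_pow_left₀ <;> linarith
  rw [mul_pow, div_pow, Real.sq_sqrt hη0] at h4
  nlinarith

end CdfAffinity

/-! ### Contraction of the estimation error on the range of `H̄ᵀ` -/

section Contraction

variable {n r : ℕ}

lemma hasEigenvalue_iff_mem_range {Q : Matrix (Fin n) (Fin n) ℝ} (hQ : Q.IsHermitian) (x : ℝ) :
    Module.End.HasEigenvalue (Matrix.toLin' Q) x ↔ x ∈ Set.range hQ.eigenvalues := by
  rw [Module.End.hasEigenvalue_iff_mem_spectrum, Matrix.spectrum_toLin',
    hQ.spectrum_real_eq_range_eigenvalues]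

lemma finite_eigenvalues {Q : Matrix (Fin n) (Fin n) ℝ} (hQ : Q.IsHermitian) :
    {x : ℝ | Module.End.HasEigenvalue (Matrix.toLin' Q) x}.Finite :=
  (Set.finite_range hQ.eigenvalues).subset fun _ hx => (hasEigenvalue_iff_mem_range hQ _).1 hx

lemma eigenvalues_le_lamMax {Q : Matrix (Fin n) (Fin n) ℝ} (hQ : Q.IsHermitian) (j : Fin n) :
    hQ.eigenvalues j ≤ lamMax Q :=
  le_csSup (finite_eigenvalues hQ).bddAbove ((hasEigenvalue_iff_mem_range hQ _).2 ⟨j, rfl⟩)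

lemma lamMinPos_le_eigenvalues {Q : Matrix (Fin n) (Fin n) ℝ} (hQ : Q.IsHermitian) {j : Fin n}
    (hj : 0 < hQ.eigenvalues j) : lamMinPos Q ≤ hQ.eigenvalues j :=
  csInf_le ⟨0, fun _ hx => hx.1.le⟩ ⟨hj, (hasEigenvalue_iff_mem_range hQ _).2 ⟨j, rfl⟩⟩

lemma isHermitian_gram (H : Matrix (Fin r) (Fin n) ℝ) : (Hᵀ * H).IsHermitian := by
  simpa using Matrix.isHermitian_conjTranspose_mul_self H

lemma posSemidef_gram (H : Matrix (Fin r) (Fin n) ℝ) : (Hᵀ * H).PosSemidef := by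
  simpa using Matrix.posSemidef_conjTranspose_mul_self H

lemma gram_eq_zero {H : Matrix (Fin r) (Fin n) ℝ} (h : Hᵀ * H = 0) : H = 0 := by
  rw [← Matrix.conjTranspose_mul_self_eq_zero]
  simpa using h

lemma exists_pos_eigenvalue {H : Matrix (Fin r) (Fin n) ℝ} (h : Hᵀ * H ≠ 0) :
    ∃ j, 0 < (isHermitian_gram H).eigenvalues j := by
  by_contra! hc
  refine h ((isHermitian_gram H).eigenvalues_eq_zero_iff.1 ?_)
  ext j
  exact le_antisymm (hc j) ((posSemidef_gram H).eigenvalues_nonneg j)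

lemma lamMinPos_pos {H : Matrix (Fin r) (Fin n) ℝ} (h : Hᵀ * H ≠ 0) :
    0 < lamMinPos (Hᵀ * H) := by
  have hne : {x : ℝ | 0 < x ∧ Module.End.HasEigenvalue (Matrix.toLin' (Hᵀ * H)) x}.Nonempty := by
    obtain ⟨j, hj⟩ := exists_pos_eigenvalue h
    exact ⟨_, hj, (hasEigenvalue_iff_mem_range (isHermitian_gram H) _).2 ⟨j, rfl⟩⟩
  exact (hne.csInf_mem ((finite_eigenvalues (isHermitian_gram H)).subset fun _ hx => hx.2)).1

/-- Makes every contraction factor positive. For a nonzero Gram matrix compare with the largest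
eigenvalue; for the zero matrix `lamMinPos` is the infimum of the empty set, which is `0`. -/
lemma lamMinPos_mul_lt_one (H : Matrix (Fin r) (Fin n) ℝ) {β : ℝ} (hβ : 0 ≤ β)
    (h1 : β * lamMax (Hᵀ * H) < 1) : lamMinPos (Hᵀ * H) * β < 1 := by
  by_cases h : Hᵀ * H = 0
  · have : lamMinPos (Hᵀ * H) ≤ 0 := by
      have hE : {x : ℝ | 0 < x ∧ Module.End.HasEigenvalue (Matrix.toLin' (Hᵀ * H)) x} = ∅ := by
        ext x
        simp only [Set.mem_ofPred_eq, Set.mem_empty_iff_false, iff_false, not_and]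
        intro hx hx2
        obtain ⟨j, hj⟩ := (hasEigenvalue_iff_mem_range (isHermitian_gram H) _).1 hx2
        have := (isHermitian_gram H).eigenvalues_eq_zero_iff.2 h
        rw [this] at hj
        simp at hj
        linarith
      rw [lamMinPos, hE, Real.sInf_empty]
    nlinarith
  · obtain ⟨j, hj⟩ := exists_pos_eigenvalue h
    have h2 := lamMinPos_le_eigenvalues _ hj
    have h3 := eigenvalues_le_lamMax (isHermitian_gram H) j
    nlinarith

/-- One step of the error recursion contracts the range of `Hᵀ` by `1 - λ⁺_min β`. -/
lemma dotProduct_self_step_le (H : Matrix (Fin r) (Fin n) ℝ) {β : ℝ} (hβ : 0 ≤ β)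
    (h1 : β * lamMax (Hᵀ * H) < 1) (w : Fin r → ℝ) :
    (Hᵀ *ᵥ w - β • ((Hᵀ * H) *ᵥ (Hᵀ *ᵥ w))) ⬝ᵥ (Hᵀ *ᵥ w - β • ((Hᵀ * H) *ᵥ (Hᵀ *ᵥ w))) ≤
      (1 - lamMinPos (Hᵀ * H) * β) ^ 2 * ((Hᵀ *ᵥ w) ⬝ᵥ (Hᵀ *ᵥ w)) := by
  set hQ := isHermitian_gram H
  set e := hQ.eigenvectorBasis
  have parseval : ∀ x : Fin n → ℝ, x ⬝ᵥ x = ∑ j, (x ⬝ᵥ (e j).ofLp) ^ 2 := fun x => by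
    have h := e.sum_sq_norm_inner_left (WithLp.toLp 2 x)
    rw [EuclideanSpace.norm_sq_eq] at h
    simp only [Real.norm_eq_abs, sq_abs] at h
    rw [dotProduct]
    simp only [← pow_two]
    rw [← h]
    refine Finset.sum_congr rfl fun j _ => ?_
    rw [EuclideanSpace.inner_eq_star_dotProduct]
    simp [dotProduct_comm]
  have hmul : ∀ j, (Hᵀ * H) *ᵥ (e j).ofLp = hQ.eigenvalues j • (e j).ofLp := fun j =>
    hQ.mulVec_eigenvectorBasis j
  set x := Hᵀ *ᵥ w with hx
  have hcoord : ∀ j, (x - β • ((Hᵀ * H) *ᵥ x)) ⬝ᵥ (e j).ofLp =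
      (1 - β * hQ.eigenvalues j) * (x ⬝ᵥ (e j).ofLp) := fun j => by
    have : ((Hᵀ * H) *ᵥ x) ⬝ᵥ (e j).ofLp = hQ.eigenvalues j * (x ⬝ᵥ (e j).ofLp) := by
      rw [dotProduct_comm, Matrix.dotProduct_mulVec, ← Matrix.mulVec_transpose]
      rw [Matrix.transpose_mul, Matrix.transpose_transpose, hmul, smul_dotProduct, smul_eq_mul,
        dotProduct_comm]
    rw [sub_dotProduct, smul_dotProduct, this, smul_eq_mul]; ring
  -- A null vector of `Hᵀ H` is a null vector of `H`, hence orthogonal to the range of `Hᵀ`; this is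
  -- why only positive eigenvalues count.
  have hker : ∀ j, hQ.eigenvalues j = 0 → x ⬝ᵥ (e j).ofLp = 0 := fun j hj => by
    have h0 : H *ᵥ (e j).ofLp = 0 := by
      have h2 := hmul j
      rw [hj, zero_smul, ← Matrix.mulVec_mulVec] at h2
      have h3 : (H *ᵥ (e j).ofLp) ⬝ᵥ (H *ᵥ (e j).ofLp) = 0 := by
        rw [Matrix.dotProduct_mulVec, ← Matrix.mulVec_transpose, h2, zero_dotProduct]
      exact dotProduct_self_eq_zero.1 h3
    rw [hx, Matrix.mulVec_transpose, ← Matrix.dotProduct_mulVec, h0, dotProduct_zero]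
  rw [parseval, parseval x, Finset.mul_sum]
  refine Finset.sum_le_sum fun j _ => ?_
  rw [hcoord, mul_pow]
  rcases ((posSemidef_gram H).eigenvalues_nonneg j).eq_or_lt with h0 | h0
  · rw [hker j h0.symm]; simp
  -- For a positive eigenvalue `μ_j`, `0 ≤ 1 - β μ_j ≤ 1 - λ⁺_min β`. The lower bound, needed to
  -- compare the squares, comes from `β λ_max < 1`.
  · have h2 := lamMinPos_le_eigenvalues hQ h0
    have h3 := eigenvalues_le_lamMax hQ j
    have h4 : β * hQ.eigenvalues j ≤ β * lamMax (Hᵀ * H) := mul_le_mul_of_nonneg_left h3 hβ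
    have h5 : lamMinPos (Hᵀ * H) * β ≤ β * hQ.eigenvalues j := by
      rw [mul_comm]; exact mul_le_mul_of_nonneg_left h2 hβ
    gcongr
    linarith

end Contraction

/-! ### The estimates for prescribed signals -/

section Replay

variable {N n M : ℕ} [NeZero n] {m : Fin N → ℕ}

/-- Graphs and observations at the times `1, 2, …` (the index `t` stands for the time `t + 1`). -/
abbrev Path (N : ℕ) (m : Fin N → ℕ) : Type :=
  (ℕ → Fin N → Fin N → ℝ) × ((i : Fin N) → ℕ → Fin (m i) → ℝ)

/-- Replace the observation of sensor `i` with index `k`. -/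
def Path.set (z : Path N m) (i : Fin N) (k : ℕ) (y : Fin (m i) → ℝ) : Path N m :=
  (z.1, Function.update z.2 i (Function.update (z.2 i) k y))

lemma Path.set_fst (z : Path N m) (i : Fin N) (k : ℕ) (y : Fin (m i) → ℝ) :
    (z.set i k y).1 = z.1 := rfl

lemma Path.set_snd (z : Path N m) (i : Fin N) (k : ℕ) (y : Fin (m i) → ℝ) (t : ℕ) :
    (z.set i k y).2 i t = if t = k then y else z.2 i t := by
  simp [Path.set, Function.update_apply]

lemma Path.set_snd_of_ne (z : Path N m) {i u : Fin N} (hu : u ≠ i) (k : ℕ) (y : Fin (m i) → ℝ) :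
    (z.set i k y).2 u = z.2 u := by
  simp [Path.set, hu]

/-- A finite record of signals, extended by `0`. -/
def extendSignals {T : ℕ} (s : Fin T → Fin N → Fin N → SignType) :
    ℕ → Fin N → Fin N → SignType :=
  fun t => if h : t < T then s ⟨t, h⟩ else 0

lemma extendSignals_snoc {T t : ℕ} (ht : t < T) (s : Fin T → Fin N → Fin N → SignType)
    (a : Fin N → Fin N → SignType) :
    extendSignals (Fin.snoc s a : Fin (T + 1) → Fin N → Fin N → SignType) t =
      extendSignals s t := by
  have h := Fin.snoc_castSucc (α := fun _ => Fin N → Fin N → SignType) a s ⟨t, ht⟩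
  simp only [extendSignals, ht, Nat.lt_succ_of_lt ht, dif_pos]
  exact h

open Classical in
/-- The estimates when the transmitted signals are `σ`. -/
def Model.replay (S : Model N n M m) (z : Path N m) (σ : ℕ → Fin N → Fin N → SignType) :
    ℕ → Fin N → Fin n → ℝ
  | 0 => S.est0
  | k + 1 => fun i =>
      S.replay z σ k i +
        (∑ j ∈ Finset.univ.filter (fun j => 0 < z.1 k i j),
          S.α i j (k + 1) * z.1 k i j * ((σ k i j : ℝ) - (σ k j i : ℝ))) • phi n (k + 1) +
        S.β i (k + 1) • ((S.Hbar i)ᵀ *ᵥ (z.2 i k - S.Hbar i *ᵥ S.replay z σ k i))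

lemma Model.replay_congr (S : Model N n M m) (z : Path N m) {σ τ : ℕ → Fin N → Fin N → SignType}
    {k : ℕ} (h : ∀ l < k, σ l = τ l) : S.replay z σ k = S.replay z τ k := by
  induction k with
  | zero => rfl
  | succ k ih =>
    have ih' := ih fun l hl => h l (by omega)
    funext i
    simp only [Model.replay, ih', h k (by omega)]

lemma Model.est_eq_replay (S : Model N n M m) (g : ℕ → Fin N → Fin N → ℝ)
    (y : (i : Fin N) → ℕ → Fin (m i) → ℝ) (d : Fin N → Fin N → ℕ → ℝ)
    (σ : ℕ → Fin N → Fin N → SignType) {k : ℕ}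
    (h : ∀ l < k, S.sendSignal (g (l + 1)) (fun i j => d i j (l + 1)) (l + 1)
      (S.est g y d l) = σ l) :
    S.est g y d k = S.replay (fun t => g (t + 1), fun i t => y i (t + 1)) σ k := by
  induction k with
  | zero => rfl
  | succ k ih =>
    have ih' := ih fun l hl => h l (by omega)
    have hk := h k (by omega)
    funext i
    simp only [Model.est, Model.replay, hk]
    rw [ih']

/-- As long as the realized signals agree with `s`, the estimates can be computed from `s`. The
feedback disappears: for a given path, the condition at each time involves only the noises of that
time. -/
lemma Model.record_eq_iff (S : Model N n M m) (g : ℕ → Fin N → Fin N → ℝ)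
    (y : (i : Fin N) → ℕ → Fin (m i) → ℝ) (d : Fin N → Fin N → ℕ → ℝ) {T : ℕ}
    (s : Fin T → Fin N → Fin N → SignType) :
    S.record g y d T = s ↔ ∀ t : Fin T, S.sendSignal (g (t + 1)) (fun i j => d i j (t + 1)) (t + 1)
      (S.replay (fun t => g (t + 1), fun i t => y i (t + 1)) (extendSignals s) t) = s t := by
  constructor
  · rintro rfl t
    rw [← S.est_eq_replay g y d]
    · rfl
    · intro l hl
      have hlT : l < T := hl.trans t.2
      simp only [extendSignals, hlT, dif_pos]
      rfl
  · intro h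
    have key : ∀ l, ∀ hl : l < T, S.sendSignal (g (l + 1)) (fun i j => d i j (l + 1)) (l + 1)
        (S.est g y d l) = s ⟨l, hl⟩ := by
      intro l
      induction l using Nat.strong_induction_on with
      | _ l ih =>
        intro hl
        rw [S.est_eq_replay g y d (extendSignals s)]
        · exact h ⟨l, hl⟩
        · intro l' hl'
          rw [ih l' hl' (hl'.trans hl)]
          simp [extendSignals, hl'.trans hl]
    funext t
    exact key t t.2

/-- The effect of a change `v` of the observation of sensor `i` with index `k` on the estimates
of sensor `i`, for fixed signals. -/
def Model.err (S : Model N n M m) (i : Fin N) (k : ℕ) (v : Fin (m i) → ℝ) : ℕ → Fin n → ℝ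
  | 0 => 0
  | t + 1 => S.err i k v t - S.β i (t + 1) • (S.Q i *ᵥ S.err i k v t) +
      if t = k then S.β i (k + 1) • ((S.Hbar i)ᵀ *ᵥ v) else 0

lemma Model.replay_set_of_ne (S : Model N n M m) (z : Path N m)
    (σ : ℕ → Fin N → Fin N → SignType) {i u : Fin N} (hu : u ≠ i) (k : ℕ) (y : Fin (m i) → ℝ)
    (t : ℕ) : S.replay (z.set i k y) σ t u = S.replay z σ t u := by
  induction t with
  | zero => rfl
  | succ t ih => simp only [Model.replay, ih, Path.set_fst, Path.set_snd_of_ne z hu]; rfl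

/-- With the same signals the fusion terms cancel and the remaining update is affine, so the
difference of the estimates depends neither on `σ` nor on the graphs. -/
lemma Model.replay_set_sub (S : Model N n M m) (z : Path N m)
    (σ : ℕ → Fin N → Fin N → SignType) (i : Fin N) (k : ℕ) (y y' : Fin (m i) → ℝ) (t : ℕ) :
    S.replay (z.set i k y) σ t i - S.replay (z.set i k y') σ t i = S.err i k (y - y') t := by
  induction t with
  | zero => simp [Model.replay, Model.err]
  | succ t ih =>
    have e : ∀ a c a' b b' : Fin n → ℝ, a + c + b - (a' + c + b') = a - a' + (b - b') := by
      intros; abel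
    refine (e _ _ _ _ _).trans ?_
    simp only [Model.err, ← ih, Model.Q, ← Matrix.mulVec_mulVec, Path.set_snd]
    split_ifs with h
    · subst h
      simp only [Matrix.mulVec_sub, smul_sub]
      abel
    · simp only [Matrix.mulVec_sub, smul_sub]
      abel

lemma Model.err_eq_zero (S : Model N n M m) (i : Fin N) {k t : ℕ} (ht : t ≤ k)
    (v : Fin (m i) → ℝ) : S.err i k v t = 0 := by
  induction t with
  | zero => rfl
  | succ t ih => simp [Model.err, ih (by omega), show t ≠ k by omega]

/-- The range of `H̄ᵀ` is invariant under `1 - β Q` and contains the initial perturbation; the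
contraction holds only there. -/
lemma Model.exists_err_eq (S : Model N n M m) (i : Fin N) (k : ℕ) (v : Fin (m i) → ℝ) (t : ℕ) :
    ∃ w, S.err i k v t = (S.Hbar i)ᵀ *ᵥ w := by
  induction t with
  | zero => exact ⟨0, by simp [Model.err]⟩
  | succ t ih =>
    obtain ⟨w, hw⟩ := ih
    refine ⟨w - S.β i (t + 1) • (S.Hbar i *ᵥ ((S.Hbar i)ᵀ *ᵥ w)) +
      if t = k then S.β i (k + 1) • v else 0, ?_⟩
    simp only [Model.err, hw, Model.Q, ← Matrix.mulVec_mulVec]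
    split_ifs <;> simp [Matrix.mulVec_add, Matrix.mulVec_sub, Matrix.mulVec_smul]

/-- Index `k` is time `k + 1`: the perturbation enters with the step-size `β i (k + 1)`, and
contraction begins one time later, at `l = k + 2`. -/
lemma Model.err_dotProduct_self_le (S : Model N n M m)
    (hβ : ∀ i k, 1 ≤ k → S.β i k * lamMax (S.Q i) < 1) (i : Fin N) (k t : ℕ)
    (v : Fin (m i) → ℝ) :
    S.err i k v (k + 1 + t) ⬝ᵥ S.err i k v (k + 1 + t) ≤ S.β i (k + 1) ^ 2 *
      (∏ l ∈ Finset.Ico (k + 2) (k + 2 + t), (1 - lamMinPos (S.Q i) * S.β i l)) ^ 2 *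
        (((S.Hbar i)ᵀ *ᵥ v) ⬝ᵥ ((S.Hbar i)ᵀ *ᵥ v)) := by
  induction t with
  | zero =>
    simp [Model.err, S.err_eq_zero i le_rfl v]
    apply le_of_eq; ring
  | succ t ih =>
    rw [← add_assoc, ← add_assoc, Finset.prod_Ico_succ_top (by omega), Model.err,
      if_neg (by omega), add_zero]
    obtain ⟨w, hw⟩ := S.exists_err_eq i k v (k + 1 + t)
    have h := dotProduct_self_step_le (S.Hbar i) (S.β_nonneg i (k + 1 + t + 1) (by omega))
      (hβ i (k + 1 + t + 1) (by omega)) w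
    rw [← hw] at h
    refine h.trans ?_
    rw [show k + 1 + t + 1 = k + 2 + t by omega]
    have := mul_le_mul_of_nonneg_left ih (sq_nonneg (1 - lamMinPos (S.Q i) * S.β i (k + 2 + t)))
    refine this.trans (le_of_eq ?_)
    ring

lemma phi_dotProduct_sq_le (k : ℕ) (x : Fin n → ℝ) : (phi n k ⬝ᵥ x) ^ 2 ≤ x ⬝ᵥ x := by
  rw [phi, single_one_dotProduct, dotProduct]
  simp only [← pow_two]
  exact Finset.single_le_sum (f := fun j => x j ^ 2) (fun j _ => sq_nonneg _) (Finset.mem_univ _)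

/-- The squared sensitivity of the estimate of sensor `i` used with index `t`. -/
def Model.sens (S : Model N n M m) (i : Fin N) (k t : ℕ) : ℝ :=
  if k < t then S.β i (k + 1) ^ 2 *
    (∏ l ∈ Finset.Ico (k + 2) (t + 1), (1 - lamMinPos (S.Q i) * S.β i l)) ^ 2 else 0

lemma Model.sens_nonneg (S : Model N n M m) (i : Fin N) (k t : ℕ) : 0 ≤ S.sens i k t := by
  unfold Model.sens; split_ifs <;> positivity

lemma Model.phi_dotProduct_err_sq_le (S : Model N n M m)
    (hβ : ∀ i k, 1 ≤ k → S.β i k * lamMax (S.Q i) < 1) (i : Fin N) (k t : ℕ)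
    (v : Fin (m i) → ℝ) :
    (phi n (t + 1) ⬝ᵥ S.err i k v t) ^ 2 ≤
      S.sens i k t * (((S.Hbar i)ᵀ *ᵥ v) ⬝ᵥ ((S.Hbar i)ᵀ *ᵥ v)) := by
  by_cases h : k < t
  · obtain ⟨r, rfl⟩ := Nat.exists_eq_add_of_le (Nat.succ_le_of_lt h)
    refine (phi_dotProduct_sq_le _ _).trans ((S.err_dotProduct_self_le hβ i k r v).trans ?_)
    rw [Model.sens, if_pos h, show k + 2 + r = k.succ + r + 1 by omega]
  · rw [S.err_eq_zero i (not_lt.1 h), Model.sens, if_neg h]; simp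

end Replay

/-! ### The law of the signals given the graphs and the observations -/

section Affinity

/-- Applied to affinities, this says that the defects of independent components add up at most. -/
lemma one_sub_sum_le_prod {ι : Type*} (A : Finset ι) (f : ι → ℝ) (h0 : ∀ i ∈ A, 0 ≤ f i)
    (h1 : ∀ i ∈ A, f i ≤ 1) : 1 - ∑ i ∈ A, (1 - f i) ≤ ∏ i ∈ A, f i := by
  classical
  induction A using Finset.induction_on with
  | empty => simp
  | insert a A ha ih =>
    rw [Finset.sum_insert ha, Finset.prod_insert ha]
    have h2 := ih (fun i hi => h0 i (Finset.mem_insert_of_mem hi))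
      (fun i hi => h1 i (Finset.mem_insert_of_mem hi))
    have h3 : ∏ i ∈ A, f i ≤ 1 := Finset.prod_le_one
      (fun i hi => h0 i (Finset.mem_insert_of_mem hi))
      (fun i hi => h1 i (Finset.mem_insert_of_mem hi))
    have h4 := h1 a (Finset.mem_insert_self a A)
    nlinarith

lemma sum_fin_succ_pi {A : Type*} [Fintype A] {T : ℕ} (f : (Fin (T + 1) → A) → ℝ) :
    ∑ s, f s = ∑ s : Fin T → A, ∑ a, f (Fin.snoc s a : Fin (T + 1) → A) := by
  rw [← (Fin.snocEquiv fun _ : Fin (T + 1) => A).sum_comp f, Fintype.sum_prod_type,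
    Finset.sum_comm]
  rfl

lemma sum_prod_pi_pi {N : ℕ} (f : Fin N → Fin N → SignType → ℝ) :
    ∑ a : Fin N → Fin N → SignType, ∏ u, ∏ v, f u v (a u v) = ∏ u, ∏ v, ∑ x, f u v x := by
  simp_rw [Finset.prod_univ_sum, Fintype.piFinset_univ]

/-- The probability of the signal on an edge of weight `b`, where `p` is the probability
of `1`. -/
def signalProb (b p : ℝ) (s : SignType) : ℝ :=
  open Classical in
  if 0 < b then (if s = 1 then p else if s = -1 then 1 - p else 0) else if s = 0 then 1 else 0

lemma sum_signType (f : SignType → ℝ) : ∑ s, f s = f 1 + f (-1) + f 0 := by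
  have : (Finset.univ : Finset SignType) = {1, -1, 0} := by decide
  rw [this, Finset.sum_insert (by decide), Finset.sum_insert (by decide), Finset.sum_singleton]
  ring

lemma signalProb_nonneg {b p : ℝ} (h0 : 0 ≤ p) (h1 : p ≤ 1) (s : SignType) :
    0 ≤ signalProb b p s := by
  unfold signalProb; split_ifs <;> linarith

lemma sum_signalProb (b p : ℝ) : ∑ s, signalProb b p s = 1 := by
  rw [sum_signType]
  unfold signalProb
  split_ifs <;> simp_all

lemma sum_sqrt_signalProb (b p q : ℝ) :
    ∑ s, √(signalProb b p s * signalProb b q s) =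
      if 0 < b then √(p * q) + √((1 - p) * (1 - q)) else 1 := by
  rw [sum_signType]
  unfold signalProb
  split_ifs <;> simp_all

variable {N n M : ℕ} [NeZero n] {m : Fin N → ℕ} {Ω : Type*} [MeasurableSpace Ω]
  (S : Model N n M m) (X : Env N n M m Ω) (μ : Measure Ω)

lemma Env.F_nonneg (u v : Fin N) (t : ℕ) (x : ℝ) : 0 ≤ X.F μ u v t x := cdf_nonneg _ _

lemma Env.F_le_one (u v : Fin N) (t : ℕ) (x : ℝ) : X.F μ u v t x ≤ 1 := cdf_le_one _ _

/-- The probability of the signals `a` with index `t`, for the graph `g` and the estimates `x`. -/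
def Env.stepProb (t : ℕ) (g : Fin N → Fin N → ℝ) (x : Fin N → Fin n → ℝ)
    (a : Fin N → Fin N → SignType) : ℝ :=
  ∏ u, ∏ v, signalProb (g u v)
    (X.F μ u v (t + 1) (S.C u v - phi n (t + 1) ⬝ᵥ x u)) (a u v)

/-- The probability of the record `s` given the graphs and the observations. -/
def Env.pathProb {T : ℕ} (s : Fin T → Fin N → Fin N → SignType) (z : Path N m) : ℝ :=
  ∏ t : Fin T, X.stepProb S μ t (z.1 t) (S.replay z (extendSignals s) t) (s t)

lemma Env.stepProb_nonneg (t : ℕ) (g : Fin N → Fin N → ℝ) (x : Fin N → Fin n → ℝ)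
    (a : Fin N → Fin N → SignType) : 0 ≤ X.stepProb S μ t g x a :=
  Finset.prod_nonneg fun _ _ => Finset.prod_nonneg fun _ _ =>
    signalProb_nonneg (X.F_nonneg μ _ _ _ _) (X.F_le_one μ _ _ _ _) _

lemma Env.pathProb_nonneg {T : ℕ} (s : Fin T → Fin N → Fin N → SignType) (z : Path N m) :
    0 ≤ X.pathProb S μ s z :=
  Finset.prod_nonneg fun _ _ => X.stepProb_nonneg S μ _ _ _ _

lemma Env.sum_stepProb (t : ℕ) (g : Fin N → Fin N → ℝ) (x : Fin N → Fin n → ℝ) :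
    ∑ a, X.stepProb S μ t g x a = 1 := by
  simp only [Env.stepProb]
  rw [sum_prod_pi_pi fun u v a => signalProb (g u v)
    (X.F μ u v (t + 1) (S.C u v - phi n (t + 1) ⬝ᵥ x u)) a]
  simp [sum_signalProb]

/-- The chain rule: the estimates used with index `T` depend only on signals with smaller index, so
appending a step changes no earlier factor. -/
lemma Env.pathProb_snoc {T : ℕ} (s : Fin T → Fin N → Fin N → SignType)
    (a : Fin N → Fin N → SignType) (z : Path N m) :
    X.pathProb S μ (Fin.snoc s a : Fin (T + 1) → Fin N → Fin N → SignType) z =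
      X.pathProb S μ s z * X.stepProb S μ T (z.1 T) (S.replay z (extendSignals s) T) a := by
  simp only [Env.pathProb]
  rw [Fin.prod_univ_castSucc]
  congr 1
  · refine Finset.prod_congr rfl fun t _ => ?_
    rw [Fin.snoc_castSucc, Fin.val_castSucc]
    rw [S.replay_congr z fun l hl => extendSignals_snoc (hl.trans t.2) s a]
  · rw [Fin.snoc_last, Fin.val_last, S.replay_congr z fun l hl => extendSignals_snoc hl s a]

lemma Env.sum_pathProb_snoc {T : ℕ} (s : Fin T → Fin N → Fin N → SignType) (z : Path N m) :
    ∑ a, X.pathProb S μ (Fin.snoc s a : Fin (T + 1) → Fin N → Fin N → SignType) z =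
      X.pathProb S μ s z := by
  simp only [Env.pathProb_snoc, ← Finset.mul_sum, Env.sum_stepProb, mul_one]

lemma Env.sum_pathProb (T : ℕ) (z : Path N m) :
    ∑ s : Fin T → Fin N → Fin N → SignType, X.pathProb S μ s z = 1 := by
  induction T with
  | zero => simp [Env.pathProb]
  | succ T ih => rw [sum_fin_succ_pi]; simp only [Env.sum_pathProb_snoc, ih]

lemma Env.pathProb_le_one {T : ℕ} (s : Fin T → Fin N → Fin N → SignType) (z : Path N m) :
    X.pathProb S μ s z ≤ 1 := by
  rw [← X.sum_pathProb S μ T z]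
  exact Finset.single_le_sum (f := fun s => X.pathProb S μ s z)
    (fun s _ => X.pathProb_nonneg S μ s z) (Finset.mem_univ s)

/-- Information available from one transmission step. -/
def Env.stepInfo (i : Fin N) (t : ℕ) (g : Fin N → Fin N → ℝ) : ℝ :=
  open Classical in ∑ v ∈ S.nbr i, if 0 < g i v then X.eta μ i v (t + 1) else 0

variable {S X μ}

lemma Env.eta_nonneg (i j : Fin N) (t : ℕ) : 0 ≤ X.eta μ i j t :=
  Real.iSup_nonneg fun _ => div_nonneg (sq_nonneg _)
    (mul_nonneg (X.F_nonneg μ _ _ _ _) (sub_nonneg.2 (X.F_le_one μ _ _ _ _)))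

lemma Env.stepInfo_nonneg (i : Fin N) (t : ℕ) (g : Fin N → Fin N → ℝ) :
    0 ≤ X.stepInfo S μ i t g := by
  refine Finset.sum_nonneg fun v _ => ?_
  split_ifs
  · exact Env.eta_nonneg _ _ _
  · exact le_rfl

lemma sqrt_mul_add_sqrt_le_one {p q : ℝ} (hp0 : 0 ≤ p) (hp1 : p ≤ 1) (hq0 : 0 ≤ q) (hq1 : q ≤ 1) :
    √(p * q) + √((1 - p) * (1 - q)) ≤ 1 := by
  have h1 : √(p * q) ≤ (p + q) / 2 := by
    apply Real.sqrt_le_iff.2 ⟨by linarith, by nlinarith [sq_nonneg (p - q)]⟩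
  have h2 : √((1 - p) * (1 - q)) ≤ (1 - p + (1 - q)) / 2 := by
    apply Real.sqrt_le_iff.2 ⟨by linarith, by nlinarith [sq_nonneg (p - q)]⟩
  linarith

/-- The affinity factorizes over ordered pairs. Senders other than `i` have equal estimates, and
pairs without a current edge send nothing, so these factors are `1`. Each remaining factor is a
Bernoulli affinity along `F`. -/
lemma Env.one_sub_le_affinity_step [IsProbabilityMeasure μ] (hPriv : X.PrivacyNoiseAssumption S μ)
    {g : Fin N → Fin N → ℝ} (hg : ∀ u v, 0 < g u v → S.Edge u v) (t : ℕ) (i : Fin N)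
    {x x' : Fin N → Fin n → ℝ} (hx : ∀ u, u ≠ i → x u = x' u) :
    1 - X.stepInfo S μ i t g / 8 * (phi n (t + 1) ⬝ᵥ (x i - x' i)) ^ 2 ≤
      ∑ a, √(X.stepProb S μ t g x a * X.stepProb S μ t g x' a) := by
  set p : (Fin N → Fin n → ℝ) → Fin N → Fin N → ℝ := fun x u v =>
    X.F μ u v (t + 1) (S.C u v - phi n (t + 1) ⬝ᵥ x u) with hp
  have hp0 : ∀ x u v, 0 ≤ p x u v := fun x u v => X.F_nonneg μ _ _ _ _
  have hp1 : ∀ x u v, p x u v ≤ 1 := fun x u v => X.F_le_one μ _ _ _ _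
  set ρ : Fin N → Fin N → ℝ := fun u v =>
    ∑ s, √(signalProb (g u v) (p x u v) s * signalProb (g u v) (p x' u v) s) with hρ
  have hsum : ∑ a, √(X.stepProb S μ t g x a * X.stepProb S μ t g x' a) = ∏ u, ∏ v, ρ u v := by
    rw [hρ, ← sum_prod_pi_pi fun u v s =>
      √(signalProb (g u v) (p x u v) s * signalProb (g u v) (p x' u v) s)]
    refine Finset.sum_congr rfl fun a _ => ?_
    simp only [Env.stepProb, ← Finset.prod_mul_distrib]
    rw [Real.sqrt_prod _ fun u _ => Finset.prod_nonneg fun v _ => mul_nonneg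
      (signalProb_nonneg (hp0 x u v) (hp1 x u v) _) (signalProb_nonneg (hp0 x' u v) (hp1 x' u v) _)]
    refine Finset.prod_congr rfl fun u _ => ?_
    rw [Real.sqrt_prod _ fun v _ => mul_nonneg
      (signalProb_nonneg (hp0 x u v) (hp1 x u v) _) (signalProb_nonneg (hp0 x' u v) (hp1 x' u v) _)]
  have hρ0 : ∀ u v, 0 ≤ ρ u v := fun u v => Finset.sum_nonneg fun s _ => Real.sqrt_nonneg _
  have hρ1 : ∀ u v, ρ u v ≤ 1 := fun u v => by
    simp only [hρ, sum_sqrt_signalProb]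
    split_ifs
    · exact sqrt_mul_add_sqrt_le_one (hp0 _ _ _) (hp1 _ _ _) (hp0 _ _ _) (hp1 _ _ _)
    · exact le_rfl
  have hne : ∀ u, u ≠ i → ∀ v, ρ u v = 1 := fun u hu v => by
    have : p x' u v = p x u v := by simp only [hp, hx u hu]
    simp only [hρ, this, ← pow_two]
    rw [← sum_signalProb (g u v) (p x u v)]
    exact Finset.sum_congr rfl fun s _ => Real.sqrt_sq (signalProb_nonneg (hp0 _ _ _) (hp1 _ _ _) _)
  rw [hsum, Finset.prod_eq_single i (fun u _ hu => Finset.prod_eq_one fun v _ => hne u hu v)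
    (fun h => absurd (Finset.mem_univ i) h)]
  refine le_trans ?_ (one_sub_sum_le_prod _ _ (fun v _ => hρ0 i v) fun v _ => hρ1 i v)
  have hv : ∀ v, v ∉ S.nbr i → 1 - ρ i v = 0 := fun v hv => by
    have : ¬ 0 < g i v := fun h => hv (by simp [Model.nbr, hg i v h])
    simp [hρ, sum_sqrt_signalProb, this]
  rw [← Finset.sum_subset (Finset.subset_univ (S.nbr i)) fun v _ h => hv v h]
  rw [Env.stepInfo, Finset.sum_div, Finset.sum_mul]
  refine sub_le_sub_left (Finset.sum_le_sum fun v hvn => ?_) _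
  simp only [hρ, sum_sqrt_signalProb]
  split_ifs with h
  · have hE := hg i v h
    have hprob : IsProbabilityMeasure (μ.map (X.d i v (t + 1))) :=
      Measure.isProbabilityMeasure_map (X.d_meas i v (t + 1)).aemeasurable
    have := one_sub_le_affinity_cdf (hPriv.dens i v (t + 1) (by omega) hE)
      (η := X.eta μ i v (t + 1))
      (fun x => le_ciSup (hPriv.eta_finite i v (t + 1) (by omega) hE) x)
      (S.C i v - phi n (t + 1) ⬝ᵥ x i) (S.C i v - phi n (t + 1) ⬝ᵥ x' i)
    have e : (S.C i v - phi n (t + 1) ⬝ᵥ x i - (S.C i v - phi n (t + 1) ⬝ᵥ x' i)) ^ 2 =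
        (phi n (t + 1) ⬝ᵥ (x i - x' i)) ^ 2 := by rw [dotProduct_sub]; ring
    rw [e] at this
    simp only [hp, Env.F]
    linarith
  · simp

/-- Each step multiplies every summand by at least `1 - κ`, with one `κ` for all records because
`Model.err` ignores the signals. Since the affinity `A` is at most `1`, `A (1 - κ) ≥ A - κ` and the
defects accumulate additively. -/
lemma Env.one_sub_le_affinity_path [IsProbabilityMeasure μ] (hPriv : X.PrivacyNoiseAssumption S μ)
    {z : Path N m} (hz : ∀ t u v, 0 < z.1 t u v → S.Edge u v) (i : Fin N) (k : ℕ)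
    (y y' : Fin (m i) → ℝ) (T : ℕ) :
    1 - ∑ t ∈ Finset.range T, X.stepInfo S μ i t (z.1 t) / 8 *
        (phi n (t + 1) ⬝ᵥ S.err i k (y - y') t) ^ 2 ≤
      ∑ s : Fin T → Fin N → Fin N → SignType,
        √(X.pathProb S μ s (z.set i k y) * X.pathProb S μ s (z.set i k y')) := by
  induction T with
  | zero => simp [Env.pathProb]
  | succ T ih =>
    rw [Finset.sum_range_succ, sum_fin_succ_pi]
    set A := ∑ s : Fin T → Fin N → Fin N → SignType,
        √(X.pathProb S μ s (z.set i k y) * X.pathProb S μ s (z.set i k y')) with hA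
    set κ := X.stepInfo S μ i T (z.1 T) / 8 * (phi n (T + 1) ⬝ᵥ S.err i k (y - y') T) ^ 2 with hκ
    have hκ0 : 0 ≤ κ := by
      have := Env.stepInfo_nonneg (X := X) (S := S) (μ := μ) i T (z.1 T)
      positivity
    have hA1 : A ≤ 1 := by
      have : A ≤ ∑ s : Fin T → Fin N → Fin N → SignType,
          (X.pathProb S μ s (z.set i k y) + X.pathProb S μ s (z.set i k y')) / 2 := by
        refine Finset.sum_le_sum fun s _ => ?_
        have h1 := X.pathProb_nonneg S μ s (z.set i k y)
        have h2 := X.pathProb_nonneg S μ s (z.set i k y')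
        apply Real.sqrt_le_iff.2 ⟨by linarith, ?_⟩
        nlinarith [sq_nonneg (X.pathProb S μ s (z.set i k y) - X.pathProb S μ s (z.set i k y'))]
      refine this.trans (le_of_eq ?_)
      rw [← Finset.sum_div, Finset.sum_add_distrib, X.sum_pathProb, X.sum_pathProb]
      norm_num
    have hstep : A * (1 - κ) ≤ ∑ s : Fin T → Fin N → Fin N → SignType, ∑ a,
        √(X.pathProb S μ (Fin.snoc s a : Fin (T + 1) → Fin N → Fin N → SignType) (z.set i k y) *
          X.pathProb S μ (Fin.snoc s a : Fin (T + 1) → Fin N → Fin N → SignType)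
            (z.set i k y')) := by
      rw [hA, Finset.sum_mul]
      refine Finset.sum_le_sum fun s _ => ?_
      have hs := Env.one_sub_le_affinity_step hPriv (g := z.1 T) (hz T) T i
        (x := S.replay (z.set i k y) (extendSignals s) T)
        (x' := S.replay (z.set i k y') (extendSignals s) T)
        (fun u hu => by rw [S.replay_set_of_ne z _ hu, S.replay_set_of_ne z _ hu])
      rw [S.replay_set_sub] at hs
      refine (mul_le_mul_of_nonneg_left hs (Real.sqrt_nonneg _)).trans (le_of_eq ?_)
      rw [Finset.mul_sum]
      refine Finset.sum_congr rfl fun a _ => ?_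
      rw [X.pathProb_snoc, X.pathProb_snoc, mul_mul_mul_comm,
        Real.sqrt_mul (mul_nonneg (X.pathProb_nonneg S μ _ _) (X.pathProb_nonneg S μ _ _))]
      rfl
    have hAκ : A * κ ≤ κ := by nlinarith
    linarith

end Affinity

/-! ### Independence and the likelihoods -/

section GeneralIndependence

variable {Ω : Type*} {mΩ : MeasurableSpace Ω} {μ : Measure Ω}

/-- Regroups independence, on the π-system of intersections `s ∩ t` that generates `m2 ⊔ m3`. It is
used to separate one observation from the others together with the graphs. -/
lemma indep_sup_right [IsProbabilityMeasure μ] {m1 m2 m3 : MeasurableSpace Ω} (h1 : m1 ≤ mΩ)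
    (h2 : m2 ≤ mΩ) (h3 : m3 ≤ mΩ) (h12 : Indep m1 m2 μ) (h123 : Indep (m1 ⊔ m2) m3 μ) :
    Indep m1 (m2 ⊔ m3) μ := by
  set p : Set (Set Ω) := {u | ∃ s t, MeasurableSet[m2] s ∧ MeasurableSet[m3] t ∧ u = s ∩ t}
  have hgen : m2 ⊔ m3 = MeasurableSpace.generateFrom p := by
    apply le_antisymm
    · refine sup_le (fun s hs => ?_) fun t ht => ?_
      · exact MeasurableSpace.measurableSet_generateFrom
          ⟨s, Set.univ, hs, MeasurableSet.univ, (Set.inter_univ s).symm⟩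
      · exact MeasurableSpace.measurableSet_generateFrom
          ⟨Set.univ, t, MeasurableSet.univ, ht, (Set.univ_inter t).symm⟩
    · refine MeasurableSpace.generateFrom_le ?_
      rintro u ⟨s, t, hs, ht, rfl⟩
      have hs' : MeasurableSet[m2 ⊔ m3] s := (le_sup_left : m2 ≤ m2 ⊔ m3) s hs
      have ht' : MeasurableSet[m2 ⊔ m3] t := (le_sup_right : m3 ≤ m2 ⊔ m3) t ht
      exact hs'.inter ht'
  have hpi : IsPiSystem p := by
    rintro _ ⟨s, t, hs, ht, rfl⟩ _ ⟨s', t', hs', ht', rfl⟩ _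
    refine ⟨s ∩ s', t ∩ t', hs.inter hs', ht.inter ht', ?_⟩
    rw [Set.inter_inter_inter_comm]
  refine IndepSets.indep h1 (sup_le h2 h3) (@MeasurableSpace.isPiSystem_measurableSet Ω m1) hpi
    (@MeasurableSpace.generateFrom_measurableSet Ω m1).symm hgen ?_
  rw [IndepSets_iff]
  rintro a _ ha ⟨s, t, hs, ht, rfl⟩
  have ha' : MeasurableSet[m1 ⊔ m2] a := (le_sup_left : m1 ≤ m1 ⊔ m2) a ha
  have hs' : MeasurableSet[m1 ⊔ m2] s := (le_sup_right : m2 ≤ m1 ⊔ m2) s hs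
  rw [Indep_iff] at h123 h12
  rw [← Set.inter_assoc, h123 _ _ (ha'.inter hs') ht, h12 _ _ ha hs, h123 _ _ hs' ht, mul_assoc]

/-- Fubini with `W` frozen: the conditions then concern separate coordinates of a product measure,
so the inner probability factorizes. -/
lemma measure_forall_mem_of_indep [IsProbabilityMeasure μ] {ι E : Type*} [Fintype ι]
    [MeasurableSpace E] {D : ι → Ω → ℝ} (hDm : ∀ e, Measurable (D e)) (hDi : iIndepFun D μ)
    {W : Ω → E} (hW : Measurable W) (hDW : IndepFun (fun ω e => D e ω) W μ) {B : Set E}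
    (hB : MeasurableSet B) {C : ι → Set (ℝ × E)} (hC : ∀ e, MeasurableSet (C e)) :
    μ {ω | W ω ∈ B ∧ ∀ e, (D e ω, W ω) ∈ C e} =
      ∫⁻ ω in W ⁻¹' B, ∏ e, μ {ω' | (D e ω', W ω) ∈ C e} ∂μ := by
  have hDvec : Measurable fun ω e => D e ω := measurable_pi_lambda _ hDm
  have hlaw : μ.map (fun ω => ((fun e => D e ω), W ω)) =
      (Measure.pi fun e => μ.map (D e)).prod (μ.map W) := by
    rw [(indepFun_iff_map_prod_eq_prod_map_map hDvec.aemeasurable hW.aemeasurable).1 hDW,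
      (iIndepFun_iff_map_fun_eq_pi_map fun e => (hDm e).aemeasurable).1 hDi]
  have hprob : ∀ e, IsProbabilityMeasure (μ.map (D e)) := fun e =>
    Measure.isProbabilityMeasure_map (hDm e).aemeasurable
  have hprobW : IsProbabilityMeasure (μ.map W) := Measure.isProbabilityMeasure_map hW.aemeasurable
  set A : Set ((ι → ℝ) × E) := {q | q.2 ∈ B ∧ ∀ e, (q.1 e, q.2) ∈ C e} with hA
  have hAm : MeasurableSet A := by
    refine (measurable_snd hB).inter ?_
    have : {q : (ι → ℝ) × E | ∀ e, (q.1 e, q.2) ∈ C e} =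
        ⋂ e, (fun q : (ι → ℝ) × E => (q.1 e, q.2)) ⁻¹' C e := by ext; simp
    change MeasurableSet {q : (ι → ℝ) × E | ∀ e, (q.1 e, q.2) ∈ C e}
    rw [this]
    exact MeasurableSet.iInter fun e => ((measurable_pi_apply e).comp measurable_fst).prodMk
      measurable_snd (hC e)
  have hpair : Measurable fun ω => ((fun e => D e ω), W ω) := hDvec.prodMk hW
  change μ ((fun ω => ((fun e => D e ω), W ω)) ⁻¹' A) = _
  rw [← Measure.map_apply hpair hAm, hlaw, Measure.prod_apply_symm hAm,
    lintegral_map (measurable_measure_prodMk_right hAm) hW, ← lintegral_indicator (hW hB)]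
  refine lintegral_congr fun ω => ?_
  by_cases hω : W ω ∈ B
  · rw [Set.indicator_of_mem (show ω ∈ W ⁻¹' B from hω)]
    have : (fun x : ι → ℝ => (x, W ω)) ⁻¹' A =
        Set.pi Set.univ fun e => {x | (x, W ω) ∈ C e} := by
      ext x; simp [hA, hω]
    rw [this, Measure.pi_pi]
    refine Finset.prod_congr rfl fun e _ => ?_
    exact Measure.map_apply (hDm e) ((measurable_id.prodMk measurable_const) (hC e))
  · rw [Set.indicator_of_notMem (show ω ∉ W ⁻¹' B from hω)]
    have : (fun x : ι → ℝ => (x, W ω)) ⁻¹' A = ∅ := by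
      ext x; simp [hA, hω]
    rw [this, measure_empty]

end GeneralIndependence

/-! ### Measurability of graphs and observations for smaller σ-algebras -/

section SubSigmaAlgebra

variable {N n M : ℕ} [NeZero n] {m : Fin N → ℕ} {Ω : Type*} {mm : MeasurableSpace Ω}
  [MeasurableSpace Ω] {S : Model N n M m} {X : Env N n M m Ω}

variable (S X) in
/-- The realized graphs and observations. -/
def Env.path (ω : Ω) : Path N m :=
  (fun t => X.graph S (t + 1) ω, fun i t => X.obs i (t + 1) ω)

lemma Env.measurable_obs_of_le {i : Fin N} {k : ℕ}
    (hW : X.sigW i k ≤ mm) (hH : X.sigH i k ≤ mm) : Measurable[mm] (X.obs i k) := by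
  have h1 : Measurable[mm] (X.w i k) := (comap_measurable (X.w i k)).mono hW le_rfl
  have h2 : Measurable[mm] fun ω (r : Fin (m i)) (c : Fin n) => X.H i k ω r c :=
    (comap_measurable (fun ω (r : Fin (m i)) (c : Fin n) => X.H i k ω r c)).mono hH le_rfl
  refine @measurable_pi_lambda _ _ _ mm _ _ fun r => ?_
  refine @Measurable.add _ _ _ _ mm _ _ _ ?_ ((measurable_pi_apply r).comp h1)
  change Measurable[mm] fun ω => ∑ c, X.H i k ω r c * X.θ c
  refine Finset.measurable_sum _ fun c _ => ?_
  exact ((measurable_pi_apply c).comp ((measurable_pi_apply r).comp h2)).mul_const _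

lemma Env.measurable_path_of_le 
    (hW : ∀ i k, X.sigW i (k + 1) ≤ mm) (hH : ∀ i k, X.sigH i (k + 1) ≤ mm)
    (hG : ∀ k, X.sigG S (k + 1) ≤ mm) : Measurable[mm] (X.path S) := by
  refine @Measurable.prodMk _ mm _ _ _ _ _ _ ?_ ?_
  · exact @measurable_pi_lambda _ _ _ mm _ _ fun t =>
      (comap_measurable (X.graph S (t + 1))).mono (hG t) le_rfl
  · exact @measurable_pi_lambda _ _ _ mm _ _ fun i => @measurable_pi_lambda _ _ _ mm _ _ fun t =>
      X.measurable_obs_of_le (hW i t) (hH i t)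

/-- Overwriting the entry `(i, k)` by `0` removes the dependence on that observation, so the
σ-algebras of its noise and its matrix are not needed. -/
lemma Env.measurable_path_set_of_le {i : Fin N} {k : ℕ}
    (hW : ∀ u t, (u, t) ≠ (i, k) → X.sigW u (t + 1) ≤ mm)
    (hH : ∀ u t, (u, t) ≠ (i, k) → X.sigH u (t + 1) ≤ mm)
    (hG : ∀ t, X.sigG S (t + 1) ≤ mm) : Measurable[mm] fun ω => (X.path S ω).set i k 0 := by
  refine @Measurable.prodMk _ mm _ _ _ _ _ _ ?_ ?_
  · exact @measurable_pi_lambda _ _ _ mm _ _ fun t =>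
      (comap_measurable (X.graph S (t + 1))).mono (hG t) le_rfl
  · refine @measurable_pi_lambda _ _ _ mm _ _ fun u => @measurable_pi_lambda _ _ _ mm _ _
      fun t => ?_
    change Measurable[mm] fun ω => ((X.path S ω).set i k 0).2 u t
    by_cases hu : u = i
    · subst hu
      simp only [Path.set_snd]
      split_ifs with ht
      · exact @measurable_const _ _ _ mm _
      · exact X.measurable_obs_of_le (hW u t (by simp [ht])) (hH u t (by simp [ht]))
    · simp only [Path.set_snd_of_ne _ hu]
      exact X.measurable_obs_of_le (hW u t (by simp [hu])) (hH u t (by simp [hu]))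

end SubSigmaAlgebra

/-! ### The likelihoods as averages of path probabilities, and as conditional probabilities -/

section Likelihood

variable {N n M : ℕ} [NeZero n] {m : Fin N → ℕ} {Ω : Type*} [MeasurableSpace Ω]
  {S : Model N n M m} {X : Env N n M m Ω} {μ : Measure Ω}

lemma Env.edge_of_path_pos (ω : Ω) (t : ℕ) (u v : Fin N) (h : 0 < (X.path S ω).1 t u v) :
    S.Edge u v := ⟨_, h⟩

lemma measurable_mulVec {r c : ℕ} (A : Matrix (Fin r) (Fin c) ℝ) :
    Measurable fun v : Fin c → ℝ => A *ᵥ v :=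
  (continuous_const.matrix_mulVec continuous_id).measurable

lemma Path.measurable_set {i : Fin N} {k : ℕ} {Γ : Type*} [MeasurableSpace Γ]
    {z : Γ → Path N m} {y : Γ → Fin (m i) → ℝ} (hz : Measurable z) (hy : Measurable y) :
    Measurable fun γ => (z γ).set i k (y γ) := by
  refine (measurable_fst.comp hz).prodMk (measurable_pi_lambda _ fun u => ?_)
  have hsnd : ∀ u, Measurable fun γ => (z γ).2 u := fun u =>
    (measurable_pi_apply u).comp (measurable_snd.comp hz)
  change Measurable fun γ => ((z γ).set i k (y γ)).2 u
  by_cases hu : u = i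
  · subst hu
    refine measurable_pi_lambda _ fun t => ?_
    simp only [Path.set_snd]
    split_ifs
    · exact hy
    · exact (measurable_pi_apply t).comp (hsnd u)
  · simp only [Path.set_snd_of_ne _ hu]
    exact hsnd u

lemma Path.measurable_graph (t : ℕ) (u v : Fin N) : Measurable fun z : Path N m => z.1 t u v :=
  (measurable_pi_apply v).comp ((measurable_pi_apply u).comp
    ((measurable_pi_apply t).comp measurable_fst))

lemma Path.measurable_obs (i : Fin N) (t : ℕ) : Measurable fun z : Path N m => z.2 i t :=
  (measurable_pi_apply t).comp ((measurable_pi_apply i).comp measurable_snd)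

lemma Model.measurable_replay (σ : ℕ → Fin N → Fin N → SignType) (t : ℕ) (u : Fin N) :
    Measurable fun z : Path N m => S.replay z σ t u := by
  induction t with
  | zero => exact measurable_const
  | succ t ih =>
    simp only [Model.replay, Finset.sum_filter]
    refine Measurable.add (Measurable.add ih (Measurable.smul_const ?_ _)) ?_
    · refine Finset.measurable_sum _ fun j _ => ?_
      have hg := Path.measurable_graph (m := m) t u j
      exact Measurable.ite (measurableSet_lt measurable_const hg)
        ((hg.const_mul _).mul_const _) measurable_const
    · exact ((measurable_mulVec _).comp ((Path.measurable_obs u t).sub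
        ((measurable_mulVec _).comp ih))).const_smul (S.β u (t + 1))

lemma measurable_phi_dotProduct (k : ℕ) : Measurable fun x : Fin n → ℝ => phi n k ⬝ᵥ x := by
  simp only [phi, single_one_dotProduct]
  exact measurable_pi_apply _

lemma Env.measurable_F (u v : Fin N) (t : ℕ) : Measurable (X.F μ u v t) :=
  (monotone_cdf _).measurable

lemma Env.measurable_pathProb {T : ℕ} (s : Fin T → Fin N → Fin N → SignType) :
    Measurable (X.pathProb S μ s) := by
  refine Finset.measurable_prod _ fun t _ => Finset.measurable_prod _ fun u _ =>
    Finset.measurable_prod _ fun v _ => ?_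
  have hF := (X.measurable_F (μ := μ) u v (t + 1)).comp
    (measurable_const.sub ((measurable_phi_dotProduct (n := n) (t + 1)).comp
      (S.measurable_replay (extendSignals s) t u)) : Measurable fun z : Path N m =>
        S.C u v - phi n (t + 1) ⬝ᵥ S.replay z (extendSignals s) t u)
  simp only [signalProb]
  refine Measurable.ite (measurableSet_lt measurable_const (Path.measurable_graph _ _ _)) ?_
    measurable_const
  split_ifs
  · exact hF
  · exact measurable_const.sub hF
  · exact measurable_const

/-- The σ-algebra of the graphs and the observation noises. -/
abbrev Env.sigRest (S : Model N n M m) (X : Env N n M m Ω) : MeasurableSpace Ω :=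
  (⨆ e : Fin N × ℕ, X.sigW e.1 (e.2 + 1)) ⊔ (⨆ e : Fin N × ℕ, X.sigH e.1 (e.2 + 1)) ⊔
    (⨆ k : ℕ, X.sigG S (k + 1))

lemma Env.sigW_le (i : Fin N) (k : ℕ) : X.sigW i k ≤ ‹MeasurableSpace Ω› :=
  (X.w_meas i k).comap_le

lemma Env.sigH_le (i : Fin N) (k : ℕ) : X.sigH i k ≤ ‹MeasurableSpace Ω› :=
  (measurable_pi_lambda _ fun r => measurable_pi_lambda _ fun c => X.H_meas i k r c).comap_le

lemma Env.measurable_graph (k : ℕ) : Measurable (X.graph S k) :=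
  (measurable_of_countable S.a).comp (X.chain_meas k)

lemma Env.sigG_le (k : ℕ) : X.sigG S k ≤ ‹MeasurableSpace Ω› := X.measurable_graph k |>.comap_le

lemma Env.measurable_obs (i : Fin N) (k : ℕ) : Measurable (X.obs i k) :=
  X.measurable_obs_of_le (X.sigW_le i k) (X.sigH_le i k)

lemma Env.measurable_path : Measurable (X.path S) :=
  X.measurable_path_of_le (fun _ _ => X.sigW_le _ _) (fun _ _ => X.sigH_le _ _)
    fun _ => X.sigG_le _

lemma Env.comap_path_le_sigRest :
    MeasurableSpace.comap (X.path S) inferInstance ≤ X.sigRest S := by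
  have h : Measurable[X.sigRest S] (X.path S) := X.measurable_path_of_le
    (fun i k => ((le_iSup (fun e : Fin N × ℕ => X.sigW e.1 (e.2 + 1)) (i, k)).trans
      le_sup_left).trans le_sup_left)
    (fun i k => ((le_iSup (fun e : Fin N × ℕ => X.sigH e.1 (e.2 + 1)) (i, k)).trans
      le_sup_right).trans le_sup_left)
    (fun k => (le_iSup (fun k => X.sigG S (k + 1)) k).trans le_sup_right)
  exact h.comap_le

open Classical in
lemma Env.indepFun_noise_path (hPriv : X.PrivacyNoiseAssumption S μ) (T : ℕ) :
    IndepFun (fun ω (e : {e : Fin N × Fin N // S.Edge e.1 e.2} × Fin T) =>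
      X.d e.1.1.1 e.1.1.2 (e.2 + 1) ω) (X.path S) μ := by
  refine indep_of_indep_of_le_left (indep_of_indep_of_le_right hPriv.indep_rest
    X.comap_path_le_sigRest) ?_
  have : Measurable[⨆ e : {e : Fin N × Fin N // S.Edge e.1 e.2} × ℕ,
      X.sigD e.1.1.1 e.1.1.2 (e.2 + 1)]
      (fun ω (e : {e : Fin N × Fin N // S.Edge e.1 e.2} × Fin T) =>
        X.d e.1.1.1 e.1.1.2 (e.2 + 1) ω) := by
    refine @measurable_pi_lambda _ _ _ (_) _ _ fun e => ?_
    exact (comap_measurable (X.d e.1.1.1 e.1.1.2 (e.2 + 1))).mono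
      (le_iSup (fun e : {e : Fin N × Fin N // S.Edge e.1 e.2} × ℕ =>
        X.sigD e.1.1.1 e.1.1.2 (e.2 + 1)) (e.1, (e.2 : ℕ))) le_rfl
  exact this.comap_le

lemma Env.iIndepFun_noise (hPriv : X.PrivacyNoiseAssumption S μ) (T : ℕ) :
    iIndepFun (fun e : {e : Fin N × Fin N // S.Edge e.1 e.2} × Fin T =>
      X.d e.1.1.1 e.1.1.2 (e.2 + 1)) μ := by
  have h := hPriv.indep.precomp (g := fun e : {e : Fin N × Fin N // S.Edge e.1 e.2} × Fin T =>
    (e.1, (e.2 : ℕ))) (by rintro ⟨a, b⟩ ⟨c, d⟩ h; simp at h; ext <;> simp [h])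
  exact h

/-- The condition that the signal from `u` to `v` with index `t` is `a`. -/
def Model.signalEvent (S : Model N n M m) (σ : ℕ → Fin N → Fin N → SignType) (t : ℕ)
    (u v : Fin N) (a : SignType) : Set (ℝ × Path N m) :=
  open Classical in
  {q | (if 0 < q.2.1 t u v then
    (if phi n (t + 1) ⬝ᵥ S.replay q.2 σ t u + q.1 ≤ S.C u v then (1 : SignType) else -1)
      else 0) = a}

lemma Model.measurableSet_signalEvent (σ : ℕ → Fin N → Fin N → SignType) (t : ℕ)
    (u v : Fin N) (a : SignType) : MeasurableSet (S.signalEvent σ t u v a) := by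
  classical
  let _ : MeasurableSpace SignType := ⊤
  have h : Measurable fun q : ℝ × Path N m => (if 0 < q.2.1 t u v then
      (if phi n (t + 1) ⬝ᵥ S.replay q.2 σ t u + q.1 ≤ S.C u v then (1 : SignType) else -1)
      else 0) := by
    refine Measurable.ite (measurableSet_lt measurable_const
      ((Path.measurable_graph t u v).comp measurable_snd)) (Measurable.ite ?_ measurable_const
        measurable_const) measurable_const
    exact measurableSet_le ((((measurable_phi_dotProduct (t + 1)).comp
      (S.measurable_replay σ t u)).comp measurable_snd).add measurable_fst) measurable_const
  exact h (show MeasurableSet {a} from trivial)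

lemma Env.measure_signalEvent [IsProbabilityMeasure μ] (σ : ℕ → Fin N → Fin N → SignType) (t : ℕ)
    (u v : Fin N) (a : SignType) (z : Path N m) :
    μ {ω | (X.d u v (t + 1) ω, z) ∈ S.signalEvent σ t u v a} = ENNReal.ofReal
      (signalProb (z.1 t u v)
        (X.F μ u v (t + 1) (S.C u v - phi n (t + 1) ⬝ᵥ S.replay z σ t u)) a) := by
  have hd := X.d_meas u v (t + 1)
  have hprob : IsProbabilityMeasure (μ.map (X.d u v (t + 1))) :=
    Measure.isProbabilityMeasure_map hd.aemeasurable
  set x := phi n (t + 1) ⬝ᵥ S.replay z σ t u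
  have hset : {ω | x + X.d u v (t + 1) ω ≤ S.C u v} =
      X.d u v (t + 1) ⁻¹' Set.Iic (S.C u v - x) := by
    ext ω; simp [le_sub_iff_add_le, add_comm]
  have hF : μ {ω | x + X.d u v (t + 1) ω ≤ S.C u v} =
      ENNReal.ofReal (X.F μ u v (t + 1) (S.C u v - x)) := by
    rw [hset, ← Measure.map_apply hd measurableSet_Iic, Env.F, ofReal_cdf]
  have hm : MeasurableSet {ω | x + X.d u v (t + 1) ω ≤ S.C u v} := by
    rw [hset]; exact hd measurableSet_Iic
  simp only [Model.signalEvent, signalProb, Set.mem_ofPred_eq]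
  by_cases hg : 0 < z.1 t u v
  · simp only [hg, if_true]
    by_cases h1 : a = 1
    · subst h1
      simp only [if_true]
      rw [← hF]
      congr 1; ext ω
      simp only [Set.mem_ofPred_eq]
      change (if x + X.d u v (t + 1) ω ≤ S.C u v then (1 : SignType) else -1) = 1 ↔ _
      split_ifs with h <;> simp [h]
    · by_cases h2 : a = -1
      · subst h2
        simp only [if_true, if_neg h1]
        rw [ENNReal.ofReal_sub _ (X.F_nonneg μ _ _ _ _), ← hF, ENNReal.ofReal_one,
          ← prob_compl_eq_one_sub hm]
        congr 1; ext ω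
        simp only [Set.mem_ofPred_eq, Set.mem_compl_iff]
        change (if x + X.d u v (t + 1) ω ≤ S.C u v then (1 : SignType) else -1) = -1 ↔ _
        split_ifs with h <;> simp [h]
      · simp only [if_neg h1, if_neg h2, ENNReal.ofReal_zero]
        rw [← measure_empty (μ := μ)]
        congr 1; ext ω
        simp only [Set.mem_ofPred_eq, Set.mem_empty_iff_false, iff_false]
        split_ifs
        · exact fun h => h1 h.symm
        · exact fun h => h2 h.symm
  · simp only [hg, if_false]
    by_cases h0 : a = 0
    · subst h0; simp
    · simp [h0, Ne.symm h0]

-- The map `τ` lets one computation serve both the actual signals (`τ = id`) and those with a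
-- replaced observation. Given the path, the event is a product event in the noises.
open Classical in
lemma Env.measure_record_of_path [IsProbabilityMeasure μ] (hPriv : X.PrivacyNoiseAssumption S μ)
    {τ : Path N m → Path N m} (hτ : Measurable τ) (hτ1 : ∀ z, (τ z).1 = z.1) {B : Set (Path N m)}
    (hB : MeasurableSet B) {T : ℕ} (s : Fin T → Fin N → Fin N → SignType) :
    μ {ω | X.path S ω ∈ B ∧ ∀ t : Fin T, S.sendSignal (X.graph S (t + 1) ω)
        (fun i j => X.d i j (t + 1) ω) (t + 1)
        (S.replay (τ (X.path S ω)) (extendSignals s) t) = s t} =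
      ∫⁻ ω in X.path S ⁻¹' B, ENNReal.ofReal (X.pathProb S μ s (τ (X.path S ω))) ∂μ := by
  have hgraph : ∀ ω t u v, ¬ S.Edge u v → ¬ 0 < (τ (X.path S ω)).1 t u v := fun ω t u v h hpos =>
    h (X.edge_of_path_pos (S := S) ω t u v (by rwa [hτ1] at hpos))
  have hev : ∀ ω, (∀ t : Fin T, S.sendSignal (X.graph S (t + 1) ω)
        (fun i j => X.d i j (t + 1) ω) (t + 1)
        (S.replay (τ (X.path S ω)) (extendSignals s) t) = s t) ↔
      ∀ (t : Fin T) u v, (X.d u v (t + 1) ω, τ (X.path S ω)) ∈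
        S.signalEvent (extendSignals s) t u v (s t u v) := by
    intro ω
    simp only [funext_iff, Model.signalEvent, Set.mem_ofPred_eq, hτ1]
    rfl
  simp only [hev]
  -- Independence is available only for noises on edges of the union graph. Off these edges the
  -- signal is always `0`: the conditions there are void, or else both sides vanish.
  by_cases hs : ∀ (t : Fin T) u v, ¬ S.Edge u v → s t u v = 0
  · have hset : {ω | X.path S ω ∈ B ∧ ∀ (t : Fin T) u v, (X.d u v (t + 1) ω, τ (X.path S ω)) ∈
        S.signalEvent (extendSignals s) t u v (s t u v)} =
        {ω | X.path S ω ∈ B ∧ ∀ e : {e : Fin N × Fin N // S.Edge e.1 e.2} × Fin T,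
          (X.d e.1.1.1 e.1.1.2 (e.2 + 1) ω, X.path S ω) ∈
          (fun q : ℝ × Path N m => (q.1, τ q.2)) ⁻¹' S.signalEvent (extendSignals s) e.2
            e.1.1.1 e.1.1.2 (s e.2 e.1.1.1 e.1.1.2)} := by
      ext ω
      refine and_congr_right fun _ => ⟨fun h e => h _ _ _, fun h t u v => ?_⟩
      by_cases huv : S.Edge u v
      · exact h (⟨(u, v), huv⟩, t)
      · simp only [Model.signalEvent, Set.mem_ofPred_eq, if_neg (hgraph ω t u v huv), hs t u v huv]
    rw [hset, measure_forall_mem_of_indep (fun e => X.d_meas _ _ _) (X.iIndepFun_noise hPriv T)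
      X.measurable_path (X.indepFun_noise_path hPriv T) hB
      (C := fun e => (fun q : ℝ × Path N m => (q.1, τ q.2)) ⁻¹' S.signalEvent (extendSignals s) e.2
            e.1.1.1 e.1.1.2 (s e.2 e.1.1.1 e.1.1.2)) fun e =>
              (measurable_fst.prodMk (hτ.comp measurable_snd))
        (S.measurableSet_signalEvent _ _ _ _ _)]
    refine lintegral_congr fun ω => ?_
    simp only [Set.mem_preimage]
    simp only [X.measure_signalEvent]
    rw [← ENNReal.ofReal_prod_of_nonneg fun e _ => signalProb_nonneg (X.F_nonneg μ _ _ _ _)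
      (X.F_le_one μ _ _ _ _) _]
    congr 1
    simp only [Env.pathProb, Env.stepProb]
    rw [Fintype.prod_prod_type, Finset.prod_comm]
    refine Finset.prod_congr rfl fun t _ => ?_
    rw [← Fintype.prod_prod_type' (f := fun u v => signalProb ((τ (X.path S ω)).1 t u v)
      (X.F μ u v (t + 1) (S.C u v - phi n (t + 1) ⬝ᵥ
        S.replay (τ (X.path S ω)) (extendSignals s) t u)) (s t u v)),
      ← Fintype.prod_subtype_mul_prod_subtype fun e : Fin N × Fin N => S.Edge e.1 e.2]
    rw [Finset.prod_eq_one (s := (Finset.univ :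
      Finset {e : Fin N × Fin N // ¬ S.Edge e.1 e.2})), mul_one]
    intro e _
    simp only [signalProb, if_neg (hgraph ω t _ _ e.2), hs t _ _ e.2, if_true]
  · push Not at hs
    obtain ⟨t, u, v, huv, hne⟩ := hs
    have h1 : {ω | X.path S ω ∈ B ∧ ∀ (t : Fin T) u v, (X.d u v (t + 1) ω, τ (X.path S ω)) ∈
        S.signalEvent (extendSignals s) t u v (s t u v)} = ∅ := by
      ext ω
      simp only [Set.mem_ofPred_eq, Set.mem_empty_iff_false, iff_false, not_and]
      intro _ h
      have := h t u v
      simp only [Model.signalEvent, Set.mem_ofPred_eq, if_neg (hgraph ω t u v huv)] at this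
      exact hne this.symm
    have h2 : ∀ ω, X.pathProb S μ s (τ (X.path S ω)) = 0 := fun ω => by
      refine Finset.prod_eq_zero (Finset.mem_univ t) (Finset.prod_eq_zero (Finset.mem_univ u)
        (Finset.prod_eq_zero (Finset.mem_univ v) ?_))
      simp only [signalProb, if_neg (hgraph ω t u v huv), if_neg hne]
    rw [h1]; simp [h2]

lemma Env.signals_eq_iff {T : ℕ} (s : Fin T → Fin N → Fin N → SignType) (ω : Ω) :
    X.signals S T ω = s ↔ ∀ t : Fin T, S.sendSignal (X.graph S (t + 1) ω)
        (fun i j => X.d i j (t + 1) ω) (t + 1)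
        (S.replay (X.path S ω) (extendSignals s) t) = s t :=
  S.record_eq_iff _ _ _ s

lemma Env.signalsGiven_eq_iff (i : Fin N) (k : ℕ) (y : Fin (m i) → ℝ) {T : ℕ}
    (s : Fin T → Fin N → Fin N → SignType) (ω : Ω) :
    X.signalsGiven S i (k + 1) y T ω = s ↔ ∀ t : Fin T, S.sendSignal (X.graph S (t + 1) ω)
        (fun i j => X.d i j (t + 1) ω) (t + 1)
        (S.replay ((X.path S ω).set i k y) (extendSignals s) t) = s t := by
  have hpath : (fun t => X.graph S (t + 1) ω, fun i' t =>
      (Function.update (fun i' k' => X.obs i' k' ω) i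
        (Function.update (fun k' => X.obs i k' ω) (k + 1) y)) i' (t + 1)) =
      (X.path S ω).set i k y := by
    refine Prod.ext rfl ?_
    funext u t
    by_cases hu : u = i
    · subst hu
      simp only [Function.update_self, Path.set_snd, Function.update_apply, Env.path]
      simp
    · rw [Path.set_snd_of_ne _ hu]
      simp [Function.update_of_ne hu, Env.path]
  rw [← hpath]
  exact S.record_eq_iff _ _ _ s

/-- The likelihood as a mean over the graphs and observations. -/
lemma Env.ofReal_lik [IsProbabilityMeasure μ] (hPriv : X.PrivacyNoiseAssumption S μ) (i : Fin N)
    (k : ℕ) {T : ℕ} (s : Fin T → Fin N → Fin N → SignType) (y : Fin (m i) → ℝ) :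
    ENNReal.ofReal (X.lik S μ i (k + 1) T s y) =
      ∫⁻ ω, ENNReal.ofReal (X.pathProb S μ s ((X.path S ω).set i k y)) ∂μ := by
  rw [Env.lik, ofReal_measureReal]
  simp only [X.signalsGiven_eq_iff]
  have := X.measure_record_of_path hPriv (τ := fun z => z.set i k y)
    (Path.measurable_set measurable_id measurable_const) (fun _ => rfl) MeasurableSet.univ s
  simpa using this

lemma Env.measurable_pathProb_set {Γ : Type*} [MeasurableSpace Γ] (i : Fin N) (k : ℕ)
    {T : ℕ} (s : Fin T → Fin N → Fin N → SignType) {z : Γ → Path N m} {y : Γ → Fin (m i) → ℝ}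
    (hz : Measurable z) (hy : Measurable y) :
    Measurable fun γ => X.pathProb S μ s ((z γ).set i k (y γ)) :=
  (X.measurable_pathProb s).comp (Path.measurable_set hz hy)

lemma Env.integrable_pathProb [IsProbabilityMeasure μ] (i : Fin N) (k : ℕ) {T : ℕ}
    (s : Fin T → Fin N → Fin N → SignType) (y : Fin (m i) → ℝ) :
    Integrable (fun ω => X.pathProb S μ s ((X.path S ω).set i k y)) μ := by
  refine Integrable.of_bound (X.measurable_pathProb_set i k s X.measurable_path
    measurable_const).aestronglyMeasurable 1 (Eventually.of_forall fun ω => ?_)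
  rw [Real.norm_of_nonneg (X.pathProb_nonneg S μ _ _)]
  exact X.pathProb_le_one S μ _ _

lemma Env.lik_nonneg (i : Fin N) (k T : ℕ) (s : Fin T → Fin N → Fin N → SignType)
    (y : Fin (m i) → ℝ) : 0 ≤ X.lik S μ i k T s y := measureReal_nonneg

lemma Env.lik_eq_integral [IsProbabilityMeasure μ] (hPriv : X.PrivacyNoiseAssumption S μ)
    (i : Fin N) (k : ℕ) {T : ℕ} (s : Fin T → Fin N → Fin N → SignType) (y : Fin (m i) → ℝ) :
    X.lik S μ i (k + 1) T s y = ∫ ω, X.pathProb S μ s ((X.path S ω).set i k y) ∂μ := by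
  have h := X.ofReal_lik hPriv i k s y
  rw [← ofReal_integral_eq_lintegral_ofReal (X.integrable_pathProb i k s y)
    (Eventually.of_forall fun ω => X.pathProb_nonneg S μ _ _)] at h
  exact (ENNReal.ofReal_eq_ofReal_iff (X.lik_nonneg i _ T s y)
    (integral_nonneg fun ω => X.pathProb_nonneg S μ _ _)).1 h

/-- The observation of sensor `i` at time `k + 1` is independent of the graphs and of the
other observations. -/
lemma Env.indepFun_obs_path [IsProbabilityMeasure μ] (hNoise : X.NoiseAssumption S μ) (i : Fin N)
    (k : ℕ) : IndepFun (X.obs i (k + 1)) (fun ω => (X.path S ω).set i k 0) μ := by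
  set ms : (Fin N × ℕ) ⊕ (Fin N × ℕ) → MeasurableSpace Ω :=
    Sum.elim (fun e : Fin N × ℕ => X.sigW e.1 (e.2 + 1)) (fun e : Fin N × ℕ => X.sigH e.1 (e.2 + 1))
    with hms
  have hle : ∀ e, ms e ≤ ‹MeasurableSpace Ω› := by
    rintro (e | e)
    · exact X.sigW_le _ _
    · exact X.sigH_le _ _
  -- The two sources of randomness in this observation: its noise and its measurement matrix.
  set A : Set ((Fin N × ℕ) ⊕ (Fin N × ℕ)) := {Sum.inl (i, k), Sum.inr (i, k)} with hA
  have h12 : Indep (⨆ e ∈ A, ms e) (⨆ e ∈ Aᶜ, ms e) μ :=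
    indep_iSup_of_disjoint hle hNoise.indep disjoint_compl_right
  have hall : ∀ e, ms e ≤ (⨆ e : Fin N × ℕ, X.sigW e.1 (e.2 + 1)) ⊔
      (⨆ e : Fin N × ℕ, X.sigH e.1 (e.2 + 1)) := by
    rintro (e | e)
    · exact (le_iSup (fun e : Fin N × ℕ => X.sigW e.1 (e.2 + 1)) e).trans le_sup_left
    · exact (le_iSup (fun e : Fin N × ℕ => X.sigH e.1 (e.2 + 1)) e).trans le_sup_right
  have h123 : Indep ((⨆ e ∈ A, ms e) ⊔ ⨆ e ∈ Aᶜ, ms e) (⨆ k : ℕ, X.sigG S (k + 1)) μ :=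
    indep_of_indep_of_le_left hNoise.indep_graph (sup_le (iSup₂_le fun e _ => hall e)
      (iSup₂_le fun e _ => hall e))
  have hind := indep_sup_right (iSup₂_le fun e _ => hle e) (iSup₂_le fun e _ => hle e)
    (iSup_le fun k => X.sigG_le _) h12 h123
  have hY : MeasurableSpace.comap (X.obs i (k + 1)) inferInstance ≤ ⨆ e ∈ A, ms e := by
    refine Measurable.comap_le (m₁ := ⨆ e ∈ A, ms e) (X.measurable_obs_of_le ?_ ?_)
    · exact le_iSup₂_of_le (f := fun e (_ : e ∈ A) => ms e) (Sum.inl (i, k)) (by simp [hA]) le_rfl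
    · exact le_iSup₂_of_le (f := fun e (_ : e ∈ A) => ms e) (Sum.inr (i, k)) (by simp [hA]) le_rfl
  refine indep_of_indep_of_le_left (indep_of_indep_of_le_right hind ?_) hY
  refine (X.measurable_path_set_of_le (fun u t hne => ?_) (fun u t hne => ?_)
    fun t => (le_iSup (fun k => X.sigG S (k + 1)) t).trans le_sup_right).comap_le
  · exact le_trans (le_iSup₂_of_le (f := fun e (_ : e ∈ Aᶜ) => ms e) (Sum.inl (u, t))
      (by simpa [hA] using hne) le_rfl) le_sup_left
  · exact le_trans (le_iSup₂_of_le (f := fun e (_ : e ∈ Aᶜ) => ms e) (Sum.inr (u, t))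
      (by simpa [hA] using hne) le_rfl) le_sup_left

/-- The likelihoods are conditional probabilities given the observation. -/
theorem Env.measure_signals_eq [IsProbabilityMeasure μ] (hNoise : X.NoiseAssumption S μ)
    (hPriv : X.PrivacyNoiseAssumption S μ) (i : Fin N) (k : ℕ) {T : ℕ}
    (s : Fin T → Fin N → Fin N → SignType) {B : Set (Fin (m i) → ℝ)} (hB : MeasurableSet B) :
    μ {ω | X.obs i (k + 1) ω ∈ B ∧ X.signals S T ω = s} = ∫⁻ ω in X.obs i (k + 1) ⁻¹' B,
      ENNReal.ofReal (X.lik S μ i (k + 1) T s (X.obs i (k + 1) ω)) ∂μ := by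
  -- The path is recovered from the observation and the path with that entry erased. These two are
  -- independent, so Fubini turns the probability into a likelihood evaluated at the observation.
  have hset : ∀ (z : Path N m) (y y' : Fin (m i) → ℝ), (z.set i k y).set i k y' = z.set i k y' := by
    intro z y y'
    refine Prod.ext rfl ?_
    funext u t
    by_cases hu : u = i
    · subst hu; simp only [Path.set_snd]; split_ifs <;> rfl
    · simp only [Path.set_snd_of_ne _ hu]
  have hself : ∀ ω, (X.path S ω).set i k (X.obs i (k + 1) ω) = X.path S ω := by
    intro ω
    refine Prod.ext rfl ?_
    funext u t
    by_cases hu : u = i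
    · subst hu; simp only [Path.set_snd]; split_ifs with ht
      · subst ht; rfl
      · rfl
    · simp only [Path.set_snd_of_ne _ hu]
  have hY := X.measurable_obs i (k + 1)
  have hZ : Measurable fun ω => (X.path S ω).set i k 0 :=
    Path.measurable_set X.measurable_path measurable_const
  have h1 := X.measure_record_of_path hPriv (τ := id) measurable_id (fun _ => rfl)
    ((Path.measurable_obs i k) hB) s
  simp only [X.signals_eq_iff]
  refine h1.trans ?_
  set g : (Fin (m i) → ℝ) × Path N m → ENNReal := fun q =>
    B.indicator (fun y => ENNReal.ofReal (X.pathProb S μ s (q.2.set i k y))) q.1 with hg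
  have hgm : Measurable g := by
    have h0 : Measurable fun q : (Fin (m i) → ℝ) × Path N m =>
        ENNReal.ofReal (X.pathProb S μ s (q.2.set i k q.1)) :=
      (X.measurable_pathProb_set i k s measurable_snd measurable_fst).ennreal_ofReal
    exact h0.indicator (measurable_fst hB)
  have hlaw := (indepFun_iff_map_prod_eq_prod_map_map hY.aemeasurable hZ.aemeasurable).1
    (X.indepFun_obs_path hNoise i k)
  have hprobZ : IsProbabilityMeasure (μ.map fun ω => (X.path S ω).set i k 0) :=
    Measure.isProbabilityMeasure_map hZ.aemeasurable
  calc ∫⁻ ω in X.path S ⁻¹' ((fun z : Path N m => z.2 i k) ⁻¹' B),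
        ENNReal.ofReal (X.pathProb S μ s (id (X.path S ω))) ∂μ
      = ∫⁻ ω, g (X.obs i (k + 1) ω, (X.path S ω).set i k 0) ∂μ := by
        rw [← lintegral_indicator (X.measurable_path ((Path.measurable_obs i k) hB))]
        refine lintegral_congr fun ω => ?_
        simp only [hg, hset, Set.indicator]
        by_cases hω : X.obs i (k + 1) ω ∈ B
        · rw [if_pos hω, if_pos (show ω ∈ X.path S ⁻¹' ((fun z : Path N m => z.2 i k) ⁻¹' B)
            from hω), hself]
          rfl
        · rw [if_neg hω, if_neg (show ω ∉ X.path S ⁻¹' ((fun z : Path N m => z.2 i k) ⁻¹' B)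
            from hω)]
    _ = ∫⁻ q, g q ∂((μ.map (X.obs i (k + 1))).prod (μ.map fun ω => (X.path S ω).set i k 0)) := by
        rw [← hlaw, lintegral_map hgm (hY.prodMk hZ)]
    _ = ∫⁻ ω, ∫⁻ ω', g (X.obs i (k + 1) ω, (X.path S ω').set i k 0) ∂μ ∂μ := by
        rw [lintegral_prod _ hgm.aemeasurable, lintegral_map hgm.lintegral_prod_right' hY]
        refine lintegral_congr fun ω => ?_
        exact lintegral_map (f := fun z => g (X.obs i (k + 1) ω, z))
          (hgm.comp (measurable_const.prodMk measurable_id)) hZ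
    _ = ∫⁻ ω in X.obs i (k + 1) ⁻¹' B,
          ENNReal.ofReal (X.lik S μ i (k + 1) T s (X.obs i (k + 1) ω)) ∂μ := by
        rw [← lintegral_indicator (hY hB)]
        refine lintegral_congr fun ω => ?_
        simp only [hg, hset, X.ofReal_lik hPriv]
        by_cases hω : X.obs i (k + 1) ω ∈ B
        · rw [Set.indicator_of_mem (show ω ∈ X.obs i (k + 1) ⁻¹' B from hω)]
          simp only [Set.indicator_of_mem hω]
        · rw [Set.indicator_of_notMem (show ω ∉ X.obs i (k + 1) ⁻¹' B from hω)]
          simp only [Set.indicator_of_notMem hω, lintegral_zero]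

end Likelihood

/-! ### Regularity of the likelihoods and the bound on the Fisher information -/

/-- Cauchy–Schwarz for `√a` and `√b`. It expresses that mixing two families of laws with the same
weights does not decrease the affinity. -/
lemma integral_sqrt_mul_le {Ω : Type*} [MeasurableSpace Ω] {μ : Measure Ω} {a b : Ω → ℝ}
    (ha : Integrable a μ) (hb : Integrable b μ) (ha0 : ∀ ω, 0 ≤ a ω) (hb0 : ∀ ω, 0 ≤ b ω) :
    ∫ ω, √(a ω * b ω) ∂μ ≤ √((∫ ω, a ω ∂μ) * ∫ ω, b ω ∂μ) := by
  have hL : ∀ {c : Ω → ℝ}, Integrable c μ → (∀ ω, 0 ≤ c ω) →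
      MemLp (fun ω => √(c ω)) (ENNReal.ofReal 2) μ := fun {c} hc hc0 => by
    rw [show ENNReal.ofReal 2 = 2 by simp]
    refine (memLp_two_iff_integrable_sq
      (Real.continuous_sqrt.comp_aestronglyMeasurable hc.aestronglyMeasurable)).2 ?_
    simpa only [Real.sq_sqrt (hc0 _)] using hc
  have h := integral_mul_le_Lp_mul_Lq_of_nonneg Real.HolderConjugate.two_two
    (Eventually.of_forall fun ω => Real.sqrt_nonneg (a ω))
    (Eventually.of_forall fun ω => Real.sqrt_nonneg (b ω)) (hL ha ha0) (hL hb hb0)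
  simp only [Real.rpow_two, Real.sq_sqrt (ha0 _), Real.sq_sqrt (hb0 _), ← Real.sqrt_eq_rpow] at h
  rw [Real.sqrt_mul (integral_nonneg ha0)]
  simpa only [Real.sqrt_mul (ha0 _)] using h

lemma sum_sqrt_sub_sq {ι : Type*} [Fintype ι] {a b : ι → ℝ} (ha : ∀ s, 0 ≤ a s) (hb : ∀ s, 0 ≤ b s)
    (ha1 : ∑ s, a s = 1) (hb1 : ∑ s, b s = 1) :
    ∑ s, (√(a s) - √(b s)) ^ 2 = 2 - 2 * ∑ s, √(a s * b s) := by
  have : ∀ s, (√(a s) - √(b s)) ^ 2 = a s + b s - 2 * √(a s * b s) := fun s => by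
    rw [sub_sq, Real.sq_sqrt (ha s), Real.sq_sqrt (hb s), Real.sqrt_mul (ha s)]; ring
  simp only [this, Finset.sum_sub_distrib, Finset.sum_add_distrib, ha1, hb1, ← Finset.mul_sum]
  norm_num

lemma abs_sub_le_of_sqrt_sub_sq_le {a b c : ℝ} (ha : 0 ≤ a) (hb : 0 ≤ b) (ha1 : a ≤ 1)
    (hb1 : b ≤ 1) (hc : 0 ≤ c) (h : (√a - √b) ^ 2 ≤ c ^ 2) : |a - b| ≤ 2 * c := by
  have h1 : |√a - √b| ≤ c := by
    rw [← abs_of_nonneg hc]; exact sq_le_sq.1 h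
  have h2 : a - b = (√a - √b) * (√a + √b) := by
    nlinarith [Real.sq_sqrt ha, Real.sq_sqrt hb]
  rw [h2, abs_mul, abs_of_nonneg (by positivity : 0 ≤ √a + √b)]
  have := Real.sqrt_le_one.2 ha1
  have := Real.sqrt_le_one.2 hb1
  have := Real.sqrt_nonneg a
  have := Real.sqrt_nonneg b
  nlinarith [abs_nonneg (√a - √b)]

lemma differentiable_prod {E ι : Type*} [NormedAddCommGroup E] [NormedSpace ℝ E] (A : Finset ι)
    {f : ι → E → ℝ} (h : ∀ j, Differentiable ℝ (f j)) :
    Differentiable ℝ fun x => ∏ j ∈ A, f j x := by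
  classical
  induction A using Finset.induction_on with
  | empty => simp
  | insert a A ha ih => simp only [Finset.prod_insert ha]; exact (h a).mul ih

/-- The norm on `Fin r → ℝ` is the sup norm, which costs the factor `√r` against the dot product. -/
lemma exists_dotProduct_mulVec_le {r c : ℕ} (A : Matrix (Fin r) (Fin c) ℝ) :
    ∃ K : ℝ, 0 ≤ K ∧ ∀ v, (A *ᵥ v) ⬝ᵥ (A *ᵥ v) ≤ (K * ‖v‖) ^ 2 := by
  set L := A.mulVecLin.toContinuousLinearMap
  refine ⟨√r * ‖L‖, by positivity, fun v => ?_⟩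
  have h1 : ‖A *ᵥ v‖ ≤ ‖L‖ * ‖v‖ := L.le_opNorm v
  have h2 : (A *ᵥ v) ⬝ᵥ (A *ᵥ v) ≤ r * ‖A *ᵥ v‖ ^ 2 := by
    rw [dotProduct]
    calc ∑ j, (A *ᵥ v) j * (A *ᵥ v) j ≤ ∑ _j : Fin r, ‖A *ᵥ v‖ ^ 2 := by
          refine Finset.sum_le_sum fun j _ => ?_
          have := norm_le_pi_norm (A *ᵥ v) j
          rw [Real.norm_eq_abs] at this
          rw [← abs_mul_abs_self, ← pow_two]
          exact pow_le_pow_left₀ (abs_nonneg _) this 2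
      _ = r * ‖A *ᵥ v‖ ^ 2 := by simp
  refine h2.trans ?_
  rw [mul_assoc, mul_pow, Real.sq_sqrt (Nat.cast_nonneg r)]
  gcongr

/-! ### From the affinity bound to Lipschitz likelihoods and the finite-horizon information bound -/

section Regularity

variable {N n M : ℕ} [NeZero n] {m : Fin N → ℕ} {Ω : Type*} [MeasurableSpace Ω]
  {S : Model N n M m} {X : Env N n M m Ω} {μ : Measure Ω}

lemma Env.one_sub_le_affinity_path_sens [IsProbabilityMeasure μ]
    (hPriv : X.PrivacyNoiseAssumption S μ)
    (hβ : ∀ i k, 1 ≤ k → S.β i k * lamMax (S.Q i) < 1) (ω : Ω) (i : Fin N) (k : ℕ)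
    (y y' : Fin (m i) → ℝ) (T : ℕ) :
    1 - (∑ t ∈ Finset.range T, X.stepInfo S μ i t ((X.path S ω).1 t) * S.sens i k t) / 8 *
        (((S.Hbar i)ᵀ *ᵥ (y - y')) ⬝ᵥ ((S.Hbar i)ᵀ *ᵥ (y - y'))) ≤
      ∑ s : Fin T → Fin N → Fin N → SignType,
        √(X.pathProb S μ s ((X.path S ω).set i k y) *
          X.pathProb S μ s ((X.path S ω).set i k y')) := by
  refine le_trans ?_ (Env.one_sub_le_affinity_path hPriv (X.edge_of_path_pos ω) i k y y' T)
  rw [Finset.sum_div, Finset.sum_mul]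
  refine sub_le_sub_left (Finset.sum_le_sum fun t _ => ?_) _
  have h1 := S.phi_dotProduct_err_sq_le hβ i k t (y - y')
  have h2 := Env.stepInfo_nonneg (X := X) (S := S) (μ := μ) i t ((X.path S ω).1 t)
  calc _ ≤ X.stepInfo S μ i t ((X.path S ω).1 t) / 8 * (S.sens i k t *
      (((S.Hbar i)ᵀ *ᵥ (y - y')) ⬝ᵥ ((S.Hbar i)ᵀ *ᵥ (y - y')))) := by gcongr
    _ = _ := by ring

lemma Env.stepInfo_le (i : Fin N) (t : ℕ) (g : Fin N → Fin N → ℝ) :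
    X.stepInfo S μ i t g ≤ ∑ v ∈ S.nbr i, X.eta μ i v (t + 1) := by
  refine Finset.sum_le_sum fun v _ => ?_
  split_ifs
  · exact le_rfl
  · exact Env.eta_nonneg _ _ _

/-- The Hellinger distance controls the change of each single probability. Counting every neighbour
as connected makes the constant independent of `ω`, so it survives averaging and dominates
difference quotients. -/
lemma Env.exists_lipschitz_pathProb [IsProbabilityMeasure μ] (hPriv : X.PrivacyNoiseAssumption S μ)
    (hβ : ∀ i k, 1 ≤ k → S.β i k * lamMax (S.Q i) < 1) (i : Fin N) (k T : ℕ) :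
    ∃ K : ℝ, 0 ≤ K ∧ ∀ (s : Fin T → Fin N → Fin N → SignType) (ω : Ω) (y y' : Fin (m i) → ℝ),
      |X.pathProb S μ s ((X.path S ω).set i k y) - X.pathProb S μ s ((X.path S ω).set i k y')| ≤
        K * ‖y - y'‖ := by
  obtain ⟨K, hK0, hK⟩ := exists_dotProduct_mulVec_le (S.Hbar i)ᵀ
  set c := ∑ t ∈ Finset.range T, (∑ v ∈ S.nbr i, X.eta μ i v (t + 1)) * S.sens i k t with hc
  have hc0 : 0 ≤ c := Finset.sum_nonneg fun t _ => mul_nonneg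
    (Finset.sum_nonneg fun v _ => Env.eta_nonneg _ _ _) (S.sens_nonneg _ _ _)
  -- The squared Hellinger distance is `2 - 2 · affinity`, which turns `c / 8` into `c / 4`; the
  -- leading `2` bounds `√a + √b`.
  refine ⟨2 * (√(c / 4) * K), by positivity, fun s ω y y' => ?_⟩
  rw [mul_assoc]
  refine abs_sub_le_of_sqrt_sub_sq_le (X.pathProb_nonneg S μ _ _) (X.pathProb_nonneg S μ _ _)
    (X.pathProb_le_one S μ _ _) (X.pathProb_le_one S μ _ _) (by positivity) ?_
  have h1 := sum_sqrt_sub_sq (fun s => X.pathProb_nonneg S μ s ((X.path S ω).set i k y))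
    (fun s => X.pathProb_nonneg S μ s ((X.path S ω).set i k y'))
    (X.sum_pathProb S μ T _) (X.sum_pathProb S μ T _)
  have h2 := Finset.single_le_sum (f := fun s => (√(X.pathProb S μ s ((X.path S ω).set i k y)) -
    √(X.pathProb S μ s ((X.path S ω).set i k y'))) ^ 2) (fun s _ => sq_nonneg _)
    (Finset.mem_univ s)
  have h3 := Env.one_sub_le_affinity_path_sens hPriv hβ ω i k y y' T
  set D := ((S.Hbar i)ᵀ *ᵥ (y - y')) ⬝ᵥ ((S.Hbar i)ᵀ *ᵥ (y - y')) with hD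
  have hD0 : 0 ≤ D := by
    rw [hD, dotProduct]; exact Finset.sum_nonneg fun j _ => mul_self_nonneg _
  have h4 : (∑ t ∈ Finset.range T, X.stepInfo S μ i t ((X.path S ω).1 t) * S.sens i k t) ≤ c :=
    Finset.sum_le_sum fun t _ => mul_le_mul_of_nonneg_right (Env.stepInfo_le _ _ _)
      (S.sens_nonneg _ _ _)
  have h5 := hK (y - y')
  rw [mul_assoc, mul_pow, Real.sq_sqrt (by positivity)]
  have h6 := mul_le_mul_of_nonneg_right h4 hD0
  have h7 := mul_le_mul_of_nonneg_left h5 hc0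
  linarith

lemma Env.lipschitz_lik [IsProbabilityMeasure μ] (hPriv : X.PrivacyNoiseAssumption S μ)
    (hβ : ∀ i k, 1 ≤ k → S.β i k * lamMax (S.Q i) < 1) (i : Fin N) (k T : ℕ)
    (s : Fin T → Fin N → Fin N → SignType) :
    ∃ K, LipschitzWith K (X.lik S μ i (k + 1) T s) := by
  obtain ⟨K, hK0, hK⟩ := Env.exists_lipschitz_pathProb hPriv hβ i k T
  refine ⟨⟨K, hK0⟩, LipschitzWith.of_dist_le_mul fun y y' => ?_⟩
  rw [Real.dist_eq, X.lik_eq_integral hPriv, X.lik_eq_integral hPriv,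
    ← integral_sub (X.integrable_pathProb i k s y) (X.integrable_pathProb i k s y'), dist_eq_norm]
  have h := norm_integral_le_of_norm_le_const (μ := μ)
    (f := fun ω => X.pathProb S μ s ((X.path S ω).set i k y) -
      X.pathProb S μ s ((X.path S ω).set i k y')) (Eventually.of_forall fun ω => hK s ω y y')
  rw [probReal_univ, mul_one] at h
  exact h

lemma Model.differentiable_err (i : Fin N) (k t : ℕ) :
    Differentiable ℝ fun v => S.err i k v t := by
  have hlin : ∀ {r c : ℕ} (A : Matrix (Fin r) (Fin c) ℝ), Differentiable ℝ fun v => A *ᵥ v :=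
    fun A => A.mulVecLin.toContinuousLinearMap.differentiable
  induction t with
  | zero => exact differentiable_const _
  | succ t ih =>
    simp only [Model.err]
    refine (ih.sub (((hlin (S.Q i)).comp ih).const_smul (S.β i (t + 1)))).add ?_
    split_ifs
    · exact (hlin (S.Hbar i)ᵀ).const_smul (S.β i (k + 1))
    · exact differentiable_const _

lemma Model.differentiable_replay (z : Path N m) (σ : ℕ → Fin N → Fin N → SignType) (i u : Fin N)
    (k t : ℕ) : Differentiable ℝ fun y => S.replay (z.set i k y) σ t u := by
  by_cases hu : u = i
  · subst hu
    have : (fun y => S.replay (z.set u k y) σ t u) =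
        fun y => S.err u k y t + S.replay (z.set u k 0) σ t u := by
      funext y
      rw [← sub_eq_iff_eq_add, S.replay_set_sub, sub_zero]
    rw [this]
    exact (S.differentiable_err u k t).add (differentiable_const _)
  · simp only [S.replay_set_of_ne z σ hu]
    exact differentiable_const _

lemma Env.differentiable_pathProb
    (hF : ∀ i' j' k', 1 ≤ k' → S.Edge i' j' → ∀ x,
      HasDerivAt (X.F μ i' j' k') (X.f i' j' k' x) x) {z : Path N m}
    (hz : ∀ t u v, 0 < z.1 t u v → S.Edge u v) (i : Fin N) (k : ℕ) {T : ℕ}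
    (s : Fin T → Fin N → Fin N → SignType) :
    Differentiable ℝ fun y => X.pathProb S μ s (z.set i k y) := by
  simp only [Env.pathProb, Env.stepProb]
  refine differentiable_prod _ fun t => differentiable_prod _ fun u =>
    differentiable_prod _ fun v => ?_
  simp only [Path.set_fst]
  by_cases hg : 0 < z.1 t u v
  · have hFd : Differentiable ℝ (X.F μ u v (t + 1)) := fun x =>
      (hF u v (t + 1) (by omega) (hz t u v hg) x).differentiableAt
    have hphi : Differentiable ℝ fun y => phi n (t + 1) ⬝ᵥ
        S.replay (z.set i k y) (extendSignals s) t u := by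
      simp only [phi, single_one_dotProduct]
      exact differentiable_pi.1 (S.differentiable_replay z _ i u k t) _
    have hp := hFd.comp ((differentiable_const (S.C u v)).sub hphi)
    simp only [signalProb, if_pos hg]
    split_ifs
    · exact hp
    · exact (differentiable_const _).sub hp
    · exact differentiable_const _
  · simp only [signalProb, if_neg hg]
    exact differentiable_const _

/-- Differentiation under the integral, dominated by the Lipschitz constant that is uniform in `ω`.
-/
lemma Env.differentiable_lik [IsProbabilityMeasure μ] (hPriv : X.PrivacyNoiseAssumption S μ)
    (hβ : ∀ i k, 1 ≤ k → S.β i k * lamMax (S.Q i) < 1)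
    (hF : ∀ i' j' k', 1 ≤ k' → S.Edge i' j' → ∀ x,
      HasDerivAt (X.F μ i' j' k') (X.f i' j' k' x) x) (i : Fin N) (k : ℕ) {T : ℕ}
    (s : Fin T → Fin N → Fin N → SignType) : Differentiable ℝ (X.lik S μ i (k + 1) T s) := by
  intro y
  have hfun : X.lik S μ i (k + 1) T s =
      fun y => ∫ ω, X.pathProb S μ s ((X.path S ω).set i k y) ∂μ :=
    funext fun y => X.lik_eq_integral hPriv i k s y
  obtain ⟨K, hK0, hK⟩ := Env.exists_lipschitz_pathProb hPriv hβ i k T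
  set G : Ω → (Fin (m i) → ℝ) → ℝ := fun ω y => X.pathProb S μ s ((X.path S ω).set i k y) with hG
  have hGd : ∀ ω, HasFDerivAt (G ω) (fderiv ℝ (G ω) y) y := fun ω =>
    (Env.differentiable_pathProb hF (X.edge_of_path_pos ω) i k s y).hasFDerivAt
  have hGm : ∀ y, Measurable fun ω => G ω y := fun y =>
    X.measurable_pathProb_set i k s X.measurable_path measurable_const
  -- Directional derivatives are limits of measurable difference quotients; in finite dimension they
  -- determine the derivative as a measurable map.
  have hdir : ∀ v, Measurable fun ω => fderiv ℝ (G ω) y v := fun v => by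
    refine measurable_of_tendsto_metrizable
      (f := fun (j : ℕ) ω => (j : ℝ) • (G ω (y + ((j : ℝ))⁻¹ • v) - G ω y))
      (fun j => ((hGm _).sub (hGm _)).const_smul (j : ℝ)) ?_
    rw [tendsto_pi_nhds]
    intro ω
    exact (hGd ω).lim v (by simpa using tendsto_natCast_atTop_atTop (R := ℝ))
  have hmeas : AEStronglyMeasurable (fun ω => fderiv ℝ (G ω) y) μ := by
    have : (fun ω => fderiv ℝ (G ω) y) = fun ω => ∑ r, fderiv ℝ (G ω) y (Pi.single r 1) •
        (ContinuousLinearMap.proj (R := ℝ) (φ := fun _ : Fin (m i) => ℝ) r) := by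
      funext ω
      ext v
      conv_lhs => rw [pi_eq_sum_univ' v]
      simp [mul_comm]
    rw [this]
    exact Finset.aestronglyMeasurable_fun_sum _ fun r _ =>
      (hdir _).aestronglyMeasurable.smul_const _
  rw [hfun]
  refine (hasFDerivAt_integral_of_dominated_loc_of_lip (F := fun y ω => G ω y)
    (F' := fun ω => fderiv ℝ (G ω) y) (bound := fun _ => K) (Metric.ball_mem_nhds y one_pos)
    (Eventually.of_forall fun y => (hGm y).aestronglyMeasurable)
    (X.integrable_pathProb i k s y) hmeas (Eventually.of_forall fun ω => ?_) (integrable_const K)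
    (Eventually.of_forall hGd)).2.differentiableAt
  refine LipschitzOnWith.of_dist_le_mul fun a _ b _ => ?_
  rw [Real.dist_eq, dist_eq_norm]
  simpa [abs_of_nonneg hK0] using hK s ω a b

/-- In the density case Rademacher's theorem applies: a Lipschitz likelihood is differentiable
Lebesgue-almost everywhere, hence almost surely at the observation. -/
theorem Env.fisherDefined [IsProbabilityMeasure μ] (hPriv : X.PrivacyNoiseAssumption S μ)
    (hβ : ∀ i k, 1 ≤ k → S.β i k * lamMax (S.Q i) < 1) (i : Fin N) (k : ℕ)
    (h : (∀ i' j' k', 1 ≤ k' → S.Edge i' j' → ∀ x,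
      HasDerivAt (X.F μ i' j' k') (X.f i' j' k' x) x) ∨ μ.map (X.obs i (k + 1)) ≪ volume) :
    X.FisherDefined S μ i (k + 1) := by
  intro T s
  rcases h with hF | hac
  · exact Eventually.of_forall fun ω => Env.differentiable_lik hPriv hβ hF i k s _
  · obtain ⟨K, hK⟩ := Env.lipschitz_lik hPriv hβ i k T s
    exact ae_of_ae_map (X.measurable_obs i (k + 1)).aemeasurable
      (hac.ae_le (hK.ae_differentiableAt (μ := volume)))

/-- The bound on the information about the observation with index `k` in the signals with index
below `T`. -/
def Env.infoBound (S : Model N n M m) (X : Env N n M m Ω) (μ : Measure Ω) (i : Fin N)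
    (k T : ℕ) : ℝ :=
  ∑ t ∈ Finset.range T, (∑ j ∈ S.nbr i, X.q S μ i j (t + 1) * X.eta μ i j (t + 1)) * S.sens i k t

lemma Env.measurableSet_edge (i j : Fin N) (t : ℕ) :
    MeasurableSet {ω | 0 < X.graph S t ω i j} :=
  measurableSet_lt measurable_const ((measurable_pi_apply j).comp ((measurable_pi_apply i).comp
    (X.measurable_graph t)))

lemma Env.integrable_integral_stepInfo [IsProbabilityMeasure μ] (i : Fin N) (t : ℕ) :
    Integrable (fun ω => X.stepInfo S μ i t ((X.path S ω).1 t)) μ ∧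
    ∫ ω, X.stepInfo S μ i t ((X.path S ω).1 t) ∂μ =
      ∑ j ∈ S.nbr i, X.q S μ i j (t + 1) * X.eta μ i j (t + 1) := by
  have hind : ∀ j, (fun ω => open Classical in
      if 0 < (X.path S ω).1 t i j then X.eta μ i j (t + 1) else 0) =
      Set.indicator {ω | 0 < X.graph S (t + 1) ω i j} fun _ => X.eta μ i j (t + 1) := by
    intro j; funext ω
    by_cases h : 0 < X.graph S (t + 1) ω i j <;> simp [Set.indicator, Env.path, h]
  have hint : ∀ j, Integrable (Set.indicator {ω | 0 < X.graph S (t + 1) ω i j}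
      fun _ => X.eta μ i j (t + 1)) μ := fun j =>
    (integrable_const _).indicator (X.measurableSet_edge i j (t + 1))
  constructor
  · simp only [Env.stepInfo]
    refine integrable_finsetSum _ fun j _ => ?_
    rw [hind]; exact hint j
  · simp only [Env.stepInfo]
    rw [integral_finsetSum _ fun j _ => by rw [hind]; exact hint j]
    refine Finset.sum_congr rfl fun j _ => ?_
    rw [hind, integral_indicator (X.measurableSet_edge i j (t + 1))]
    simp [Env.q]

lemma Env.sum_lik [IsProbabilityMeasure μ] (hPriv : X.PrivacyNoiseAssumption S μ)
    (i : Fin N) (k T : ℕ) (y : Fin (m i) → ℝ) :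
    ∑ s : Fin T → Fin N → Fin N → SignType, X.lik S μ i (k + 1) T s y = 1 := by
  simp only [X.lik_eq_integral hPriv]
  rw [← integral_finsetSum _ fun s _ => X.integrable_pathProb i k s y]
  simp [X.sum_pathProb]

lemma Env.integrable_sqrt_pathProb_mul [IsProbabilityMeasure μ] (i : Fin N) (k : ℕ) {T : ℕ}
    (s : Fin T → Fin N → Fin N → SignType) (y y' : Fin (m i) → ℝ) :
    Integrable (fun ω => √(X.pathProb S μ s ((X.path S ω).set i k y) *
      X.pathProb S μ s ((X.path S ω).set i k y'))) μ := by
  refine Integrable.of_bound (((X.measurable_pathProb_set i k s X.measurable_path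
    measurable_const).mul (X.measurable_pathProb_set i k s X.measurable_path
    measurable_const)).sqrt).aestronglyMeasurable 1 (Eventually.of_forall fun ω => ?_)
  rw [Real.norm_of_nonneg (Real.sqrt_nonneg _)]
  exact Real.sqrt_le_one.2 (mul_le_one₀ (X.pathProb_le_one S μ _ _) (X.pathProb_nonneg S μ _ _)
    (X.pathProb_le_one S μ _ _))

/-- Hellinger bound for the laws of the signals under two values of the observation. -/
lemma Env.hellinger_lik_le [IsProbabilityMeasure μ] (hPriv : X.PrivacyNoiseAssumption S μ)
    (hβ : ∀ i k, 1 ≤ k → S.β i k * lamMax (S.Q i) < 1) (i : Fin N) (k T : ℕ)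
    (y y' : Fin (m i) → ℝ) :
    ∑ s : Fin T → Fin N → Fin N → SignType,
      (√(X.lik S μ i (k + 1) T s y) - √(X.lik S μ i (k + 1) T s y')) ^ 2 ≤
    X.infoBound S μ i k T / 4 *
      (((S.Hbar i)ᵀ *ᵥ (y - y')) ⬝ᵥ ((S.Hbar i)ᵀ *ᵥ (y - y'))) := by
  rw [sum_sqrt_sub_sq (fun s => X.lik_nonneg _ _ _ _ _) (fun s => X.lik_nonneg _ _ _ _ _)
    (X.sum_lik hPriv i k T y) (X.sum_lik hPriv i k T y')]
  set D := ((S.Hbar i)ᵀ *ᵥ (y - y')) ⬝ᵥ ((S.Hbar i)ᵀ *ᵥ (y - y')) with hD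
  -- The affinity of the averaged laws is at least the averaged affinity. Below, the pathwise bound
  -- is integrated and the edge indicators become the probabilities `q`.
  have hmix : ∫ ω, ∑ s : Fin T → Fin N → Fin N → SignType,
        √(X.pathProb S μ s ((X.path S ω).set i k y) *
          X.pathProb S μ s ((X.path S ω).set i k y')) ∂μ ≤
      ∑ s : Fin T → Fin N → Fin N → SignType,
        √(X.lik S μ i (k + 1) T s y * X.lik S μ i (k + 1) T s y') := by
    rw [integral_finsetSum]
    · refine Finset.sum_le_sum fun s _ => ?_
      rw [X.lik_eq_integral hPriv, X.lik_eq_integral hPriv]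
      exact integral_sqrt_mul_le (X.integrable_pathProb i k s y) (X.integrable_pathProb i k s y')
        (fun ω => X.pathProb_nonneg S μ _ _) (fun ω => X.pathProb_nonneg S μ _ _)
    · exact fun s _ => Env.integrable_sqrt_pathProb_mul i k s y y'
  have hstep : ∀ t, Integrable (fun ω => X.stepInfo S μ i t ((X.path S ω).1 t) * S.sens i k t) μ :=
    fun t => (Env.integrable_integral_stepInfo i t).1.mul_const _
  have hInt : Integrable (fun ω => (∑ t ∈ Finset.range T,
      X.stepInfo S μ i t ((X.path S ω).1 t) * S.sens i k t) / 8 * D) μ :=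
    ((integrable_finsetSum _ fun t _ => hstep t).div_const _).mul_const _
  have hlow : 1 - X.infoBound S μ i k T / 8 * D ≤ ∫ ω, ∑ s : Fin T → Fin N → Fin N → SignType,
        √(X.pathProb S μ s ((X.path S ω).set i k y) *
          X.pathProb S μ s ((X.path S ω).set i k y')) ∂μ := by
    have e : 1 - X.infoBound S μ i k T / 8 * D = ∫ ω, (1 - (∑ t ∈ Finset.range T,
        X.stepInfo S μ i t ((X.path S ω).1 t) * S.sens i k t) / 8 * D) ∂μ := by
      rw [integral_sub (integrable_const _) hInt, integral_mul_const, integral_div,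
        integral_finsetSum _ fun t _ => hstep t]
      simp only [integral_mul_const, (Env.integrable_integral_stepInfo i _).2]
      simp [Env.infoBound]
    rw [e]
    refine integral_mono ((integrable_const _).sub hInt) (integrable_finsetSum _ fun s _ =>
      Env.integrable_sqrt_pathProb_mul i k s y y') fun ω => ?_
    exact Env.one_sub_le_affinity_path_sens hPriv hβ ω i k y y' T
  linarith

lemma Env.score_dotProduct {i : Fin N} {k T : ℕ} {s : Fin T → Fin N → Fin N → SignType}
    (y v : Fin (m i) → ℝ) :
    X.score S μ i k T s y ⬝ᵥ v = fderiv ℝ (fun y' => Real.log (X.lik S μ i k T s y')) y v := by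
  conv_rhs => rw [pi_eq_sum_univ' v]
  simp [Env.score, dotProduct, mul_comm]

/-- At a zero of the likelihood both sides are `0`, the right one by the division convention, so no
positivity has to be assumed. -/
lemma Env.lik_mul_score_sq {i : Fin N} {k T : ℕ} {s : Fin T → Fin N → Fin N → SignType}
    {y : Fin (m i) → ℝ} (hd : DifferentiableAt ℝ (X.lik S μ i k T s) y) (v : Fin (m i) → ℝ) :
    X.lik S μ i k T s y * (X.score S μ i k T s y ⬝ᵥ v) ^ 2 =
      (fderiv ℝ (X.lik S μ i k T s) y v) ^ 2 / X.lik S μ i k T s y := by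
  rw [Env.score_dotProduct]
  rcases (X.lik_nonneg i k T s y).eq_or_lt with h0 | h0
  · rw [← h0]; simp
  · rw [(hd.hasFDerivAt.log h0.ne').fderiv]
    simp only [_root_.smul_apply, smul_eq_mul]
    field_simp

lemma Env.dotProduct_fisher_mulVec {i : Fin N} {k T : ℕ} (y v : Fin (m i) → ℝ) :
    v ⬝ᵥ (X.fisher S μ i k T y *ᵥ v) =
      ∑ s, X.lik S μ i k T s y * (X.score S μ i k T s y ⬝ᵥ v) ^ 2 := by
  simp only [Env.fisher, Matrix.sum_mulVec, dotProduct_sum, Matrix.smul_mulVec, dotProduct_smul,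
    Matrix.vecMulVec_mulVec, smul_eq_mul]
  refine Finset.sum_congr rfl fun s _ => ?_
  congr 1
  rw [dotProduct_comm v]
  simp [pow_two]

/-- The derivative of `√L` has square `L'² / (4 L)`, so the Hellinger bound for increments `v / j`,
scaled by `j²`, yields the information bound in the limit. Only records with `L > 0` contribute
information, and there the root is differentiable; the other Hellinger terms are non-negative and
may be dropped. -/
theorem Env.dotProduct_fisher_mulVec_le [IsProbabilityMeasure μ]
    (hPriv : X.PrivacyNoiseAssumption S μ)
    (hβ : ∀ i k, 1 ≤ k → S.β i k * lamMax (S.Q i) < 1) (i : Fin N) (k T : ℕ)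
    {y : Fin (m i) → ℝ} (hd : ∀ s, DifferentiableAt ℝ (X.lik S μ i (k + 1) T s) y)
    (v : Fin (m i) → ℝ) :
    v ⬝ᵥ (X.fisher S μ i (k + 1) T y *ᵥ v) ≤
      X.infoBound S μ i k T * (((S.Hbar i)ᵀ *ᵥ v) ⬝ᵥ ((S.Hbar i)ᵀ *ᵥ v)) := by
  classical
  set L := fun s => X.lik S μ i (k + 1) T s with hL
  set P := Finset.univ.filter fun s => 0 < L s y with hP
  rw [Env.dotProduct_fisher_mulVec]
  have hsum : ∑ s, L s y * (X.score S μ i (k + 1) T s y ⬝ᵥ v) ^ 2 =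
      ∑ s ∈ P, (fderiv ℝ (L s) y v) ^ 2 / L s y := by
    rw [hP, Finset.sum_filter]
    refine Finset.sum_congr rfl fun s _ => ?_
    split_ifs with h
    · exact Env.lik_mul_score_sq (hd s) v
    · rw [le_antisymm (not_lt.1 h) (X.lik_nonneg i _ T s y), zero_mul]
  change ∑ s, L s y * (X.score S μ i (k + 1) T s y ⬝ᵥ v) ^ 2 ≤ _
  rw [hsum]
  have hlim : Tendsto (fun j : ℕ => ∑ s ∈ P,
      ((j : ℝ) • (√(L s (y + (j : ℝ)⁻¹ • v)) - √(L s y))) ^ 2) atTop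
      (𝓝 (∑ s ∈ P, (fderiv ℝ (L s) y v) ^ 2 / L s y / 4)) := by
    refine tendsto_finsetSum _ fun s hs => ?_
    have hpos : 0 < L s y := (Finset.mem_filter.1 hs).2
    have h1 := ((hd s).hasFDerivAt.sqrt hpos.ne').lim v (c := fun j : ℕ => (j : ℝ)) (l := atTop)
      (by simpa using tendsto_natCast_atTop_atTop (R := ℝ))
    convert h1.pow 2 using 2
    simp only [_root_.smul_apply, smul_eq_mul, mul_pow, div_pow]
    rw [Real.sq_sqrt hpos.le]
    ring
  have hle : ∑ s ∈ P, (fderiv ℝ (L s) y v) ^ 2 / L s y / 4 ≤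
      X.infoBound S μ i k T / 4 * (((S.Hbar i)ᵀ *ᵥ v) ⬝ᵥ ((S.Hbar i)ᵀ *ᵥ v)) := by
    refine le_of_tendsto hlim ?_
    filter_upwards [eventually_gt_atTop 0] with j hj
    have hj' : (0 : ℝ) < j := Nat.cast_pos.2 hj
    have h2 := Env.hellinger_lik_le (X := X) hPriv hβ i k T (y + (j : ℝ)⁻¹ • v) y
    rw [add_sub_cancel_left, Matrix.mulVec_smul, smul_dotProduct, dotProduct_smul] at h2
    calc _ ≤ ∑ s, ((j : ℝ) • (√(L s (y + (j : ℝ)⁻¹ • v)) - √(L s y))) ^ 2 :=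
          Finset.sum_le_sum_of_subset_of_nonneg (Finset.subset_univ _) fun s _ _ => sq_nonneg _
      _ = (j : ℝ) ^ 2 * ∑ s, (√(L s (y + (j : ℝ)⁻¹ • v)) - √(L s y)) ^ 2 := by
          rw [Finset.mul_sum]
          refine Finset.sum_congr rfl fun s _ => ?_
          rw [smul_eq_mul, mul_pow]
      _ ≤ (j : ℝ) ^ 2 * (X.infoBound S μ i k T / 4 * ((j : ℝ)⁻¹ • (j : ℝ)⁻¹ •
            (((S.Hbar i)ᵀ *ᵥ v) ⬝ᵥ ((S.Hbar i)ᵀ *ᵥ v)))) :=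
          mul_le_mul_of_nonneg_left h2 (by positivity)
      _ = _ := by simp only [smul_eq_mul]; field_simp
  rw [← Finset.sum_div] at hle
  linarith

end Regularity

/-! ### The mean Fisher information -/

section QuadraticForms

variable {r : ℕ}

lemma dotProduct_mulVec_single (A : Matrix (Fin r) (Fin r) ℝ) (a b : Fin r) :
    Pi.single a 1 ⬝ᵥ (A *ᵥ Pi.single b 1) = A a b := by
  simp

/-- Test the form on the sum and the difference of two unit vectors. Thus Loewner bounds control all
entries through the diagonal. -/
lemma abs_apply_le_of_posSemidef {A : Matrix (Fin r) (Fin r) ℝ} (hA : A.PosSemidef)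
    (a b : Fin r) : |A a b| ≤ (A a a + A b b) / 2 := by
  have hs : A b a = A a b := by
    have := hA.1.apply a b
    simpa using this
  have h1 := hA.dotProduct_mulVec_nonneg (Pi.single a 1 + Pi.single b 1)
  have h2 := hA.dotProduct_mulVec_nonneg (Pi.single a 1 - Pi.single b 1)
  simp only [star_trivial, Matrix.mulVec_add, Matrix.mulVec_sub, add_dotProduct, sub_dotProduct,
    dotProduct_add, dotProduct_sub, dotProduct_mulVec_single, hs] at h1 h2
  rw [abs_le]; constructor <;> linarith

lemma apply_eq_of_isSymm {A : Matrix (Fin r) (Fin r) ℝ} (hA : Aᵀ = A) (a b : Fin r) :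
    A a b = ((Pi.single a 1 + Pi.single b 1) ⬝ᵥ (A *ᵥ (Pi.single a 1 + Pi.single b 1)) -
      Pi.single a 1 ⬝ᵥ (A *ᵥ Pi.single a 1) - Pi.single b 1 ⬝ᵥ (A *ᵥ Pi.single b 1)) / 2 := by
  have hs : A b a = A a b := congrFun (congrFun hA a) b
  simp only [Matrix.mulVec_add, add_dotProduct, dotProduct_add, dotProduct_mulVec_single, hs]
  ring

lemma dotProduct_mulVec_eq_sum (A : Matrix (Fin r) (Fin r) ℝ) (v : Fin r → ℝ) :
    v ⬝ᵥ (A *ᵥ v) = ∑ a, ∑ b, v a * (A a b * v b) := by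
  simp only [dotProduct, Matrix.mulVec, Finset.mul_sum]

lemma continuous_dotProduct_mulVec (v : Fin r → ℝ) :
    Continuous fun A : Matrix (Fin r) (Fin r) ℝ => v ⬝ᵥ (A *ᵥ v) := by
  simp only [dotProduct_mulVec_eq_sum]
  fun_prop

/-- Bounded monotone quadratic forms converge. -/
lemma exists_tendsto_of_monotone_bounded {J : ℕ → Matrix (Fin r) (Fin r) ℝ}
    (hsymm : ∀ T, (J T)ᵀ = J T) (hmono : ∀ v, Monotone fun T => v ⬝ᵥ (J T *ᵥ v))
    {B : (Fin r → ℝ) → ℝ} (hB : ∀ v T, v ⬝ᵥ (J T *ᵥ v) ≤ B v) :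
    ∃ L, Tendsto J atTop (𝓝 L) := by
  have hq : ∀ v, Tendsto (fun T => v ⬝ᵥ (J T *ᵥ v)) atTop (𝓝 (⨆ T, v ⬝ᵥ (J T *ᵥ v))) := fun v =>
    tendsto_atTop_ciSup (hmono v) ⟨B v, by rintro _ ⟨T, rfl⟩; exact hB v T⟩
  set q : (Fin r → ℝ) → ℝ := fun v => ⨆ T, v ⬝ᵥ (J T *ᵥ v)
  refine ⟨Matrix.of fun a b => (q (Pi.single a 1 + Pi.single b 1) - q (Pi.single a 1) -
    q (Pi.single b 1)) / 2, ?_⟩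
  refine tendsto_pi_nhds.2 fun a => tendsto_pi_nhds.2 fun b => ?_
  simp only [fun T => apply_eq_of_isSymm (hsymm T) a b]
  exact (((hq _).sub (hq _)).sub (hq _)).div_const 2

end QuadraticForms

/-! ### Integrability, monotonicity in the horizon, and convergence of the mean information -/

section MeanFisher

variable {N n M : ℕ} [NeZero n] {m : Fin N → ℕ} {Ω : Type*} [MeasurableSpace Ω]
  {S : Model N n M m} {X : Env N n M m Ω} {μ : Measure Ω}

lemma Env.posSemidef_fisher (i : Fin N) (k T : ℕ) (y : Fin (m i) → ℝ) :
    (X.fisher S μ i k T y).PosSemidef := by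
  refine Matrix.posSemidef_sum _ fun s _ => Matrix.PosSemidef.smul ?_ (X.lik_nonneg i k T s y)
  simpa using Matrix.posSemidef_vecMulVec_self_star (X.score S μ i k T s y)

lemma Env.ae_forall_differentiableAt {i : Fin N} {k : ℕ} (hdef : X.FisherDefined S μ i k) (T : ℕ) :
    ∀ᵐ ω ∂μ, ∀ s, DifferentiableAt ℝ (X.lik S μ i k T s) (X.obs i k ω) :=
  ae_all_iff.2 (hdef T)

lemma Env.integrable_fisher [IsProbabilityMeasure μ] (hPriv : X.PrivacyNoiseAssumption S μ)
    (hβ : ∀ i k, 1 ≤ k → S.β i k * lamMax (S.Q i) < 1) (i : Fin N) (k T : ℕ)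
    (hdef : X.FisherDefined S μ i (k + 1)) (a b : Fin (m i)) :
    Integrable (fun ω => X.fisher S μ i (k + 1) T (X.obs i (k + 1) ω) a b) μ := by
  set C : Fin (m i) → ℝ := fun a => X.infoBound S μ i k T *
    (((S.Hbar i)ᵀ *ᵥ Pi.single a 1) ⬝ᵥ ((S.Hbar i)ᵀ *ᵥ Pi.single a 1)) with hC
  refine Integrable.of_bound ?_ ((C a + C b) / 2) ?_
  · have hm : Measurable fun y => X.fisher S μ i (k + 1) T y a b := by
      simp only [Env.fisher, Matrix.sum_apply, Matrix.smul_apply, Matrix.vecMulVec_apply,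
        smul_eq_mul]
      refine Finset.measurable_sum _ fun s _ => ?_
      obtain ⟨K, hK⟩ := Env.lipschitz_lik hPriv hβ i k T s
      exact hK.continuous.measurable.mul
        ((measurable_fderiv_apply_const ℝ _ _).mul (measurable_fderiv_apply_const ℝ _ _))
    exact (hm.comp (X.measurable_obs i (k + 1))).aestronglyMeasurable
  · filter_upwards [Env.ae_forall_differentiableAt hdef T] with ω hω
    refine (abs_apply_le_of_posSemidef (X.posSemidef_fisher i (k + 1) T _) a b).trans ?_
    have h1 := Env.dotProduct_fisher_mulVec_le hPriv hβ i k T hω (Pi.single a 1)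
    have h2 := Env.dotProduct_fisher_mulVec_le hPriv hβ i k T hω (Pi.single b 1)
    rw [dotProduct_mulVec_single] at h1 h2
    simp only [hC]
    linarith

lemma Env.integrable_dotProduct_fisher [IsProbabilityMeasure μ]
    (hPriv : X.PrivacyNoiseAssumption S μ)
    (hβ : ∀ i k, 1 ≤ k → S.β i k * lamMax (S.Q i) < 1) (i : Fin N) (k T : ℕ)
    (hdef : X.FisherDefined S μ i (k + 1)) (v : Fin (m i) → ℝ) :
    Integrable (fun ω => v ⬝ᵥ (X.fisher S μ i (k + 1) T (X.obs i (k + 1) ω) *ᵥ v)) μ ∧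
    v ⬝ᵥ (X.meanFisherUpTo S μ i (k + 1) T *ᵥ v) =
      ∫ ω, v ⬝ᵥ (X.fisher S μ i (k + 1) T (X.obs i (k + 1) ω) *ᵥ v) ∂μ := by
  have hint := fun a b => X.integrable_fisher hPriv hβ i k T hdef a b
  have hint' : ∀ a b, Integrable (fun ω =>
      v a * (X.fisher S μ i (k + 1) T (X.obs i (k + 1) ω) a b * v b)) μ := fun a b =>
    ((hint a b).mul_const _).const_mul _
  simp only [dotProduct_mulVec_eq_sum]
  refine ⟨integrable_finsetSum _ fun a _ => integrable_finsetSum _ fun b _ => hint' a b, ?_⟩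
  rw [integral_finsetSum _ fun a _ => integrable_finsetSum _ fun b _ => hint' a b]
  refine Finset.sum_congr rfl fun a _ => ?_
  rw [integral_finsetSum _ fun b _ => hint' a b]
  refine Finset.sum_congr rfl fun b _ => ?_
  rw [integral_const_mul, integral_mul_const]
  rfl

lemma Env.transpose_meanFisherUpTo (i : Fin N) (k T : ℕ) :
    (X.meanFisherUpTo S μ i k T)ᵀ = X.meanFisherUpTo S μ i k T := by
  ext a b
  simp only [Env.meanFisherUpTo, Matrix.transpose_apply, Matrix.of_apply]
  refine integral_congr_ae (Eventually.of_forall fun ω => ?_)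
  have := (X.posSemidef_fisher (S := S) (μ := μ) i k T (X.obs i k ω)).1.apply a b
  simpa using this

lemma Env.sum_lik_snoc [IsProbabilityMeasure μ] (hPriv : X.PrivacyNoiseAssumption S μ)
    (i : Fin N) (k : ℕ) {T : ℕ} (s : Fin T → Fin N → Fin N → SignType) (y : Fin (m i) → ℝ) :
    ∑ a, X.lik S μ i (k + 1) (T + 1) (Fin.snoc s a : Fin (T + 1) → Fin N → Fin N → SignType) y =
      X.lik S μ i (k + 1) T s y := by
  simp only [X.lik_eq_integral hPriv]
  rw [← integral_finsetSum _ fun a _ => X.integrable_pathProb i k _ y]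
  simp only [X.sum_pathProb_snoc]

/-- A zero of a non-negative function is a minimum. This covers records of zero likelihood when
horizons are compared. -/
lemma Env.fderiv_lik_eq_zero {i : Fin N} {k T : ℕ} {s : Fin T → Fin N → Fin N → SignType}
    {y : Fin (m i) → ℝ} (h : X.lik S μ i k T s y = 0) : fderiv ℝ (X.lik S μ i k T s) y = 0 :=
  IsLocalMin.fderiv_eq_zero (Eventually.of_forall fun y' => h ▸ X.lik_nonneg i k T s y')

/-- More signals carry more information. -/
lemma Env.dotProduct_fisher_mulVec_mono [IsProbabilityMeasure μ]
    (hPriv : X.PrivacyNoiseAssumption S μ) (i : Fin N) (k T : ℕ) {y : Fin (m i) → ℝ}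
    (hd : ∀ s, DifferentiableAt ℝ (X.lik S μ i (k + 1) T s) y)
    (hd' : ∀ s, DifferentiableAt ℝ (X.lik S μ i (k + 1) (T + 1) s) y) (v : Fin (m i) → ℝ) :
    v ⬝ᵥ (X.fisher S μ i (k + 1) T y *ᵥ v) ≤ v ⬝ᵥ (X.fisher S μ i (k + 1) (T + 1) y *ᵥ v) := by
  rw [Env.dotProduct_fisher_mulVec, Env.dotProduct_fisher_mulVec, sum_fin_succ_pi]
  refine Finset.sum_le_sum fun s _ => ?_
  rw [Env.lik_mul_score_sq (hd s)]
  simp only [fun a => Env.lik_mul_score_sq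
    (hd' (Fin.snoc s a : Fin (T + 1) → Fin N → Fin N → SignType)) v]
  set L := fun a => X.lik S μ i (k + 1) (T + 1)
    (Fin.snoc s a : Fin (T + 1) → Fin N → Fin N → SignType) with hL
  have hsum : X.lik S μ i (k + 1) T s = fun y => ∑ a, L a y :=
    funext fun y => (X.sum_lik_snoc hPriv i k s y).symm
  have hfd : fderiv ℝ (X.lik S μ i (k + 1) T s) y v = ∑ a, fderiv ℝ (L a) y v := by
    rw [hsum, fderiv_fun_sum fun a _ => hd' _]
    simp [hL]
  have hnn : ∀ a, 0 ≤ L a y := fun a => X.lik_nonneg _ _ _ _ _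
  rw [hfd]
  have hy : X.lik S μ i (k + 1) T s y = ∑ a, L a y := congrFun hsum y
  rw [hy]
  refine div_le_of_le_mul₀ (Finset.sum_nonneg fun a _ => hnn a)
    (Finset.sum_nonneg fun a _ => div_nonneg (sq_nonneg _) (hnn a)) ?_
  -- Cauchy–Schwarz over the continuations `a` of the record: `(∑ L_a')² ≤ (∑ L_a'² / L_a) (∑ L_a)`.
  refine Finset.sum_sq_le_sum_mul_sum_of_sq_le_mul _
    (fun a _ => div_nonneg (sq_nonneg _) (hnn a)) (fun a _ => hnn a) fun a _ => ?_
  rcases (hnn a).eq_or_lt with h0 | h0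
  · have : fderiv ℝ (X.lik S μ i (k + 1) (T + 1)
        (Fin.snoc s a : Fin (T + 1) → Fin N → Fin N → SignType)) y = 0 :=
      Env.fderiv_lik_eq_zero h0.symm
    have h : fderiv ℝ (L a) y = 0 := this
    show fderiv ℝ (L a) y v ^ 2 ≤ fderiv ℝ (L a) y v ^ 2 / L a y * L a y
    simp [h]
  · exact (div_mul_cancel₀ _ h0.ne').ge

lemma Env.dotProduct_meanFisherUpTo_mono [IsProbabilityMeasure μ]
    (hPriv : X.PrivacyNoiseAssumption S μ)
    (hβ : ∀ i k, 1 ≤ k → S.β i k * lamMax (S.Q i) < 1) (i : Fin N) (k : ℕ)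
    (hdef : X.FisherDefined S μ i (k + 1)) (v : Fin (m i) → ℝ) :
    Monotone fun T => v ⬝ᵥ (X.meanFisherUpTo S μ i (k + 1) T *ᵥ v) := by
  refine monotone_nat_of_le_succ fun T => ?_
  rw [(X.integrable_dotProduct_fisher hPriv hβ i k T hdef v).2,
    (X.integrable_dotProduct_fisher hPriv hβ i k (T + 1) hdef v).2]
  refine integral_mono_ae (X.integrable_dotProduct_fisher hPriv hβ i k T hdef v).1
    (X.integrable_dotProduct_fisher hPriv hβ i k (T + 1) hdef v).1 ?_
  filter_upwards [Env.ae_forall_differentiableAt hdef T,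
    Env.ae_forall_differentiableAt hdef (T + 1)] with ω h1 h2
  exact X.dotProduct_fisher_mulVec_mono hPriv i k T h1 h2 v

lemma Env.dotProduct_meanFisherUpTo_le [IsProbabilityMeasure μ]
    (hPriv : X.PrivacyNoiseAssumption S μ)
    (hβ : ∀ i k, 1 ≤ k → S.β i k * lamMax (S.Q i) < 1) (i : Fin N) (k T : ℕ)
    (hdef : X.FisherDefined S μ i (k + 1)) (v : Fin (m i) → ℝ) :
    v ⬝ᵥ (X.meanFisherUpTo S μ i (k + 1) T *ᵥ v) ≤
      X.infoBound S μ i k T * (((S.Hbar i)ᵀ *ᵥ v) ⬝ᵥ ((S.Hbar i)ᵀ *ᵥ v)) := by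
  rw [(X.integrable_dotProduct_fisher hPriv hβ i k T hdef v).2]
  refine (integral_mono_ae (X.integrable_dotProduct_fisher hPriv hβ i k T hdef v).1
    (integrable_const (X.infoBound S μ i k T *
      (((S.Hbar i)ᵀ *ᵥ v) ⬝ᵥ ((S.Hbar i)ᵀ *ᵥ v)))) ?_).trans (by simp)
  filter_upwards [Env.ae_forall_differentiableAt hdef T] with ω h1
  exact Env.dotProduct_fisher_mulVec_le hPriv hβ i k T h1 v

/-! ### The series bound -/

lemma Env.coef_nonneg (i j : Fin N) (k t : ℕ) : 0 ≤ X.coef S μ i j k t := by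
  have h1 : 0 ≤ X.q S μ i j t := measureReal_nonneg
  have h2 : 0 ≤ X.eta μ i j t := Env.eta_nonneg _ _ _
  unfold Env.coef
  positivity

lemma Env.infoBound_le_sum_coef (i : Fin N) (k T : ℕ) :
    X.infoBound S μ i k T ≤
      ∑ j ∈ S.nbr i, ∑ t ∈ Finset.range T, X.coef S μ i j (k + 1) (k + 1 + 1 + t) := by
  have hq : ∀ j t, 0 ≤ X.q S μ i j t * X.eta μ i j t := fun j t =>
    mul_nonneg measureReal_nonneg (Env.eta_nonneg _ _ _)
  calc X.infoBound S μ i k T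
      -- The sensitivity vanishes up to index `k`. Enlarging the horizon by `k + 1` leaves exactly
      -- `T` further terms after those zeros.
      ≤ ∑ t ∈ Finset.range (k + 1 + T),
          (∑ j ∈ S.nbr i, X.q S μ i j (t + 1) * X.eta μ i j (t + 1)) * S.sens i k t :=
        Finset.sum_le_sum_of_subset_of_nonneg (Finset.range_mono (by omega)) fun t _ _ =>
          mul_nonneg (Finset.sum_nonneg fun j _ => hq j _) (S.sens_nonneg _ _ _)
    _ = ∑ t ∈ Finset.range T, (∑ j ∈ S.nbr i,
          X.q S μ i j (k + 1 + t + 1) * X.eta μ i j (k + 1 + t + 1)) * S.sens i k (k + 1 + t) := by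
        rw [Finset.sum_range_add, Finset.sum_eq_zero (s := Finset.range (k + 1)), zero_add]
        intro t ht
        rw [Model.sens, if_neg (by have := Finset.mem_range.1 ht; omega), mul_zero]
    _ = _ := by
        rw [Finset.sum_comm]
        refine Finset.sum_congr rfl fun t _ => ?_
        rw [Finset.sum_mul]
        refine Finset.sum_congr rfl fun j _ => ?_
        rw [Model.sens, if_pos (by omega), Env.coef, show k + 1 + 1 + t = k + 1 + t + 1 by omega]
        ring

/-- Against the assumed series, each product lacks the factors up to time `k + 1`, a fixed positive
number, and the last factor. The latter tends to `1`, since square summability forces `β → 0`. -/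
lemma Env.summable_coef [IsProbabilityMeasure μ]
    (hβ : ∀ i k, 1 ≤ k → S.β i k * lamMax (S.Q i) < 1) {i j : Fin N}
    (hsq : Summable fun k : ℕ => S.β i (k + 1) ^ 2)
    (hsum : Summable fun t : ℕ => X.eta μ i j (t + 1) *
        ∏ l ∈ Finset.Icc 1 (t + 1), (1 - lamMinPos (S.Q i) * S.β i l) ^ 2) (k : ℕ) :
    Summable fun t : ℕ => X.coef S μ i j (k + 1) (k + 1 + 1 + t) := by
  set c : ℕ → ℝ := fun l => 1 - lamMinPos (S.Q i) * S.β i l with hc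
  have hcpos : ∀ l, 1 ≤ l → 0 < c l := fun l hl => by
    have := lamMinPos_mul_lt_one (S.Hbar i) (S.β_nonneg i l hl) (hβ i l hl)
    simp only [hc, Model.Q]; linarith
  set P := ∏ l ∈ Finset.Icc 1 (k + 1), c l ^ 2 with hP
  have hPpos : 0 < P := Finset.prod_pos fun l hl => pow_pos (hcpos l (Finset.mem_Icc.1 hl).1) 2
  have hlim : Tendsto (fun t => c (k + 1 + 1 + t)) atTop (𝓝 1) := by
    have h1 : Tendsto (fun t => S.β i (t + 1)) atTop (𝓝 0) := by
      have := hsq.tendsto_atTop_zero.sqrt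
      simp only [Real.sqrt_zero] at this
      refine this.congr fun t => Real.sqrt_sq (S.β_nonneg i _ (by omega))
    have h2 := (h1.comp (tendsto_add_atTop_nat (k + 1))).const_mul (lamMinPos (S.Q i))
    have h3 := h2.const_sub 1
    simp only [mul_zero, sub_zero] at h3
    refine h3.congr fun t => ?_
    simp only [hc, Function.comp]
    rw [show t + (k + 1) + 1 = k + 1 + 1 + t by omega]
  have hev : ∀ᶠ t in atTop, 1 / 2 < c (k + 1 + 1 + t) :=
    hlim.eventually (lt_mem_nhds (by norm_num))
  have hshift := (summable_nat_add_iff (k + 1)).2 hsum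
  -- `P` restores the initial factors, and `4` pays for the squared last factor once that factor
  -- exceeds `1 / 2`.
  refine Summable.of_norm_bounded_eventually_nat (hshift.mul_left (S.β i (k + 1) ^ 2 * (4 / P))) ?_
  filter_upwards [hev] with t ht
  rw [Real.norm_of_nonneg (Env.coef_nonneg _ _ _ _)]
  have hη : 0 ≤ X.eta μ i j (k + 1 + 1 + t) := Env.eta_nonneg _ _ _
  have hq : X.q S μ i j (k + 1 + 1 + t) ≤ 1 := measureReal_le_one
  have hq0 : 0 ≤ X.q S μ i j (k + 1 + 1 + t) := measureReal_nonneg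
  set R := ∏ l ∈ Finset.Ico (k + 1 + 1) (k + 1 + 1 + t), c l with hR
  have hsplit : ∏ l ∈ Finset.Icc 1 (t + (k + 1) + 1), c l ^ 2 =
      P * R ^ 2 * c (k + 1 + 1 + t) ^ 2 := by
    have e1 : Finset.Icc 1 (t + (k + 1) + 1) = Finset.Ico 1 (k + 1 + 1 + t + 1) := by
      ext l; simp only [Finset.mem_Icc, Finset.mem_Ico]; omega
    have e2 : Finset.Icc 1 (k + 1) = Finset.Ico 1 (k + 1 + 1) := by
      ext l; simp only [Finset.mem_Icc, Finset.mem_Ico]; omega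
    rw [e1, Finset.prod_Ico_succ_top (by omega), hP, e2, hR, ← Finset.prod_pow,
      Finset.prod_Ico_consecutive _ (by omega) (by omega)]
  rw [hsplit, show t + (k + 1) + 1 = k + 1 + 1 + t by omega]
  have h4 : 1 ≤ 4 * c (k + 1 + 1 + t) ^ 2 := by nlinarith
  calc X.coef S μ i j (k + 1) (k + 1 + 1 + t)
      = S.β i (k + 1) ^ 2 * (X.q S μ i j (k + 1 + 1 + t) *
          (X.eta μ i j (k + 1 + 1 + t) * R ^ 2)) := by
        simp only [Env.coef, hR, hc]; ring
    _ ≤ S.β i (k + 1) ^ 2 * (1 * (X.eta μ i j (k + 1 + 1 + t) * R ^ 2)) := by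
        gcongr
    _ ≤ S.β i (k + 1) ^ 2 * (X.eta μ i j (k + 1 + 1 + t) * R ^ 2) *
          (4 * c (k + 1 + 1 + t) ^ 2) := by
        rw [one_mul]; exact le_mul_of_one_le_right (by positivity) h4
    _ = _ := by field_simp

lemma dotProduct_outer_mulVec {r c : ℕ} (H : Matrix (Fin r) (Fin c) ℝ) (v : Fin r → ℝ) :
    v ⬝ᵥ ((H * Hᵀ) *ᵥ v) = (Hᵀ *ᵥ v) ⬝ᵥ (Hᵀ *ᵥ v) := by
  rw [← Matrix.mulVec_mulVec, Matrix.dotProduct_mulVec, ← Matrix.mulVec_transpose]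

/-- The coefficients are summable unless the matrix they multiply vanishes. -/
lemma Env.summable_coef_or [IsProbabilityMeasure μ]
    (hβ : ∀ i k, 1 ≤ k → S.β i k * lamMax (S.Q i) < 1)
    (hsq : ∀ i, Summable fun k : ℕ => S.β i (k + 1) ^ 2)
    (h_ii : ∀ i j, S.Edge i j → S.Q i ≠ 0 →
      Summable fun t : ℕ => X.eta μ i j (t + 1) *
        ∏ l ∈ Finset.Icc 1 (t + 1), (1 - lamMinPos (S.Q i) * S.β i l) ^ 2) (i : Fin N) (k : ℕ) :
    S.Hbar i = 0 ∨ ∀ j ∈ S.nbr i,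
      Summable fun t : ℕ => X.coef S μ i j (k + 1) (k + 1 + 1 + t) := by
  by_cases hQ : S.Q i = 0
  · exact Or.inl (gram_eq_zero hQ)
  · refine Or.inr fun j hj => Env.summable_coef hβ (hsq i) (h_ii i j ?_ hQ) k
    simpa [Model.nbr] using hj

lemma Env.seriesBound_eq_smul {i : Fin N} {k : ℕ}
    (h : ∀ j ∈ S.nbr i, Summable fun t : ℕ => X.coef S μ i j (k + 1) (k + 1 + 1 + t)) :
    X.seriesBound S μ i (k + 1) =
      (∑ j ∈ S.nbr i, ∑' t : ℕ, X.coef S μ i j (k + 1) (k + 1 + 1 + t)) •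
        (S.Hbar i * (S.Hbar i)ᵀ) := by
  rw [Env.seriesBound, Finset.sum_smul]
  exact Finset.sum_congr rfl fun j hj => (h j hj).tsum_smul_const _

/-- The information up to any horizon is at most any bound for the partial sums of the series. -/
lemma Env.posSemidef_sub_meanFisher_of_tendsto [IsProbabilityMeasure μ]
    (hPriv : X.PrivacyNoiseAssumption S μ)
    (hβ : ∀ i k, 1 ≤ k → S.β i k * lamMax (S.Q i) < 1) {i : Fin N} {k : ℕ}
    (hdef : X.FisherDefined S μ i (k + 1)) {J : Matrix (Fin (m i)) (Fin (m i)) ℝ}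
    (hJ : Tendsto (fun T => X.meanFisherUpTo S μ i (k + 1) T) atTop (𝓝 J)) {B : ℝ}
    (hB : S.Hbar i = 0 ∨ ∀ T, ∑ j ∈ S.nbr i, ∑ t ∈ Finset.range T,
      X.coef S μ i j (k + 1) (k + 1 + 1 + t) ≤ B) :
    (B • (S.Hbar i * (S.Hbar i)ᵀ) - J).PosSemidef := by
  refine Matrix.PosSemidef.of_dotProduct_mulVec_nonneg ?_ fun v => ?_
  · have hJs : Jᵀ = J := by
      refine tendsto_nhds_unique ?_ hJ
      have : Tendsto (fun T => (X.meanFisherUpTo S μ i (k + 1) T)ᵀ) atTop (𝓝 Jᵀ) :=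
        (continuous_id.matrix_transpose.tendsto J).comp hJ
      simpa only [Env.transpose_meanFisherUpTo] using this
    rw [Matrix.IsHermitian, Matrix.conjTranspose_eq_transpose_of_trivial, Matrix.transpose_sub,
      hJs, Matrix.transpose_smul, Matrix.transpose_mul, Matrix.transpose_transpose]
  · have hlim := ((continuous_dotProduct_mulVec v).tendsto J).comp hJ
    have hle : v ⬝ᵥ (J *ᵥ v) ≤ B * (((S.Hbar i)ᵀ *ᵥ v) ⬝ᵥ ((S.Hbar i)ᵀ *ᵥ v)) := by
      refine le_of_tendsto' hlim fun T => ?_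
      refine (Env.dotProduct_meanFisherUpTo_le hPriv hβ i k T hdef v).trans ?_
      rcases hB with h0 | hB
      · simp [h0]
      · refine mul_le_mul_of_nonneg_right ((Env.infoBound_le_sum_coef i k T).trans (hB T)) ?_
        rw [dotProduct]; exact Finset.sum_nonneg fun j _ => mul_self_nonneg _
    rw [star_trivial, Matrix.sub_mulVec, dotProduct_sub, Matrix.smul_mulVec, dotProduct_smul,
      dotProduct_outer_mulVec, smul_eq_mul]
    linarith

lemma Env.tendsto_meanFisher [IsProbabilityMeasure μ] (hPriv : X.PrivacyNoiseAssumption S μ)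
    (hβ : ∀ i k, 1 ≤ k → S.β i k * lamMax (S.Q i) < 1)
    (hsq : ∀ i, Summable fun k : ℕ => S.β i (k + 1) ^ 2)
    (h_ii : ∀ i j, S.Edge i j → S.Q i ≠ 0 →
      Summable fun t : ℕ => X.eta μ i j (t + 1) *
        ∏ l ∈ Finset.Icc 1 (t + 1), (1 - lamMinPos (S.Q i) * S.β i l) ^ 2) {i : Fin N} {k : ℕ}
    (hdef : X.FisherDefined S μ i (k + 1)) :
    Tendsto (fun T => X.meanFisherUpTo S μ i (k + 1) T) atTop (𝓝 (X.meanFisher S μ i (k + 1))) := by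
  refine tendsto_nhds_limUnder (exists_tendsto_of_monotone_bounded
    (fun T => X.transpose_meanFisherUpTo i (k + 1) T)
    (Env.dotProduct_meanFisherUpTo_mono hPriv hβ i k hdef)
    (B := fun v => (∑ j ∈ S.nbr i, ∑' t : ℕ, X.coef S μ i j (k + 1) (k + 1 + 1 + t)) *
      (((S.Hbar i)ᵀ *ᵥ v) ⬝ᵥ ((S.Hbar i)ᵀ *ᵥ v))) fun v T => ?_)
  refine (Env.dotProduct_meanFisherUpTo_le hPriv hβ i k T hdef v).trans ?_
  rcases Env.summable_coef_or hβ hsq h_ii i k with h0 | hs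
  · simp [h0]
  · refine mul_le_mul_of_nonneg_right ((Env.infoBound_le_sum_coef i k T).trans
      (Finset.sum_le_sum fun j hj => (hs j hj).sum_le_tsum _ fun t _ =>
        Env.coef_nonneg _ _ _ _)) ?_
    rw [dotProduct]; exact Finset.sum_nonneg fun j _ => mul_self_nonneg _

theorem Env.posSemidef_seriesBound_sub [IsProbabilityMeasure μ]
    (hPriv : X.PrivacyNoiseAssumption S μ)
    (hβ : ∀ i k, 1 ≤ k → S.β i k * lamMax (S.Q i) < 1)
    (hsq : ∀ i, Summable fun k : ℕ => S.β i (k + 1) ^ 2)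
    (h_ii : ∀ i j, S.Edge i j → S.Q i ≠ 0 →
      Summable fun t : ℕ => X.eta μ i j (t + 1) *
        ∏ l ∈ Finset.Icc 1 (t + 1), (1 - lamMinPos (S.Q i) * S.β i l) ^ 2) {i : Fin N} {k : ℕ}
    (hdef : X.FisherDefined S μ i (k + 1)) :
    (X.seriesBound S μ i (k + 1) - X.meanFisher S μ i (k + 1)).PosSemidef := by
  have hJ := Env.tendsto_meanFisher hPriv hβ hsq h_ii hdef
  rcases Env.summable_coef_or hβ hsq h_ii i k with h0 | hs
  · have : X.seriesBound S μ i (k + 1) = (0 : ℝ) • (S.Hbar i * (S.Hbar i)ᵀ) := by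
      simp [Env.seriesBound, h0]
    rw [this]
    exact Env.posSemidef_sub_meanFisher_of_tendsto hPriv hβ hdef hJ (Or.inl h0)
  · rw [Env.seriesBound_eq_smul hs]
    exact Env.posSemidef_sub_meanFisher_of_tendsto hPriv hβ hdef hJ (Or.inr fun T =>
      Finset.sum_le_sum fun j hj => (hs j hj).sum_le_tsum _ fun t _ => Env.coef_nonneg _ _ _ _)

lemma Env.posSemidef_meanFisher [IsProbabilityMeasure μ] (hPriv : X.PrivacyNoiseAssumption S μ)
    (hβ : ∀ i k, 1 ≤ k → S.β i k * lamMax (S.Q i) < 1)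
    (hsq : ∀ i, Summable fun k : ℕ => S.β i (k + 1) ^ 2)
    (h_ii : ∀ i j, S.Edge i j → S.Q i ≠ 0 →
      Summable fun t : ℕ => X.eta μ i j (t + 1) *
        ∏ l ∈ Finset.Icc 1 (t + 1), (1 - lamMinPos (S.Q i) * S.β i l) ^ 2) {i : Fin N} {k : ℕ}
    (hdef : X.FisherDefined S μ i (k + 1)) : (X.meanFisher S μ i (k + 1)).PosSemidef := by
  have hJ := Env.tendsto_meanFisher hPriv hβ hsq h_ii hdef
  refine Matrix.PosSemidef.of_dotProduct_mulVec_nonneg ?_ fun v => ?_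
  · have := (continuous_id.matrix_transpose.tendsto (X.meanFisher S μ i (k + 1))).comp hJ
    rw [Matrix.IsHermitian, Matrix.conjTranspose_eq_transpose_of_trivial]
    refine tendsto_nhds_unique (this.congr fun T => ?_) hJ
    exact X.transpose_meanFisherUpTo i (k + 1) T
  · refine ge_of_tendsto' (((continuous_dotProduct_mulVec v).tendsto _).comp hJ) fun T => ?_
    simp only [Function.comp]
    rw [(X.integrable_dotProduct_fisher hPriv hβ i k T hdef v).2]
    refine integral_nonneg fun ω => ?_
    simpa using (X.posSemidef_fisher (S := S) (μ := μ) i (k + 1) T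
      (X.obs i (k + 1) ω)).dotProduct_mulVec_nonneg v

end MeanFisher

/-! ### Explicit rates -/

section Rates

/-- The mean value theorem on a unit interval: it supplies the telescoping inequalities that play
the role of integral comparison. -/
lemma le_sub_of_hasDerivAt {Φ φ : ℝ → ℝ} {a c : ℝ}
    (hΦ : ∀ x ∈ Set.Icc a (a + 1), HasDerivAt Φ (φ x) x)
    (hc : ∀ x ∈ Set.Icc a (a + 1), c ≤ φ x) : c ≤ Φ (a + 1) - Φ a := by
  obtain ⟨x, hx, h⟩ := exists_hasDerivAt_eq_slope Φ φ (by linarith : a < a + 1)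
    (fun x hx => (hΦ x hx).continuousAt.continuousWithinAt)
    fun x hx => hΦ x (Set.Ioo_subset_Icc_self hx)
  have := hc x (Set.Ioo_subset_Icc_self hx)
  rw [h] at this
  simpa using this

/-- A potential for the logarithms of the factors bounds their product. -/
lemma prod_le_exp_sub {c : ℕ → ℝ} {G : ℕ → ℝ} {k : ℕ} (h0 : ∀ l, k < l → 0 ≤ 1 - c l)
    (hG : ∀ l, k < l → G (l + 1) - G l ≤ c l) (r : ℕ) :
    ∏ l ∈ Finset.Ico (k + 1) (k + 1 + r), (1 - c l) ≤ Real.exp (-(G (k + 1 + r) - G (k + 1))) := by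
  induction r with
  | zero => simp
  | succ r ih =>
    rw [← add_assoc, Finset.prod_Ico_succ_top (by omega)]
    have h1 : 1 - c (k + 1 + r) ≤ Real.exp (-(G (k + 1 + r + 1) - G (k + 1 + r))) := by
      have := Real.add_one_le_exp (-(G (k + 1 + r + 1) - G (k + 1 + r)))
      have := hG (k + 1 + r) (by omega)
      linarith
    calc _ ≤ Real.exp (-(G (k + 1 + r) - G (k + 1))) *
          Real.exp (-(G (k + 1 + r + 1) - G (k + 1 + r))) :=
        mul_le_mul ih h1 (h0 _ (by omega)) (Real.exp_nonneg _)
      _ = _ := by rw [← Real.exp_add]; congr 1; ring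

lemma sum_le_of_le_sub {w Φ : ℕ → ℝ} {k : ℕ} (hΦ : ∀ l, 0 ≤ Φ l)
    (h : ∀ l, k ≤ l → w (l + 1) ≤ Φ l - Φ (l + 1)) (T : ℕ) :
    ∑ r ∈ Finset.range T, w (k + 1 + r) ≤ Φ k := by
  suffices H : ∑ r ∈ Finset.range T, w (k + 1 + r) ≤ Φ k - Φ (k + T) by
    linarith [hΦ (k + T)]
  induction T with
  | zero => simp
  | succ T ih =>
    rw [Finset.sum_range_succ]
    have := h (k + T) (by omega)
    rw [show k + 1 + T = k + T + 1 by omega, ← add_assoc]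
    linarith

variable {lam b δ ε : ℝ}

/-- The potential `c log l` bounds the squared product by `((k + 1) / t) ^ (2c)`. What remains is a
tail of `t ^ (-p)` with `p > 1`, at most `k ^ (1 - p) / (p - 1)`. -/
lemma sum_le_rateConst_of_eq_one {k : ℕ} (hk : 2 ≤ k) (hlam : 0 < lam) (hb : 0 < b)
    (hε : 0 ≤ ε) (h : 1 < 2 * lam * b + 2 * ε)
    (hfac : ∀ l : ℕ, k < l → 0 ≤ 1 - lam * (b / (l : ℝ))) (T : ℕ) :
    b / (k : ℝ) * ∑ r ∈ Finset.range T, 1 / ((k + 1 + r : ℕ) : ℝ) ^ (2 * ε) *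
      (∏ l ∈ Finset.Ico (k + 1) (k + 1 + r), (1 - lam * (b / (l : ℝ)))) ^ 2 ≤
    rateConst lam b 1 ε k / (k : ℝ) ^ (2 * ε) := by
  set c := lam * b with hc
  have hc0 : 0 < c := mul_pos hlam hb
  set p := 2 * lam * b + 2 * ε with hp
  have hpc : p = 2 * c + 2 * ε := by rw [hp, hc]; ring
  have hkpos : (0 : ℝ) < k := by exact_mod_cast (by omega : 0 < k)
  have hk1 : (0 : ℝ) < (k : ℝ) + 1 := by linarith
  have hk2 : (0 : ℝ) < (k : ℝ) - 1 := by
    have : (2 : ℝ) ≤ k := by exact_mod_cast hk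
    linarith
  have hprod : ∀ r : ℕ, (∏ l ∈ Finset.Ico (k + 1) (k + 1 + r), (1 - lam * (b / (l : ℝ)))) ^ 2 ≤
      ((k : ℝ) + 1) ^ (2 * c) * ((k + 1 + r : ℕ) : ℝ) ^ (-(2 * c)) := by
    intro r
    have h1 := prod_le_exp_sub (c := fun l => lam * (b / (l : ℝ)))
      (G := fun l => c * Real.log l) hfac (fun l hl => by
        have hl0 : (0 : ℝ) < l := by exact_mod_cast (by omega : 0 < l)
        have h2 := Real.log_le_sub_one_of_pos (x := ((l : ℝ) + 1) / l) (by positivity)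
        rw [Real.log_div (by positivity) hl0.ne'] at h2
        have h3 : ((l : ℝ) + 1) / l - 1 = 1 / l := by field_simp; ring
        rw [h3] at h2
        push_cast
        calc c * Real.log ((l : ℝ) + 1) - c * Real.log l
            = c * (Real.log ((l : ℝ) + 1) - Real.log l) := by ring
          _ ≤ c * (1 / l) := by gcongr
          _ = lam * (b / l) := by rw [hc]; ring) r
    have h0 : 0 ≤ ∏ l ∈ Finset.Ico (k + 1) (k + 1 + r), (1 - lam * (b / (l : ℝ))) :=
      Finset.prod_nonneg fun l hl => hfac l (by have := Finset.mem_Ico.1 hl; omega)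
    refine (pow_le_pow_left₀ h0 h1 2).trans (le_of_eq ?_)
    have ht : (0 : ℝ) < ((k + 1 + r : ℕ) : ℝ) := by exact_mod_cast (by omega : 0 < k + 1 + r)
    rw [← Real.exp_nat_mul, Real.rpow_def_of_pos hk1, Real.rpow_def_of_pos ht, ← Real.exp_add]
    congr 1
    push_cast
    ring
  have hstep : ∀ l : ℕ, k ≤ l → ((l + 1 : ℕ) : ℝ) ^ (-p) ≤
      (l : ℝ) ^ (1 - p) / (p - 1) - ((l + 1 : ℕ) : ℝ) ^ (1 - p) / (p - 1) := by
    intro l hl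
    have hl0 : (0 : ℝ) < l := by exact_mod_cast (by omega : 0 < l)
    have h1 := le_sub_of_hasDerivAt (Φ := fun x => -(x ^ (1 - p) / (p - 1)))
      (φ := fun x => x ^ (-p)) (a := (l : ℝ)) (c := ((l : ℝ) + 1) ^ (-p))
      (fun x hx => by
        have hx0 : 0 < x := hl0.trans_le hx.1
        have h2 := ((Real.hasDerivAt_rpow_const (p := 1 - p) (Or.inl hx0.ne')).div_const
          (p - 1)).neg
        refine h2.congr_deriv ?_
        have hp1 : p - 1 ≠ 0 := by linarith
        rw [show 1 - p - 1 = -p by ring]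
        field_simp
        ring)
      (fun x hx => Real.rpow_le_rpow_of_nonpos (hl0.trans_le hx.1) hx.2 (by linarith))
    push_cast
    linarith
  have hsum := sum_le_of_le_sub (w := fun t => ((t : ℕ) : ℝ) ^ (-p))
    (Φ := fun l => (l : ℝ) ^ (1 - p) / (p - 1))
    (fun l => div_nonneg (Real.rpow_nonneg (Nat.cast_nonneg l) _) (by linarith)) hstep T
  calc b / (k : ℝ) * ∑ r ∈ Finset.range T, 1 / ((k + 1 + r : ℕ) : ℝ) ^ (2 * ε) *
      (∏ l ∈ Finset.Ico (k + 1) (k + 1 + r), (1 - lam * (b / (l : ℝ)))) ^ 2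
      ≤ b / (k : ℝ) * ∑ r ∈ Finset.range T, ((k : ℝ) + 1) ^ (2 * c) *
          ((k + 1 + r : ℕ) : ℝ) ^ (-p) := by
        refine mul_le_mul_of_nonneg_left (Finset.sum_le_sum fun r _ => ?_) (by positivity)
        have ht : (0 : ℝ) < ((k + 1 + r : ℕ) : ℝ) := by exact_mod_cast (by omega : 0 < k + 1 + r)
        refine (mul_le_mul_of_nonneg_left (hprod r) (by positivity)).trans (le_of_eq ?_)
        rw [one_div, ← Real.rpow_neg ht.le, mul_left_comm, ← Real.rpow_add ht, hpc]
        congr 2; ring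
    _ = b / (k : ℝ) * (((k : ℝ) + 1) ^ (2 * c) *
          ∑ r ∈ Finset.range T, ((k + 1 + r : ℕ) : ℝ) ^ (-p)) := by rw [← Finset.mul_sum]
    _ ≤ b / (k : ℝ) * (((k : ℝ) + 1) ^ (2 * c) * ((k : ℝ) ^ (1 - p) / (p - 1))) := by gcongr
    _ = b / (p - 1) * ((k : ℝ) + 1) ^ (2 * c) * (k : ℝ) ^ (-p) := by
        rw [show 1 - p = -p + 1 by ring, Real.rpow_add_one hkpos.ne']
        field_simp
    -- The bound with `k` is weakened to the form of `rateConst`, which has `k - 1`; here `k ≥ 2` is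
    -- essential.
    _ ≤ b / (p - 1) * ((k : ℝ) + 1) ^ (2 * c) * ((k : ℝ) - 1) ^ (-p) := by
        have : 0 < p - 1 := by linarith
        have h3 := Real.rpow_le_rpow_of_nonpos hk2 (by linarith : (k : ℝ) - 1 ≤ k)
          (by linarith : -p ≤ 0)
        gcongr
    _ = rateConst lam b 1 ε k / (k : ℝ) ^ (2 * ε) := by
        rw [rateConst, if_pos rfl, ← hp, Real.rpow_neg hk2.le]
        have h4 : (k : ℝ) ^ (2 * ε) ≠ 0 := (Real.rpow_pos_of_pos hkpos _).ne'
        rw [show 2 * lam * b = 2 * c by rw [hc]; ring]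
        field_simp

/-- If the maximum is `δ - 2ε`, the worst case is `x = 1`, where the value exceeds `1 - δ > 0`. -/
lemma rateConst_denom_pos (hδ : δ < 1) (hlb : 0 < lam * b) (h : 1 < 2 * lam * b + 2 * ε) {x : ℝ}
    (hx1 : x ≤ 1) : 0 < 2 * lam * b - max (δ - 2 * ε) 0 * x := by
  rcases max_cases (δ - 2 * ε) 0 with ⟨h1, h2⟩ | ⟨h1, h2⟩ <;> rw [h1]
  · nlinarith
  · nlinarith

lemma sum_le_rateConst_of_lt_one {k : ℕ} (hk : 1 ≤ k) (hlam : 0 < lam) (hb : 0 < b)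
    (hε : 0 ≤ ε) (hδ : δ < 1) (hδ0 : 0 < δ) (h : 1 < 2 * lam * b + 2 * ε)
    (hfac : ∀ l : ℕ, k < l → 0 ≤ 1 - lam * (b / (l : ℝ) ^ δ)) (T : ℕ) :
    b / (k : ℝ) ^ δ * ∑ r ∈ Finset.range T, 1 / ((k + 1 + r : ℕ) : ℝ) ^ (2 * ε) *
      (∏ l ∈ Finset.Ico (k + 1) (k + 1 + r), (1 - lam * (b / (l : ℝ) ^ δ))) ^ 2 ≤
    rateConst lam b δ ε k / (k : ℝ) ^ (2 * ε) := by
  set c := lam * b with hc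
  have hc0 : 0 < c := mul_pos hlam hb
  have hδ1 : 0 < 1 - δ := by linarith
  have hkpos : (0 : ℝ) < k := by exact_mod_cast (by omega : 0 < k)
  set A := 2 * c / (1 - δ) with hA
  have hA0 : 0 < A := by positivity
  set D := 2 * lam * b - max (δ - 2 * ε) 0 * (k : ℝ) ^ (δ - 1) with hD
  have hDpos : 0 < D := rateConst_denom_pos hδ hc0 h
    (Real.rpow_le_one_of_one_le_of_nonpos (by exact_mod_cast hk) (by linarith))
  set g : ℝ → ℝ := fun x => Real.exp (-(A * x ^ (1 - δ))) with hg
  have hprod : ∀ r : ℕ, (∏ l ∈ Finset.Ico (k + 1) (k + 1 + r),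
      (1 - lam * (b / (l : ℝ) ^ δ))) ^ 2 ≤
      Real.exp (A * ((k : ℝ) + 1) ^ (1 - δ)) * g ((k + 1 + r : ℕ) : ℝ) := by
    intro r
    have h1 := prod_le_exp_sub (c := fun l => lam * (b / (l : ℝ) ^ δ))
      (G := fun l => c / (1 - δ) * (l : ℝ) ^ (1 - δ)) hfac (fun l hl => by
        have hl0 : (0 : ℝ) < l := by exact_mod_cast (by omega : 0 < l)
        have h2 := le_sub_of_hasDerivAt (Φ := fun x => -(c / (1 - δ) * x ^ (1 - δ)))
          (φ := fun x => -(c * x ^ (-δ))) (a := (l : ℝ)) (c := -(c * (l : ℝ) ^ (-δ)))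
          (fun x hx => by
            have hx0 : 0 < x := hl0.trans_le hx.1
            have h2 := ((Real.hasDerivAt_rpow_const (p := 1 - δ) (Or.inl hx0.ne')).const_mul
              (c / (1 - δ))).neg
            refine h2.congr_deriv ?_
            rw [show 1 - δ - 1 = -δ by ring]
            field_simp)
          (fun x hx => by
            have := Real.rpow_le_rpow_of_nonpos hl0 hx.1 (by linarith : -δ ≤ 0)
            have := mul_le_mul_of_nonneg_left this hc0.le
            linarith)
        have h3 : c * (l : ℝ) ^ (-δ) = lam * (b / (l : ℝ) ^ δ) := by
          rw [Real.rpow_neg hl0.le, hc]; ring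
        push_cast
        linarith) r
    have h0 : 0 ≤ ∏ l ∈ Finset.Ico (k + 1) (k + 1 + r), (1 - lam * (b / (l : ℝ) ^ δ)) :=
      Finset.prod_nonneg fun l hl => hfac l (by have := Finset.mem_Ico.1 hl; omega)
    refine (pow_le_pow_left₀ h0 h1 2).trans (le_of_eq ?_)
    simp only [hg]
    rw [← Real.exp_nat_mul, ← Real.exp_add]
    congr 1
    push_cast
    rw [hA]
    ring
  -- To leading order this is the tail integral of `x ^ (-2ε) * g x`. Its negative derivative equals
  -- that integrand times `(2c - (δ - 2ε) x ^ (δ - 1)) / D`; `D` is chosen so that this factor is at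
  -- least `1` for `x ≥ k`.
  set Φ : ℝ → ℝ := fun x => x ^ (δ - 2 * ε) * g x / D with hΦ
  have hΦ0 : ∀ x : ℝ, 0 ≤ x → 0 ≤ Φ x := fun x hx => by
    simp only [hΦ, hg]; positivity
  have hstep : ∀ l : ℕ, k ≤ l → ((l + 1 : ℕ) : ℝ) ^ (-(2 * ε)) * g ((l + 1 : ℕ) : ℝ) ≤
      Φ (l : ℝ) - Φ ((l + 1 : ℕ) : ℝ) := by
    intro l hl
    have hl0 : (0 : ℝ) < l := by exact_mod_cast (by omega : 0 < l)
    have hkl : (k : ℝ) ≤ l := by exact_mod_cast hl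
    have h1 := le_sub_of_hasDerivAt (Φ := fun x => -Φ x)
      (φ := fun x => x ^ (-(2 * ε)) * g x * ((2 * c - (δ - 2 * ε) * x ^ (δ - 1)) / D))
      (a := (l : ℝ)) (c := ((l : ℝ) + 1) ^ (-(2 * ε)) * g ((l : ℝ) + 1))
      (fun x hx => by
        have hx0 : 0 < x := hl0.trans_le hx.1
        have d1 := Real.hasDerivAt_rpow_const (p := δ - 2 * ε) (Or.inl hx0.ne')
        have d2 := (((Real.hasDerivAt_rpow_const (p := 1 - δ) (Or.inl hx0.ne')).const_mul
          A).neg).exp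
        refine (((d1.mul d2).div_const D).neg).congr_deriv ?_
        have e1 : x ^ (δ - 2 * ε - 1) = x ^ (-(2 * ε)) * x ^ (δ - 1) := by
          rw [← Real.rpow_add hx0]; congr 1; ring
        have e2 : x ^ (δ - 2 * ε) * x ^ (1 - δ - 1) = x ^ (-(2 * ε)) := by
          rw [← Real.rpow_add hx0]; congr 1; ring
        have e3 : A * (1 - δ) = 2 * c := by rw [hA]; field_simp
        simp only [hg, Pi.neg_apply]
        rw [e1]
        have : x ^ (δ - 2 * ε) * (Real.exp (-(A * x ^ (1 - δ))) *
            -(A * ((1 - δ) * x ^ (1 - δ - 1)))) =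
            -(2 * c) * x ^ (-(2 * ε)) * Real.exp (-(A * x ^ (1 - δ))) := by
          rw [← e2, ← e3]; ring
        rw [this]
        ring)
      (fun x hx => by
        have hx0 : 0 < x := hl0.trans_le hx.1
        have b1 : ((l : ℝ) + 1) ^ (-(2 * ε)) ≤ x ^ (-(2 * ε)) :=
          Real.rpow_le_rpow_of_nonpos hx0 hx.2 (by linarith)
        have b2 : g ((l : ℝ) + 1) ≤ g x := by
          simp only [hg]
          have := Real.rpow_le_rpow hx0.le hx.2 hδ1.le
          have := mul_le_mul_of_nonneg_left this hA0.le
          exact Real.exp_le_exp.2 (by linarith)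
        have b3 : 1 ≤ (2 * c - (δ - 2 * ε) * x ^ (δ - 1)) / D := by
          rw [one_le_div hDpos, hD]
          have hxk : x ^ (δ - 1) ≤ (k : ℝ) ^ (δ - 1) :=
            Real.rpow_le_rpow_of_nonpos hkpos (hkl.trans hx.1) (by linarith)
          have hx1 : 0 ≤ x ^ (δ - 1) := Real.rpow_nonneg hx0.le _
          have : (δ - 2 * ε) * x ^ (δ - 1) ≤ max (δ - 2 * ε) 0 * (k : ℝ) ^ (δ - 1) :=
            (mul_le_mul_of_nonneg_right (le_max_left _ _) hx1).trans
              (mul_le_mul_of_nonneg_left hxk (le_max_right _ _))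
          have e : 2 * c = 2 * lam * b := by rw [hc]; ring
          linarith
        have g0 : 0 ≤ g ((l : ℝ) + 1) := Real.exp_nonneg _
        have p0 : 0 ≤ x ^ (-(2 * ε)) := Real.rpow_nonneg hx0.le _
        have b4 := mul_le_mul b1 b2 g0 p0
        exact b4.trans (le_mul_of_one_le_right (mul_nonneg p0 (Real.exp_nonneg _)) b3))
    push_cast
    linarith
  have hsum := sum_le_of_le_sub (w := fun t => ((t : ℕ) : ℝ) ^ (-(2 * ε)) * g ((t : ℕ) : ℝ))
    (Φ := fun l => Φ (l : ℝ)) (fun l => hΦ0 _ (Nat.cast_nonneg l)) hstep T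
  set E := Real.exp (A * ((k : ℝ) + 1) ^ (1 - δ)) with hE
  calc b / (k : ℝ) ^ δ * ∑ r ∈ Finset.range T, 1 / ((k + 1 + r : ℕ) : ℝ) ^ (2 * ε) *
      (∏ l ∈ Finset.Ico (k + 1) (k + 1 + r), (1 - lam * (b / (l : ℝ) ^ δ))) ^ 2
      ≤ b / (k : ℝ) ^ δ * ∑ r ∈ Finset.range T, E *
          (((k + 1 + r : ℕ) : ℝ) ^ (-(2 * ε)) * g ((k + 1 + r : ℕ) : ℝ)) := by
        refine mul_le_mul_of_nonneg_left (Finset.sum_le_sum fun r _ => ?_) (by positivity)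
        refine (mul_le_mul_of_nonneg_left (hprod r) (by positivity)).trans (le_of_eq ?_)
        rw [one_div, ← Real.rpow_neg (Nat.cast_nonneg _)]
        ring
    _ = b / (k : ℝ) ^ δ * (E * ∑ r ∈ Finset.range T,
          (((k + 1 + r : ℕ) : ℝ) ^ (-(2 * ε)) * g ((k + 1 + r : ℕ) : ℝ))) := by
        rw [← Finset.mul_sum]
    _ ≤ b / (k : ℝ) ^ δ * (E * Φ (k : ℝ)) := by gcongr
    _ = rateConst lam b δ ε k / (k : ℝ) ^ (2 * ε) := by
        rw [rateConst, if_neg hδ.ne, ← hD]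
        have e1 : Real.exp (2 * lam * b / (1 - δ) *
            (((k : ℝ) + 1) ^ (1 - δ) - (k : ℝ) ^ (1 - δ))) = E * g k := by
          simp only [hE, hg]
          rw [← Real.exp_add, hA, hc]
          congr 1; ring
        rw [e1]
        simp only [hΦ]
        rw [Real.rpow_sub hkpos]
        have h4 : (k : ℝ) ^ (2 * ε) ≠ 0 := (Real.rpow_pos_of_pos hkpos _).ne'
        have h5 : (k : ℝ) ^ δ ≠ 0 := (Real.rpow_pos_of_pos hkpos _).ne'
        field_simp

lemma sum_le_rateConst {k : ℕ} (hk : 1 ≤ k) (hk2 : δ < 1 ∨ 2 ≤ k) (hlam : 0 < lam) (hb : 0 < b)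
    (hε : 0 ≤ ε) (hδ : δ ≤ 1) (hδ0 : 0 < δ) (h : 1 < 2 * lam * b + 2 * ε)
    (hfac : ∀ l : ℕ, k < l → 0 ≤ 1 - lam * (b / (l : ℝ) ^ δ)) (T : ℕ) :
    b / (k : ℝ) ^ δ * ∑ r ∈ Finset.range T, 1 / ((k + 1 + r : ℕ) : ℝ) ^ (2 * ε) *
      (∏ l ∈ Finset.Ico (k + 1) (k + 1 + r), (1 - lam * (b / (l : ℝ) ^ δ))) ^ 2 ≤
    rateConst lam b δ ε k / (k : ℝ) ^ (2 * ε) := by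
  rcases hδ.lt_or_eq with h1 | rfl
  · exact sum_le_rateConst_of_lt_one hk hlam hb hε h1 hδ0 h hfac T
  · simp only [Real.rpow_one] at hfac ⊢
    exact sum_le_rateConst_of_eq_one (hk2.resolve_left (lt_irrefl _)) hlam hb hε h hfac T

/-- For `δ < 1` the power `x ^ (1 - δ)` is subadditive, so the exponent stays bounded. For `δ = 1`
and `k ≥ 2` one has `k + 1 ≤ 3 (k - 1)` and `k ≤ 2 (k - 1)`. -/
lemma exists_abs_rateConst_le (hlam : 0 < lam) (hb : 0 < b) (hε : 0 ≤ ε) (hδ : δ ≤ 1)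
    (hδ0 : 0 < δ) (h : 1 < 2 * lam * b + 2 * ε) :
    ∃ K, ∀ k : ℕ, 2 ≤ k → |rateConst lam b δ ε k| ≤ K := by
  have hlb : 0 < lam * b := mul_pos hlam hb
  rcases hδ.lt_or_eq with h1 | rfl
  · have hD1 := rateConst_denom_pos h1 hlb h le_rfl
    refine ⟨b / (2 * lam * b - max (δ - 2 * ε) 0 * 1) * Real.exp (2 * lam * b / (1 - δ) * 1),
      fun k hk => ?_⟩
    have hkpos : (0 : ℝ) < k := by exact_mod_cast (by omega : 0 < k)
    have hx1 : (k : ℝ) ^ (δ - 1) ≤ 1 := Real.rpow_le_one_of_one_le_of_nonpos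
      (by exact_mod_cast (by omega : 1 ≤ k)) (by linarith)
    have hD := rateConst_denom_pos h1 hlb h hx1
    have hδ1 : 0 < 1 - δ := by linarith
    have hinc : ((k : ℝ) + 1) ^ (1 - δ) - (k : ℝ) ^ (1 - δ) ≤ 1 := by
      have := Real.rpow_add_le_add_rpow hkpos.le zero_le_one hδ1.le (by linarith : 1 - δ ≤ 1)
      rw [Real.one_rpow] at this
      linarith
    rw [rateConst, if_neg h1.ne, abs_of_nonneg (by positivity)]
    gcongr
  · have hp : 0 < 2 * lam * b + 2 * ε - 1 := by linarith
    refine ⟨b / (2 * lam * b + 2 * ε - 1) * (3 ^ (2 * lam * b) * 2 ^ (2 * ε)), fun k hk => ?_⟩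
    have hk' : (2 : ℝ) ≤ k := by exact_mod_cast hk
    have hk1 : (0 : ℝ) < (k : ℝ) - 1 := by linarith
    have hk0 : (0 : ℝ) < k := by linarith
    have hlb2 : 0 < 2 * lam * b := by linarith
    rw [rateConst, if_pos rfl, abs_of_nonneg (by positivity)]
    refine mul_le_mul_of_nonneg_left ?_ (by positivity)
    rw [div_le_iff₀ (by positivity), Real.rpow_add hk1]
    have e1 : ((k : ℝ) + 1) ^ (2 * lam * b) ≤
        3 ^ (2 * lam * b) * ((k : ℝ) - 1) ^ (2 * lam * b) := by
      rw [← Real.mul_rpow (by norm_num) hk1.le]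
      exact Real.rpow_le_rpow (by linarith) (by linarith) hlb2.le
    have e2 : (k : ℝ) ^ (2 * ε) ≤ 2 ^ (2 * ε) * ((k : ℝ) - 1) ^ (2 * ε) := by
      rw [← Real.mul_rpow (by norm_num) hk1.le]
      exact Real.rpow_le_rpow (by linarith) (by linarith) (by linarith)
    calc _ ≤ (3 ^ (2 * lam * b) * ((k : ℝ) - 1) ^ (2 * lam * b)) *
          (2 ^ (2 * ε) * ((k : ℝ) - 1) ^ (2 * ε)) :=
        mul_le_mul e1 e2 (by positivity) (by positivity)
      _ = _ := by ring

end Rates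

/-! ### Stationarity of the switching chain -/

section Stationarity

variable {N n M : ℕ} [NeZero n] {m : Fin N → ℕ} {Ω : Type*} [MeasurableSpace Ω]
  {S : Model N n M m} {X : Env N n M m Ω} {μ : Measure Ω} {p : Fin M → Fin M → ℝ} {π : Fin M → ℝ}

lemma sum_measureReal_inter_preimage_singleton [IsFiniteMeasure μ] {β : Type*} [Fintype β]
    [MeasurableSpace β] [MeasurableSingletonClass β] {Y : Ω → β} (hY : Measurable Y) (A : Set Ω) :
    ∑ b, μ.real (A ∩ Y ⁻¹' {b}) = μ.real A := by
  have h := sum_measureReal_preimage_singleton (μ := μ.restrict A) Finset.univ (f := Y)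
    (fun b _ => hY (measurableSet_singleton b))
  simp only [Finset.coe_univ, Set.preimage_univ] at h
  rw [measureReal_restrict_apply MeasurableSet.univ, Set.univ_inter] at h
  rw [← h]
  refine Finset.sum_congr rfl fun b _ => ?_
  rw [measureReal_restrict_apply (hY (measurableSet_singleton b)), Set.inter_comm]

/-- The law of the chain evolves by the transition matrix. -/
lemma Env.IsMarkov.measureReal_succ [IsFiniteMeasure μ] (h : X.IsMarkov μ p π) (k : ℕ)
    (v : Fin M) :
    μ.real {ω | X.chain (k + 1 + 1) ω = v} =
      ∑ u, μ.real {ω | X.chain (k + 1) ω = u} * p u v := by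
  set Y : Ω → Fin (k + 1) → Fin M := fun ω l => X.chain (l + 1) ω with hYdef
  have hY : Measurable Y := measurable_pi_lambda _ fun l => X.chain_meas _
  -- The Markov property is stated for full state sequences: a finite history is continued by `v`,
  -- with the shift `l - 1` because times start at `1`.
  set ext : (Fin (k + 1) → Fin M) → ℕ → Fin M :=
    fun u l => if h : l - 1 < k + 1 then u ⟨l - 1, h⟩ else v with hext
  have hext1 : ∀ u (l : Fin (k + 1)), ext u (l + 1) = u l := fun u l => by
    simp [hext, Nat.lt_succ_iff.1 l.isLt]
  have hext2 : ∀ u, ext u (k + 1 + 1) = v := fun u => by simp [hext]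
  have hpre : ∀ u, {ω | ∀ l ∈ Finset.Icc 1 (k + 1), X.chain l ω = ext u l} = Y ⁻¹' {u} := by
    intro u
    ext ω
    simp only [Set.mem_ofPred_eq, Set.mem_preimage, Set.mem_singleton_iff, hYdef, funext_iff,
      Finset.mem_Icc]
    constructor
    · intro H l
      rw [H _ ⟨by omega, by omega⟩, hext1]
    · rintro H l ⟨h1, h2⟩
      obtain ⟨l, rfl⟩ : ∃ l', l = l' + 1 := ⟨l - 1, by omega⟩
      have := H ⟨l, by omega⟩
      rw [show l = ((⟨l, by omega⟩ : Fin (k + 1)) : ℕ) from rfl, hext1]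
      exact this
  have hsucc : ∀ u, {ω | ∀ l ∈ Finset.Icc 1 (k + 1 + 1), X.chain l ω = ext u l} =
      {ω | X.chain (k + 1 + 1) ω = v} ∩ Y ⁻¹' {u} := by
    intro u
    rw [← hpre]
    ext ω
    simp only [Set.mem_ofPred_eq, Set.mem_inter_iff, Finset.mem_Icc]
    constructor
    · intro H
      exact ⟨(H _ ⟨by omega, le_rfl⟩).trans (hext2 u), fun l hl => H l ⟨hl.1, by omega⟩⟩
    · rintro ⟨H1, H2⟩ l hl
      rcases eq_or_lt_of_le hl.2 with rfl | h'
      · exact H1.trans (hext2 u).symm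
      · exact H2 l ⟨hl.1, by omega⟩
  have hstep : ∀ u, μ.real ({ω | X.chain (k + 1 + 1) ω = v} ∩ Y ⁻¹' {u}) =
      μ.real (Y ⁻¹' {u}) * p (u (Fin.last k)) v := by
    intro u
    have := h.markov (k + 1) (by omega) (ext u)
    rw [hsucc, hpre, hext2] at this
    rw [this, ← hext1 u (Fin.last k), Fin.val_last]
  have hlaw : ∀ w, μ.real {ω | X.chain (k + 1) ω = w} =
      ∑ u : Fin (k + 1) → Fin M, if u (Fin.last k) = w then μ.real (Y ⁻¹' {u}) else 0 := by
    intro w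
    rw [← sum_measureReal_inter_preimage_singleton hY]
    refine Finset.sum_congr rfl fun u _ => ?_
    split_ifs with hu
    · congr 1
      refine Set.inter_eq_right.2 fun ω hω => ?_
      rw [Set.mem_preimage, Set.mem_singleton_iff] at hω
      rw [Set.mem_ofPred_eq, ← hu, ← hω]
      rfl
    · rw [show {ω | X.chain (k + 1) ω = w} ∩ Y ⁻¹' {u} = ∅ from ?_, measureReal_empty]
      refine Set.eq_empty_of_forall_notMem fun ω hω => hu ?_
      have h2 : Y ω = u := hω.2
      rw [← h2]
      exact hω.1
  rw [← sum_measureReal_inter_preimage_singleton hY]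
  simp only [hstep, hlaw, Finset.sum_mul]
  rw [Finset.sum_comm]
  refine Finset.sum_congr rfl fun u _ => ?_
  simp [ite_mul]

/-- As the limit of the laws, `π` satisfies the one-step recursion and is therefore invariant; a
chain started from it keeps this law. -/
lemma Env.IsMarkov.measureReal_eq [IsFiniteMeasure μ] (h : X.IsMarkov μ p π)
    (h1 : ∀ u, μ.real {ω | X.chain 1 ω = u} = π u) (k : ℕ) (v : Fin M) :
    μ.real {ω | X.chain (k + 1) ω = v} = π v := by
  have hπ : ∀ v, π v = ∑ u, π u * p u v := fun v => by
    have l1 := (h.limit v).comp (tendsto_add_atTop_nat 2)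
    have l2 : Tendsto (fun k => ∑ u, μ.real {ω | X.chain (k + 1) ω = u} * p u v) atTop
        (𝓝 (∑ u, π u * p u v)) :=
      tendsto_finsetSum _ fun u _ =>
        ((h.limit u).comp (tendsto_add_atTop_nat 1)).mul_const _
    exact tendsto_nhds_unique (l1.congr fun k => h.measureReal_succ k v) l2
  induction k generalizing v with
  | zero => exact h1 v
  | succ k ih => rw [h.measureReal_succ, hπ v]; simp only [ih]

lemma Env.q_eq_sum [IsFiniteMeasure μ] (h : X.IsMarkov μ p π)
    (h1 : ∀ u, μ.real {ω | X.chain 1 ω = u} = π u) (i j : Fin N) (k : ℕ) :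
    X.q S μ i j (k + 1) = ∑ u ∈ S.graphsWith i j, π u := by
  have := sum_measureReal_preimage_singleton (μ := μ) (S.graphsWith i j) (f := X.chain (k + 1))
    (fun b _ => X.chain_meas _ (measurableSet_singleton b))
  simp only [← h.measureReal_eq h1 k]
  refine Eq.trans ?_ this.symm
  unfold Env.q
  congr 1
  ext ω
  simp [Env.graph, Model.graphsWith]

end Stationarity

/-! ### The rate bound -/

section RateBound

variable {N n M : ℕ} [NeZero n] {m : Fin N → ℕ} {Ω : Type*} [MeasurableSpace Ω]

/-- Polynomially decreasing step-sizes and sensitivities of the privacy noises. -/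
structure Env.PolynomialRates (S : Model N n M m) (X : Env N n M m Ω) (μ : Measure Ω)
    (b δ : Fin N → ℝ) (ε : Fin N → Fin N → ℝ) (k₀ : Fin N → ℕ) : Prop where
  noise : ∀ i j, S.Edge i j → 0 < X.eta μ i j 1 ∧ 0 ≤ ε i j ∧
    ∀ k : ℕ, 1 ≤ k → X.eta μ i j k ≤ X.eta μ i j 1 / (k : ℝ) ^ (2 * ε i j)
  step : ∀ i, 1 / 2 < δ i ∧ δ i ≤ 1 ∧ 0 < b i ∧ b i < (k₀ i : ℝ) ^ δ i ∧
    (∀ k : ℕ, 1 ≤ k → S.β i k = if k₀ i ≤ k then b i / (k : ℝ) ^ δ i else 0)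
  gap : ∀ i j, S.Edge i j → S.Q i ≠ 0 → 1 < 2 * lamMinPos (S.Q i) * b i + 2 * ε i j

variable {S : Model N n M m} {X : Env N n M m Ω} {μ : Measure Ω} {p : Fin M → Fin M → ℝ}
  {π : Fin M → ℝ} {b δ : Fin N → ℝ} {ε : Fin N → Fin N → ℝ} {k₀ : Fin N → ℕ}

lemma Model.mem_nbr {i j : Fin N} : j ∈ S.nbr i ↔ S.Edge i j := by simp [Model.nbr]

lemma Model.gram_ne_zero {i : Fin N} (h : S.Hbar i ≠ 0) : S.Q i ≠ 0 := fun h' =>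
  h (gram_eq_zero h')

lemma Env.PolynomialRates.delta_pos (h : X.PolynomialRates S μ b δ ε k₀) (i : Fin N) : 0 < δ i :=
  lt_trans (by norm_num) (h.step i).1

lemma Env.PolynomialRates.sum_coef_le [IsProbabilityMeasure μ] (hM : X.IsMarkov μ p π)
    (h1 : ∀ u, μ.real {ω | X.chain 1 ω = u} = π u)
    (hβ : ∀ i k, 1 ≤ k → S.β i k * lamMax (S.Q i) < 1)
    (h : X.PolynomialRates S μ b δ ε k₀) {i j : Fin N} (hH : S.Hbar i ≠ 0) (hj : S.Edge i j)
    {k : ℕ} (hk : 1 ≤ k) (hk2 : δ i < 1 ∨ 2 ≤ k) (T : ℕ) :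
    ∑ t ∈ Finset.range T, X.coef S μ i j k (k + 1 + t) ≤
      ∑ u ∈ S.graphsWith i j, π u * rateConst (lamMinPos (S.Q i)) (b i) (δ i) (ε i j) k *
        S.β i k * (X.eta μ i j 1 / (k : ℝ) ^ (2 * ε i j)) := by
  obtain ⟨-, hδ1, hb, -, hβeq⟩ := h.step i
  obtain ⟨hη1, hε, hη⟩ := h.noise i j hj
  set q := ∑ u ∈ S.graphsWith i j, π u with hq
  have hqt : ∀ t, 1 ≤ t → X.q S μ i j t = q := fun t ht => by
    obtain ⟨t, rfl⟩ : ∃ t', t = t' + 1 := ⟨t - 1, by omega⟩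
    exact Env.q_eq_sum hM h1 i j t
  have hq0 : 0 ≤ q := by rw [← hqt 1 le_rfl]; exact measureReal_nonneg
  simp only [mul_assoc]
  rw [← Finset.sum_mul, ← hq]
  -- Before `k₀` the step-size is zero and both sides vanish; from `k₀` on all step-sizes in the
  -- product have the polynomial form.
  rcases lt_or_ge k (k₀ i) with hlt | hge
  · have h0 : S.β i k = 0 := by rw [hβeq k hk, if_neg (by omega)]
    simp [Env.coef, h0]
  have hβl : ∀ l, k ≤ l → S.β i l = b i / (l : ℝ) ^ δ i := fun l hl => by
    rw [hβeq l (by omega), if_pos (by omega)]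
  have hlam : 0 < lamMinPos (S.Q i) := lamMinPos_pos (Model.gram_ne_zero hH)
  have hrate := sum_le_rateConst hk hk2 hlam hb hε hδ1 (h.delta_pos i)
    (h.gap i j hj (Model.gram_ne_zero hH)) (fun l hl => by
      have := lamMinPos_mul_lt_one (S.Hbar i) (S.β_nonneg i l (by omega)) (hβ i l (by omega))
      rw [hβl l hl.le] at this
      simp only [Model.Q]
      linarith) T
  have hβk := S.β_nonneg i k hk
  calc ∑ t ∈ Finset.range T, X.coef S μ i j k (k + 1 + t)
      ≤ ∑ t ∈ Finset.range T, q * S.β i k * X.eta μ i j 1 * (S.β i k *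
          (1 / ((k + 1 + t : ℕ) : ℝ) ^ (2 * ε i j) * (∏ l ∈ Finset.Ico (k + 1) (k + 1 + t),
            (1 - lamMinPos (S.Q i) * (b i / (l : ℝ) ^ δ i))) ^ 2)) := by
        refine Finset.sum_le_sum fun t _ => ?_
        have hprod : ∏ l ∈ Finset.Ico (k + 1) (k + 1 + t),
            (1 - lamMinPos (S.Q i) * (b i / (l : ℝ) ^ δ i)) =
            ∏ l ∈ Finset.Ico (k + 1) (k + 1 + t), (1 - lamMinPos (S.Q i) * S.β i l) :=
          Finset.prod_congr rfl fun l hl => by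
            rw [hβl l (by have := Finset.mem_Ico.1 hl; omega)]
        rw [hprod, Env.coef, hqt _ (by omega)]
        calc _ ≤ S.β i k ^ 2 * q * (X.eta μ i j 1 / ((k + 1 + t : ℕ) : ℝ) ^ (2 * ε i j)) *
              (∏ l ∈ Finset.Ico (k + 1) (k + 1 + t),
                (1 - lamMinPos (S.Q i) * S.β i l)) ^ 2 := by
              have := hη (k + 1 + t) (by omega)
              gcongr
          _ = _ := by ring
    _ = q * S.β i k * X.eta μ i j 1 * (b i / (k : ℝ) ^ δ i * ∑ t ∈ Finset.range T,
          1 / ((k + 1 + t : ℕ) : ℝ) ^ (2 * ε i j) * (∏ l ∈ Finset.Ico (k + 1) (k + 1 + t),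
            (1 - lamMinPos (S.Q i) * (b i / (l : ℝ) ^ δ i))) ^ 2) := by
        rw [← Finset.mul_sum, ← Finset.mul_sum, hβl k le_rfl]
    _ ≤ q * S.β i k * X.eta μ i j 1 *
          (rateConst (lamMinPos (S.Q i)) (b i) (δ i) (ε i j) k / (k : ℝ) ^ (2 * ε i j)) := by
        gcongr
    _ = _ := by ring

lemma Env.rateBound_eq_smul (i : Fin N) (k : ℕ) :
    X.rateBound S μ π b δ ε i k = (∑ j ∈ S.nbr i, ∑ u ∈ S.graphsWith i j,
      π u * rateConst (lamMinPos (S.Q i)) (b i) (δ i) (ε i j) k * S.β i k *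
      (X.eta μ i j 1 / (k : ℝ) ^ (2 * ε i j))) • (S.Hbar i * (S.Hbar i)ᵀ) := by
  simp only [Env.rateBound, Finset.sum_smul]

lemma Env.PolynomialRates.posSemidef_rateBound_sub [IsProbabilityMeasure μ]
    (hM : X.IsMarkov μ p π) (h1 : ∀ u, μ.real {ω | X.chain 1 ω = u} = π u)
    (hPriv : X.PrivacyNoiseAssumption S μ)
    (hβ : ∀ i k, 1 ≤ k → S.β i k * lamMax (S.Q i) < 1)
    (hsq : ∀ i, Summable fun k : ℕ => S.β i (k + 1) ^ 2)
    (h_ii : ∀ i j, S.Edge i j → S.Q i ≠ 0 →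
      Summable fun t : ℕ => X.eta μ i j (t + 1) *
        ∏ l ∈ Finset.Icc 1 (t + 1), (1 - lamMinPos (S.Q i) * S.β i l) ^ 2)
    (h : X.PolynomialRates S μ b δ ε k₀) {i : Fin N} {k : ℕ}
    (hk : δ i < 1 ∨ 2 ≤ k + 1) (hdef : X.FisherDefined S μ i (k + 1)) :
    (X.rateBound S μ π b δ ε i (k + 1) - X.meanFisher S μ i (k + 1)).PosSemidef := by
  rw [Env.rateBound_eq_smul]
  refine Env.posSemidef_sub_meanFisher_of_tendsto hPriv hβ hdef
    (Env.tendsto_meanFisher hPriv hβ hsq h_ii hdef) ?_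
  by_cases hH : S.Hbar i = 0
  · exact Or.inl hH
  · exact Or.inr fun T => Finset.sum_le_sum fun j hj =>
      h.sum_coef_le hM h1 hβ hH (Model.mem_nbr.1 hj) (by omega) hk T

lemma Env.PolynomialRates.isBigO_rateBound (h : X.PolynomialRates S μ b δ ε k₀) (i : Fin N)
    (r c : Fin (m i)) :
    (fun k => X.rateBound S μ π b δ ε i k r c) =O[atTop]
      fun k : ℕ => ∑ j ∈ S.nbr i, 1 / (k : ℝ) ^ (δ i + 2 * ε i j) := by
  by_cases hH : S.Hbar i = 0
  · have : (fun k => X.rateBound S μ π b δ ε i k r c) = fun _ => 0 := by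
      funext k; simp [Env.rateBound_eq_smul, hH]
    rw [this]
    exact isBigO_zero _ _
  obtain ⟨-, hδ1, hb, -, hβeq⟩ := h.step i
  simp only [Env.rateBound, Matrix.sum_apply, Matrix.smul_apply, smul_eq_mul]
  refine IsBigO.fun_sum fun j hj => IsBigO.fun_sum fun u _ => ?_
  have hE := Model.mem_nbr.1 hj
  have hR : (fun k => rateConst (lamMinPos (S.Q i)) (b i) (δ i) (ε i j) k) =O[atTop]
      fun _ : ℕ => (1 : ℝ) := by
    obtain ⟨K, hK⟩ := exists_abs_rateConst_le (lamMinPos_pos (Model.gram_ne_zero hH)) hb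
      (h.noise i j hE).2.1 hδ1 (h.delta_pos i) (h.gap i j hE (Model.gram_ne_zero hH))
    refine IsBigO.of_bound K ?_
    filter_upwards [eventually_ge_atTop 2] with k hk
    rw [norm_one, mul_one]
    exact hK k hk
  have hB : (fun k => S.β i k) =O[atTop] fun k : ℕ => 1 / (k : ℝ) ^ δ i := by
    refine IsBigO.of_bound (b i) ?_
    filter_upwards [eventually_ge_atTop (max 1 (k₀ i))] with k hk
    rw [hβeq k (le_of_max_le_left hk), if_pos (le_of_max_le_right hk), Real.norm_of_nonneg
      (by positivity), Real.norm_of_nonneg (by positivity), mul_one_div]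
  have hη : (fun k : ℕ => X.eta μ i j 1 / (k : ℝ) ^ (2 * ε i j)) =O[atTop]
      fun k : ℕ => 1 / (k : ℝ) ^ (2 * ε i j) := by
    simp only [div_eq_mul_inv, one_mul]
    exact (isBigO_refl _ _).const_mul_left _
  have h2 := (((hR.const_mul_left (π u)).mul hB).mul hη).mul
    (isBigO_const_const ((S.Hbar i * (S.Hbar i)ᵀ) r c) (one_ne_zero (α := ℝ)) atTop)
  refine h2.trans (IsBigO.of_bound 1 ?_)
  filter_upwards [eventually_ge_atTop 1] with k hk
  have hk0 : (0 : ℝ) < k := by exact_mod_cast hk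
  rw [one_mul, one_mul, mul_one, Real.norm_of_nonneg (by positivity),
    Real.norm_of_nonneg (by positivity), one_div_mul_one_div, ← Real.rpow_add hk0]
  exact Finset.single_le_sum (f := fun j => 1 / (k : ℝ) ^ (δ i + 2 * ε i j))
    (fun j _ => by positivity) hj

/-- The Loewner bound compares diagonal entries only; off-diagonal entries of the positive
semidefinite information are at most the mean of two diagonal ones. -/
lemma Env.PolynomialRates.isBigO_meanFisher [IsProbabilityMeasure μ]
    (hM : X.IsMarkov μ p π) (h1 : ∀ u, μ.real {ω | X.chain 1 ω = u} = π u)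
    (hPriv : X.PrivacyNoiseAssumption S μ)
    (hβ : ∀ i k, 1 ≤ k → S.β i k * lamMax (S.Q i) < 1)
    (hsq : ∀ i, Summable fun k : ℕ => S.β i (k + 1) ^ 2)
    (h_ii : ∀ i j, S.Edge i j → S.Q i ≠ 0 →
      Summable fun t : ℕ => X.eta μ i j (t + 1) *
        ∏ l ∈ Finset.Icc 1 (t + 1), (1 - lamMinPos (S.Q i) * S.β i l) ^ 2)
    (h : X.PolynomialRates S μ b δ ε k₀) (hdef : ∀ i k, 1 ≤ k → X.FisherDefined S μ i k)
    (i : Fin N) (r c : Fin (m i)) :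
    (fun k => X.meanFisher S μ i k r c) =O[atTop]
      fun k : ℕ => ∑ j ∈ S.nbr i, 1 / (k : ℝ) ^ (δ i + 2 * ε i j) := by
  refine IsBigO.trans (IsBigO.of_bound (1 / 2) ?_)
    ((h.isBigO_rateBound (π := π) i r r).add (h.isBigO_rateBound (π := π) i c c))
  filter_upwards [eventually_ge_atTop 2] with k hk
  obtain ⟨k, rfl⟩ : ∃ k', k = k' + 1 := ⟨k - 1, by omega⟩
  have hd := hdef i (k + 1) (by omega)
  have hR := h.posSemidef_rateBound_sub hM h1 hPriv hβ hsq h_ii (Or.inr hk) hd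
  have h2 := abs_apply_le_of_posSemidef (Env.posSemidef_meanFisher hPriv hβ hsq h_ii hd) r c
  have h3 := hR.diag_nonneg (i := r)
  have h4 := hR.diag_nonneg (i := c)
  simp only [Matrix.sub_apply] at h3 h4
  rw [Real.norm_eq_abs, Real.norm_eq_abs]
  have := le_abs_self (X.rateBound S μ π b δ ε i (k + 1) r r +
    X.rateBound S μ π b δ ε i (k + 1) c c)
  linarith

lemma Env.PolynomialRates.tendsto_sum_zero (h : X.PolynomialRates S μ b δ ε k₀) (i : Fin N) :
    Tendsto (fun k : ℕ => ∑ j ∈ S.nbr i, 1 / (k : ℝ) ^ (δ i + 2 * ε i j)) atTop (𝓝 0) := by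
  have h0 : (0 : ℝ) = ∑ _j ∈ S.nbr i, 0 := Finset.sum_const_zero.symm
  rw [h0]
  refine tendsto_finsetSum _ fun j hj => ?_
  have hpos : 0 < δ i + 2 * ε i j := by
    have := h.delta_pos i
    have := (h.noise i j (Model.mem_nbr.1 hj)).2.1
    linarith
  simp only [one_div]
  exact ((tendsto_rpow_atTop hpos).comp tendsto_natCast_atTop_atTop).inv_tendsto_atTop

end RateBound

/-! ### Dynamically enhanced privacy -/

section Enhanced

lemma posDef_of_forall_norm_eq_one {r : ℕ} {A : Matrix (Fin r) (Fin r) ℝ} (hA : A.IsHermitian)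
    (h : ∀ v ∈ Metric.sphere (0 : Fin r → ℝ) 1, 0 < v ⬝ᵥ (A *ᵥ v)) : A.PosDef := by
  refine Matrix.PosDef.of_dotProduct_mulVec_pos hA fun v hv => ?_
  have hn : 0 < ‖v‖ := norm_pos_iff.2 hv
  have := h (‖v‖⁻¹ • v) (by simp [norm_smul, hn.ne'])
  rw [Matrix.mulVec_smul, dotProduct_smul, smul_dotProduct, smul_eq_mul, smul_eq_mul] at this
  rw [star_trivial]
  have hi : 0 < ‖v‖⁻¹ := inv_pos.2 hn
  exact pos_of_mul_pos_right (pos_of_mul_pos_right this hi.le) hi.le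

/-- Small symmetric perturbations of a positive definite matrix are positive definite. -/
lemma eventually_posDef_sub {r : ℕ} {A : Matrix (Fin r) (Fin r) ℝ} (hA : A.PosDef)
    {E : ℕ → Matrix (Fin r) (Fin r) ℝ} (hE : ∀ᶠ t in atTop, (E t).IsHermitian)
    (hlim : Tendsto E atTop (𝓝 0)) : ∀ᶠ t in atTop, (A - E t).PosDef := by
  have hcont : Continuous fun z : Matrix (Fin r) (Fin r) ℝ × (Fin r → ℝ) =>
      z.2 ⬝ᵥ ((A - z.1) *ᵥ z.2) := by
    simp only [dotProduct_mulVec_eq_sum, Matrix.sub_apply]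
    fun_prop
  -- Positivity of the form persists near each unit vector and near the zero perturbation;
  -- compactness makes the neighbourhood of perturbations common to all unit vectors.
  have h := (isCompact_sphere (0 : Fin r → ℝ) 1).eventually_forall_of_forall_eventually
    (x₀ := (0 : Matrix (Fin r) (Fin r) ℝ)) (P := fun B v => 0 < v ⬝ᵥ ((A - B) *ᵥ v))
    fun v hv => hcont.continuousAt.eventually (lt_mem_nhds (by
      have hv0 : v ≠ 0 := fun h0 => by simp [h0] at hv
      simpa using hA.dotProduct_mulVec_pos hv0))
  filter_upwards [hlim.eventually h, hE] with t ht hEt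
  exact posDef_of_forall_norm_eq_one (hA.1.sub hEt) ht

variable {N : ℕ} {m : Fin N → ℕ} {J : (i : Fin N) → ℕ → Matrix (Fin (m i)) (Fin (m i)) ℝ}

lemma exists_lt_forall_of_eventually {P : ℕ → Prop} (h : ∀ᶠ t in atTop, P t) (k : ℕ) :
    ∃ T, k < T ∧ ∀ t, T ≤ t → P t := by
  obtain ⟨T, hT⟩ := eventually_atTop.1 (h.and (eventually_gt_atTop k))
  exact ⟨T, (hT T le_rfl).2, fun t ht => (hT t ht).1⟩

lemma DynamicallyEnhanced.of_tendsto (hJ : ∀ i k, 1 ≤ k → (J i k).IsHermitian)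
    (hlim : ∀ i, Tendsto (J i) atTop (𝓝 0)) : DynamicallyEnhanced J := fun i k _ hpos =>
  exists_lt_forall_of_eventually (eventually_posDef_sub hpos
    ((eventually_ge_atTop 1).mono fun t ht => hJ i t ht) (hlim i)) k

lemma DirectionallyEnhanced.of_tendsto (hlim : ∀ i, Tendsto (J i) atTop (𝓝 0)) :
    DirectionallyEnhanced J := fun i k _ v hpos =>
  exists_lt_forall_of_eventually ((((continuous_dotProduct_mulVec v).tendsto 0).comp
    (hlim i)).eventually (gt_mem_nhds (by simpa using hpos))) k

end Enhanced

end PrivEst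

end

/-! ### Assembly of the theorem -/

theorem theorem1 {N n M : ℕ} [NeZero n] {m : Fin N → ℕ} {Ω : Type*} [MeasurableSpace Ω]
    (μ : Measure Ω) [IsProbabilityMeasure μ]
    (S : PrivEst.Model N n M m) (X : PrivEst.Env N n M m Ω)
    (p : Fin M → Fin M → ℝ) (π : Fin M → ℝ) (ζ : Fin N → Fin N → ℕ → ℝ)
    (hMarkov : X.IsMarkov μ p π)
    (hMeas : X.MeasurementAssumption S μ)
    (hNoise : X.NoiseAssumption S μ)
    (hPriv : X.PrivacyNoiseAssumption S μ)
    (hStep : S.StepAssumption ζ)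
    (h_i : ∀ i k, 1 ≤ k → S.β i k * PrivEst.lamMax (S.Q i) < 1)
    (h_ii : ∀ i j, S.Edge i j → S.Q i ≠ 0 →
      Summable fun t : ℕ => X.eta μ i j (t + 1) *
        ∏ l ∈ Finset.Icc 1 (t + 1), (1 - PrivEst.lamMinPos (S.Q i) * S.β i l) ^ 2) :
    -- the likelihoods are conditional probabilities of the signals given the observation
    (∀ i k, 1 ≤ k → ∀ T s, ∀ B : Set (Fin (m i) → ℝ), MeasurableSet B →
      μ {ω | X.obs i k ω ∈ B ∧ X.signals S T ω = s} =
        ∫⁻ ω in X.obs i k ⁻¹' B, ENNReal.ofReal (X.lik S μ i k T s (X.obs i k ω)) ∂μ) ∧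
    -- the Fisher information is defined if all `F` are differentiable with derivative `f`,
    -- or if the observation has a density
    (∀ i k, 1 ≤ k →
      ((∀ i' j' k', 1 ≤ k' → S.Edge i' j' → ∀ x,
          HasDerivAt (X.F μ i' j' k') (X.f i' j' k' x) x) ∨
        μ.map (X.obs i k) ≪ volume) →
      X.FisherDefined S μ i k) ∧
    -- the series bound and its finiteness
    (∀ i k, 1 ≤ k → X.FisherDefined S μ i k →
      (∀ T r c, Integrable (fun ω => X.fisher S μ i k T (X.obs i k ω) r c) μ) ∧
      Tendsto (fun T => X.meanFisherUpTo S μ i k T) atTop (𝓝 (X.meanFisher S μ i k)) ∧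
      (X.seriesBound S μ i k - X.meanFisher S μ i k).PosSemidef ∧
      ∀ j ∈ S.nbr i,
        Summable fun t : ℕ => X.coef S μ i j k (k + 1 + t) • (S.Hbar i * (S.Hbar i)ᵀ)) ∧
    -- the rate and the dynamically enhanced privacy
    (∀ (b δ : Fin N → ℝ) (ε : Fin N → Fin N → ℝ) (k₀ : Fin N → ℕ),
      (∀ u, μ.real {ω | X.chain 1 ω = u} = π u) →
      (∀ i j, S.Edge i j → 0 < X.eta μ i j 1 ∧ 0 ≤ ε i j ∧
        ∀ k : ℕ, 1 ≤ k → X.eta μ i j k ≤ X.eta μ i j 1 / (k : ℝ) ^ (2 * ε i j)) →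
      (∀ i, 1 / 2 < δ i ∧ δ i ≤ 1 ∧ 0 < b i ∧ b i < (k₀ i : ℝ) ^ δ i ∧
        (∀ k : ℕ, 1 ≤ k → S.β i k = if k₀ i ≤ k then b i / (k : ℝ) ^ δ i else 0)) →
      (∀ i j, S.Edge i j → S.Q i ≠ 0 →
        1 < 2 * PrivEst.lamMinPos (S.Q i) * b i + 2 * ε i j) →
      (∀ i k, 1 ≤ k → (δ i < 1 ∨ 2 ≤ k) → X.FisherDefined S μ i k →
        (X.rateBound S μ π b δ ε i k - X.meanFisher S μ i k).PosSemidef) ∧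
      (∀ i r c, (fun k => X.rateBound S μ π b δ ε i k r c) =O[atTop]
        fun k : ℕ => ∑ j ∈ S.nbr i, 1 / (k : ℝ) ^ (δ i + 2 * ε i j)) ∧
      ((∀ i k, 1 ≤ k → X.FisherDefined S μ i k) →
        (∀ i r c, (fun k => X.meanFisher S μ i k r c) =O[atTop]
          fun k : ℕ => ∑ j ∈ S.nbr i, 1 / (k : ℝ) ^ (δ i + 2 * ε i j)) ∧
        PrivEst.DynamicallyEnhanced (fun i k => X.meanFisher S μ i k) ∧
        PrivEst.DirectionallyEnhanced (fun i k => X.meanFisher S μ i k))) := by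
  have hsq := hStep.beta_sq
  refine ⟨?_, ?_, ?_, ?_⟩
  · intro i k hk T s B hB
    -- The auxiliary results count observations from index `0`, which is time `1`.
    obtain ⟨k, rfl⟩ : ∃ k', k = k' + 1 := ⟨k - 1, by omega⟩
    exact PrivEst.Env.measure_signals_eq hNoise hPriv i k s hB
  · intro i k hk h
    obtain ⟨k, rfl⟩ : ∃ k', k = k' + 1 := ⟨k - 1, by omega⟩
    exact PrivEst.Env.fisherDefined hPriv h_i i k h
  · intro i k hk hdef
    obtain ⟨k, rfl⟩ : ∃ k', k = k' + 1 := ⟨k - 1, by omega⟩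
    refine ⟨fun T r c => PrivEst.Env.integrable_fisher hPriv h_i i k T hdef r c,
      PrivEst.Env.tendsto_meanFisher hPriv h_i hsq h_ii hdef,
      PrivEst.Env.posSemidef_seriesBound_sub hPriv h_i hsq h_ii hdef, fun j hj => ?_⟩
    rcases PrivEst.Env.summable_coef_or h_i hsq h_ii i k with h0 | hs
    · simp [h0]
    · exact (hs j hj).smul_const _
  · intro b δ ε k₀ h1 hη hβ hgap
    have hR : X.PolynomialRates S μ b δ ε k₀ := ⟨hη, hβ, hgap⟩
    refine ⟨?_, fun i r c => hR.isBigO_rateBound i r c, fun hdef => ?_⟩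
    · intro i k hk hk2 hdef
      obtain ⟨k, rfl⟩ : ∃ k', k = k' + 1 := ⟨k - 1, by omega⟩
      exact hR.posSemidef_rateBound_sub hMarkov h1 hPriv h_i hsq h_ii hk2 hdef
    · have hO := hR.isBigO_meanFisher hMarkov h1 hPriv h_i hsq h_ii hdef
      -- Convergence of matrices is entrywise, and the rate tends to zero because every exponent `δ
      -- i + 2 * ε i j` on an edge is positive. Both forms of enhanced privacy follow from this
      -- limit.
      have hlim : ∀ i, Tendsto (fun k => X.meanFisher S μ i k) atTop (𝓝 0) := fun i =>
        tendsto_pi_nhds.2 fun r => tendsto_pi_nhds.2 fun c =>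
          (hO i r c).trans_tendsto (hR.tendsto_sum_zero i)
      refine ⟨hO, PrivEst.DynamicallyEnhanced.of_tendsto (fun i k hk => ?_) hlim,
        PrivEst.DirectionallyEnhanced.of_tendsto hlim⟩
      obtain ⟨k, rfl⟩ : ∃ k', k = k' + 1 := ⟨k - 1, by omega⟩
      exact (PrivEst.Env.posSemidef_meanFisher hPriv h_i hsq h_ii (hdef i _ hk)).1
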